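/- **Setting.** Let $r_1,r_2>0$ and let $H:\mathbb{R}^3\to\mathbb{R}$ be an entire harmonic function. For $\epsilon>0$ put $$c_1=\frac{r_2^2-r_1^2-(r_1+r_2+\epsilon)^2}{2(r_1+r_2+\epsilon)},\qquad c_2=c_1+r_1+r_2+\epsilon,$$ and let $B_j$ be the ball with center $(0,0,c_j)$ and radius $r_j$, $j=1,2$ (so the balls are at distance $\epsilon$). Let $\nu$ denote the unit normal on $\partial B_j$ pointing out of $B_j$. Let $u$ be the solution of $$\Delta u=0\ \text{ in }\mathbb{R}^3\setminus\overline{B_1\cup B_2},\quad u=\text{constant on }\partial B_j,\quad \int_{\partial B_j}\partial_\nu u\,d\sigma=0\ (j=1,2),\quad u(\mathbf x)-H(\mathbf x)=O(|\mathbf x|^{-2})\ \text{ as }|\mathbf x|\to\infty,$$ and let $h$ be the solution of $$\Delta h=0\ \text{ in }\mathbb{R}^3\setminus\overline{B_1\cup B_2},\quad h=\text{constant on }\partial B_j,\quad \int_{\partial B_j}\partial_\nu h\,d\sigma=(-1)^{j+1}\ (j=1,2),\quad h(\mathbf x)=O(|\mathbf x|^{-2})\ \text{ as }|\mathbf x|\to\infty$$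 (both classical solutions, $C^1$ up to $\partial B_1\cup\partial B_2$). The concentration factor is $$C_H^\epsilon=\frac{u|_{\partial B_1}-u|_{\partial B_2}}{h|_{\partial B_1}-h|_{\partial B_2}}.$$ Let $\tilde r=\frac{r_1r_2}{r_1+r_2}$ and $\tilde r_j=\frac{r_j}{r_1+r_2}$. Let $\gamma$ be Euler's constant, $\zeta$ the Riemann zeta function, and $\psi_k=\frac{d^{k+1}}{dz^{k+1}}\ln\Gamma$ the polygamma function of order $k\ge 0$. Put $$\mu_j=\frac{\psi_0(\tilde r_j)+\gamma}{\psi_0(\tilde r_1)+\psi_0(\tilde r_2)+2\gamma},\quad j=1,2.$$ **Theorem.** (a) For all sufficiently small $\epsilon>0$ one has $h|_{\partial B_1}\neq h|_{\partial B_2}$, so that $C_H^\epsilon$ is meaningful, and $$C_H^\epsilon=C_H+O(\epsilon|\ln\epsilon|)\quad\text{as }\epsilon\to0^+,$$ with an implied constant that depends only on $r_1,r_2,H$, where $$\begin{aligned}C_H={}&4\pi\mu_1\sum_{m=0}^\infty\Big[\tfrac{\tilde r}{m+1}H\big(0,0,\tfrac{\tilde r}{m+1}\big)-\tfrac{\tilde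 r}{m+\tilde r_2}H\big(0,0,\tfrac{-\tilde r}{m+\tilde r_2}\big)\Big]\\&+4\pi\mu_2\sum_{m=0}^\infty\Big[\tfrac{\tilde r}{m+\tilde r_1}H\big(0,0,\tfrac{\tilde r}{m+\tilde r_1}\big)-\tfrac{\tilde r}{m+1}H\big(0,0,\tfrac{-\tilde r}{m+1}\big)\Big],\end{aligned}$$ and both series converge absolutely. (b) Let $b_{H,k}$, $k\ge1$, be the Taylor coefficients at $0$ of $g(t)=H(0,0,t)-H(\mathbf 0)$; then $H(0,0,t)=H(\mathbf 0)+\sum_{k=1}^\infty b_{H,k}t^k$ for every $t\in\mathbb{R}$, and $$C_H=\sum_{k=1}^\infty b_{H,k}\,\mathcal Q_k(r_1,r_2)$$ (absolutely convergent), where $$\mathcal Q_k(r_1,r_2)=4\pi\tilde r^{\,k+1}\Big[\big(\mu_1+(-1)^{k+1}\mu_2\big)\zeta(k+1)+\frac{\mu_1\psi_k(\tilde r_2)+(-1)^{k+1}\mu_2\psi_k(\tilde r_1)}{k!}\Big].$$ -/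

import Mathlib

open Real Set Filter Topology MeasureTheory Asymptotics

noncomputable section

namespace TwoSpheres

/-- Three dimensional Euclidean space. -/
abbrev E3 : Type := EuclideanSpace ℝ (Fin 3)

/-- The point `t e₃ = (0, 0, t)`. -/
def axisPoint (t : ℝ) : E3 := !₂[(0 : ℝ), 0, t]

/-- The third coordinate of the center of the first ball. -/
def c₁ (r₁ r₂ ε : ℝ) : ℝ :=
  (r₂ ^ 2 - r₁ ^ 2 - (r₁ + r₂ + ε) ^ 2) / (2 * (r₁ + r₂ + ε))

/-- The third coordinate of the center of the second ball. -/
def c₂ (r₁ r₂ ε : ℝ) : ℝ := c₁ r₁ r₂ ε + r₁ + r₂ + ε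

/-- The open region outside the two closed balls. -/
def exterior (r₁ r₂ ε : ℝ) : Set E3 :=
  (Metric.closedBall (axisPoint (c₁ r₁ r₂ ε)) r₁ ∪
    Metric.closedBall (axisPoint (c₂ r₁ r₂ ε)) r₂)ᶜ

/-- The exterior region together with the two spheres bounding it. -/
def closedExterior (r₁ r₂ ε : ℝ) : Set E3 :=
  (Metric.ball (axisPoint (c₁ r₁ r₂ ε)) r₁ ∪
    Metric.ball (axisPoint (c₂ r₁ r₂ ε)) r₂)ᶜ

/-- The flux `∫ ∂_ν u dσ` through the sphere with center `c` and radius `r`, where `ν` is the unit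
normal pointing out of the ball and the gradient of `u` is taken from inside the set `D`. The sphere
is parametrized by the unit sphere with its surface measure (of total mass `4π`). -/
def flux (D : Set E3) (u : E3 → ℝ) (c : E3) (r : ℝ) : ℝ :=
  ∫ ω : Metric.sphere (0 : E3) 1,
    r ^ 2 * fderivWithin ℝ u D (c + r • (ω : E3)) (ω : E3) ∂((volume : Measure E3).toSphere)

/-- The function `u` is harmonic in the exterior region, is `C¹` up to the two spheres, is equal to
the constant `αⱼ` on the `j`-th sphere, and has flux `φⱼ` through the `j`-th sphere. -/
structure IsExteriorPotential (r₁ r₂ ε : ℝ) (u : E3 → ℝ) (α₁ α₂ φ₁ φ₂ : ℝ) : Prop where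
  harmonic : InnerProductSpace.HarmonicOnNhd u (exterior r₁ r₂ ε)
  contDiffOn : ContDiffOn ℝ 1 u (closedExterior r₁ r₂ ε)
  const₁ : ∀ x ∈ Metric.sphere (axisPoint (c₁ r₁ r₂ ε)) r₁, u x = α₁
  const₂ : ∀ x ∈ Metric.sphere (axisPoint (c₂ r₁ r₂ ε)) r₂, u x = α₂
  flux₁ : flux (closedExterior r₁ r₂ ε) u (axisPoint (c₁ r₁ r₂ ε)) r₁ = φ₁
  flux₂ : flux (closedExterior r₁ r₂ ε) u (axisPoint (c₂ r₁ r₂ ε)) r₂ = φ₂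

/-- `u` solves the conductivity problem with external potential `H`, and `αⱼ` is its value on the
`j`-th sphere. -/
def IsElectricPotential (r₁ r₂ ε : ℝ) (H u : E3 → ℝ) (α₁ α₂ : ℝ) : Prop :=
  IsExteriorPotential r₁ r₂ ε u α₁ α₂ 0 0 ∧
    (fun x => u x - H x) =O[Bornology.cobounded E3] (fun x => (‖x‖ ^ 2)⁻¹)

/-- `h` is the singular function, and `βⱼ` is its value on the `j`-th sphere. -/
def IsSingularFunction (r₁ r₂ ε : ℝ) (h : E3 → ℝ) (β₁ β₂ : ℝ) : Prop :=
  IsExteriorPotential r₁ r₂ ε h β₁ β₂ 1 (-1) ∧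
    h =O[Bornology.cobounded E3] (fun x => (‖x‖ ^ 2)⁻¹)

/-- `r̃ = r₁ r₂ / (r₁ + r₂)`. -/
def rt (r₁ r₂ : ℝ) : ℝ := r₁ * r₂ / (r₁ + r₂)

/-- `r̃₁ = r₁ / (r₁ + r₂)`. -/
def rt₁ (r₁ r₂ : ℝ) : ℝ := r₁ / (r₁ + r₂)

/-- `r̃₂ = r₂ / (r₁ + r₂)`. -/
def rt₂ (r₁ r₂ : ℝ) : ℝ := r₂ / (r₁ + r₂)

/-- The polygamma function `ψ_k`, i.e. the `(k + 1)`-st derivative of `ln Γ`, or the `k`-th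
derivative of the digamma function `Γ' / Γ`, at a (positive) real number. -/
def psi (k : ℕ) (x : ℝ) : ℝ := (iteratedDeriv k Complex.digamma (x : ℂ)).re

/-- The weight `μ₁`. -/
def mu₁ (r₁ r₂ : ℝ) : ℝ :=
  (psi 0 (rt₁ r₁ r₂) + eulerMascheroniConstant) /
    (psi 0 (rt₁ r₁ r₂) + psi 0 (rt₂ r₁ r₂) + 2 * eulerMascheroniConstant)

/-- The weight `μ₂`. -/
def mu₂ (r₁ r₂ : ℝ) : ℝ :=
  (psi 0 (rt₂ r₁ r₂) + eulerMascheroniConstant) /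
    (psi 0 (rt₁ r₁ r₂) + psi 0 (rt₂ r₁ r₂) + 2 * eulerMascheroniConstant)

/-- The `m`-th term of the series with factor `4π μ₁` in `C_H`. -/
def term₁ (r₁ r₂ : ℝ) (H : E3 → ℝ) (m : ℕ) : ℝ :=
  rt r₁ r₂ / (m + 1) * H (axisPoint (rt r₁ r₂ / (m + 1)))
    - rt r₁ r₂ / (m + rt₂ r₁ r₂) * H (axisPoint (-rt r₁ r₂ / (m + rt₂ r₁ r₂)))

/-- The `m`-th term of the series with factor `4π μ₂` in `C_H`. -/
def term₂ (r₁ r₂ : ℝ) (H : E3 → ℝ) (m : ℕ) : ℝ :=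
  rt r₁ r₂ / (m + rt₁ r₁ r₂) * H (axisPoint (rt r₁ r₂ / (m + rt₁ r₁ r₂)))
    - rt r₁ r₂ / (m + 1) * H (axisPoint (-rt r₁ r₂ / (m + 1)))

/-- The constant `C_H`. -/
def CH (r₁ r₂ : ℝ) (H : E3 → ℝ) : ℝ :=
  4 * π * mu₁ r₁ r₂ * ∑' m, term₁ r₁ r₂ H m + 4 * π * mu₂ r₁ r₂ * ∑' m, term₂ r₁ r₂ H m

/-- The Taylor coefficient `b_{H,k}` at `0` of `g(t) = H(t e₃) - H(0)`. -/
def taylorCoeff (H : E3 → ℝ) (k : ℕ) : ℝ :=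
  iteratedDeriv k (fun t : ℝ => H (axisPoint t) - H 0) 0 / (k.factorial : ℝ)

/-- The constant `𝒬_k(r₁, r₂)`, for `k ≥ 1`. -/
def Q (k : ℕ) (r₁ r₂ : ℝ) : ℝ :=
  4 * π * rt r₁ r₂ ^ (k + 1) *
    ((mu₁ r₁ r₂ + (-1) ^ (k + 1) * mu₂ r₁ r₂) * (riemannZeta ((k : ℂ) + 1)).re
      + (mu₁ r₁ r₂ * psi k (rt₂ r₁ r₂) + (-1) ^ (k + 1) * mu₂ r₁ r₂ * psi k (rt₁ r₁ r₂))
        / (k.factorial : ℝ))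

end TwoSpheres

end

/-!
The potentials outside two disjoint balls are computed by the method of images, which reduces the
concentration factor to sums over image charges on the axis; these sums are then expanded as the
balls come to touch.

**Images.** Let `w` be harmonic outside the balls, vanish at infinity, and have on the two spheres
the values of two entire harmonic functions. Repeated Kelvin transforms of these functions, taken
alternately in the two spheres, give a series of exterior harmonic functions whose partial sums
match `w` on the spheres up to a geometrically small error. By the maximum principle
(`le_of_le_boundary`) they converge to `w` uniformly, and since the flux through a sphere is bounded
by the supremum of the function in a shell (`abs_flux_le`), the fluxes converge as well. The flux of
a Kelvin transform through the sphere of inversion is read off at the center by the mean value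
property (`flux_kelvin`), so that the flux of `w` depends only on the iterated images at the centers
(`tendsto_flux_images`).

**Bispherical parameters.** Choose `a > 0` and `ξⱼ` with `sinh ξⱼ = a / rⱼ` such that the centers are
at the heights `∓ a coth ξⱼ`; the centers `cⱼ` are normalized so that this is possible
(`exists_foci`). Then all images are evaluated at heights `± a coth θ` with weights `a / sinh θ`, and
reflection in the `j`-th sphere adds `ξⱼ` to `θ` (`charge_kelvin`). The fluxes become sums over
arithmetic progressions of `θ` (`tendsto_flux_charges`).

**The quotient.** Write `T₁`, `T₂` for these sums (without the factor `4π`) when the data are the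
constant `1`, and `S₁`, `S₂` when they are the values of `H`. The flux conditions on `h` and on
`u - H` are linear systems for the boundary values `(β₁, β₂)` and `(α₁, α₂)` with the same symmetric
matrix, whose row sums are `T₁` and `T₂`; eliminating the matrix gives
`(α₁ - α₂) / (β₁ - β₂) = 4π (T₂ S₁ - T₁ S₂) / (T₁ + T₂)` (`exists_charge_sums`).

**The limit.** As `ε → 0` one has `a² ~ 2 r̃ ε`, and the terms `a / sinh θ` and `a coth θ` both tend to
`a / θ`, which gives the series in `C_H`. For data that are constant or linear in the height, the
individual errors are too large, but their sum is a Riemann sum for the integral over `(0, ∞)` of the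
derivative of `1 / sinh θ - 1 / θ`, which vanishes (`abs_sum_cschReg'_le`). The remaining part of `H`
vanishes to second order at `0` and contributes `O(a² |log a|)`. Altogether the sums differ from
their limits by `O(a² (1 + |log a|)) = O(ε |log ε|)` (`imageTerm_asymptotics`). The limits of `T₁` and
`T₂` are `r̃ (ψ₀ + γ)` at `r̃₂` and `r̃₁`, by the series of the digamma function (`hasSum_psi_zero`).
They are negative, so that `T₁ + T₂` stays away from zero and the quotient converges with the same
rate.

**The Taylor coefficients.** Derivatives of an entire harmonic function along the axis are integrals
over spheres of arbitrary radius, which bounds them well enough for the Taylor series to converge on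
the whole axis (`hasSum_taylor_axis`). Inserting it into the series of `C_H` and exchanging the sums
produces values of `ζ` and `ψ_k` (`hasSum_flatTerm_taylor`); the contribution of `H(0)` cancels by
the choice of `μ₁` and `μ₂`.
-/

noncomputable section

namespace TwoSpheres

open InnerProductSpace

/-! ### Integrals over the unit sphere -/

/-- The surface measure on the unit sphere of `E3`, of total mass `4π`. -/
abbrev sphereMeasure : Measure (Metric.sphere (0 : E3) 1) := (volume : Measure E3).toSphere

lemma sphereMeasure_real_univ : sphereMeasure.real univ = 4 * π := by
  rw [Measure.toSphere_real_apply_univ, measureReal_def, EuclideanSpace.volume_ball_fin_three]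
  rw [ENNReal.toReal_mul, ENNReal.toReal_ofReal (by positivity)]
  simp
  ring

lemma measurePreserving_sphere (g : E3 ≃ₗᵢ[ℝ] E3) (f : Metric.sphere (0 : E3) 1 →
    Metric.sphere (0 : E3) 1) (hf : ∀ ω, (f ω : E3) = g ω) :
    MeasurePreserving f sphereMeasure sphereMeasure := by
  have hfc : Continuous f := by
    rw [continuous_induced_rng]
    have : (Subtype.val ∘ f) = fun ω : Metric.sphere (0 : E3) 1 => g ω := by
      ext1 ω; exact hf ω
    rw [this]; fun_prop
  refine ⟨hfc.measurable, ?_⟩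
  ext s hs
  rw [Measure.map_apply hfc.measurable hs, Measure.toSphere_apply' _ (hfc.measurable hs),
    Measure.toSphere_apply' _ hs]
  congr 1
  refine Eq.trans ?_ (g.measurePreserving.measure_preimage_equiv (f := g.toMeasurableEquiv) _)
  congr 1
  ext x
  simp only [Set.mem_smul, Set.mem_image, Set.mem_preimage]
  constructor
  · rintro ⟨t, ht, _, ⟨ω, hω, rfl⟩, rfl⟩
    exact ⟨t, ht, _, ⟨f ω, hω, rfl⟩, by simp [hf]⟩
  · rintro ⟨t, ht, _, ⟨ω, hω, rfl⟩, h⟩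
    have h1 : ‖g.symm (ω : E3)‖ = 1 := by simp
    refine ⟨t, ht, _, ⟨⟨g.symm ω, by simp⟩, ?_, rfl⟩, ?_⟩
    · convert hω
      ext1
      simp [hf]
    · apply g.injective
      simpa using h

/-- The surface measure of the unit sphere is invariant under linear isometries. -/
lemma integral_sphere_comp_isometry (g : E3 ≃ₗᵢ[ℝ] E3) (F : E3 → ℝ) :
    ∫ ω, F (g (ω : E3)) ∂sphereMeasure = ∫ ω, F (ω : E3) ∂sphereMeasure := by
  let f : Metric.sphere (0 : E3) 1 ≃ₜ Metric.sphere (0 : E3) 1 :=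
    { toFun := fun ω => ⟨g ω, by simp⟩
      invFun := fun ω => ⟨g.symm ω, by simp⟩
      left_inv := fun ω => by simp
      right_inv := fun ω => by simp
      continuous_toFun := by fun_prop
      continuous_invFun := by fun_prop }
  have := (measurePreserving_sphere g f (fun _ => rfl)).integral_comp f.measurableEmbedding
    (fun ω : Metric.sphere (0 : E3) 1 => F ω)
  simpa [f] using this

/-- Differentiation under the integral over the unit sphere. -/
lemma hasDerivAt_integral_sphere {F F' : ℝ → Metric.sphere (0 : E3) 1 → ℝ} {t₀ : ℝ} {U : Set ℝ}
    (hU : U ∈ 𝓝 t₀) (hF : ContinuousOn (Function.uncurry F) (U ×ˢ univ))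
    (hF' : ContinuousOn (Function.uncurry F') (U ×ˢ univ))
    (h : ∀ t ∈ U, ∀ ω, HasDerivAt (fun s => F s ω) (F' t ω) t) :
    HasDerivAt (fun t => ∫ ω, F t ω ∂sphereMeasure) (∫ ω, F' t₀ ω ∂sphereMeasure) t₀ := by
  obtain ⟨δ, hδ, hsub⟩ := Metric.nhds_basis_closedBall.mem_iff.1 hU
  have hcont : ∀ G : ℝ → Metric.sphere (0 : E3) 1 → ℝ,
      ContinuousOn (Function.uncurry G) (U ×ˢ univ) → ∀ t ∈ U, Continuous (G t) := by
    intro G hG t ht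
    exact hG.comp_continuous (f := fun ω => (t, ω)) (by fun_prop) (fun ω => ⟨ht, mem_univ _⟩)
  have hK : IsCompact (Metric.closedBall t₀ δ ×ˢ (univ : Set (Metric.sphere (0 : E3) 1))) :=
    (isCompact_closedBall _ _).prod isCompact_univ
  obtain ⟨M, hM⟩ := hK.exists_bound_of_continuousOn
    (hF'.mono (prod_mono hsub (subset_refl _)))
  have ht₀ : t₀ ∈ U := mem_of_mem_nhds hU
  refine (hasDerivAt_integral_of_dominated_loc_of_deriv_le (bound := fun _ => M)
    (Metric.closedBall_mem_nhds t₀ hδ) ?_ ?_ ?_ ?_ ?_ ?_).2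
  · filter_upwards [hU] with t ht
    exact (hcont F hF t ht).aestronglyMeasurable
  · exact (hcont F hF t₀ ht₀).integrable_of_hasCompactSupport (HasCompactSupport.of_compactSpace _)
  · exact (hcont F' hF' t₀ ht₀).aestronglyMeasurable
  · exact Eventually.of_forall fun ω t ht => hM (t, ω) ⟨ht, mem_univ _⟩
  · exact integrable_const _
  · exact Eventually.of_forall fun ω t ht => h t (hsub ht) ω

lemma integrable_sphere {F : Metric.sphere (0 : E3) 1 → ℝ} (hF : Continuous F) :
    Integrable F sphereMeasure :=
  hF.integrable_of_hasCompactSupport (HasCompactSupport.of_compactSpace _)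

/-- The derivative of a `C¹` function along a linear vector field generating rotations has mean
zero on spheres. -/
lemma integral_fderiv_skew (A : E3 →L[ℝ] E3) (hA : star A = -A) {G : E3 → ℝ} {r : ℝ}
    (hr : r ≠ 0) (hG : ∀ ω : Metric.sphere (0 : E3) 1, ContDiffAt ℝ 1 G (r • (ω : E3))) :
    ∫ ω, fderiv ℝ G (r • (ω : E3)) (A ω) ∂sphereMeasure = 0 := by
  have hskew : ∀ t : ℝ, t • A ∈ skewAdjoint (E3 →L[ℝ] E3) := by
    intro t
    rw [skewAdjoint.mem_iff, star_smul, hA]; simp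
  let _ : NormedAlgebra ℚ (E3 →L[ℝ] E3) := NormedAlgebra.restrictScalars ℚ ℝ _
  have hunit : ∀ t : ℝ, NormedSpace.exp (t • A) ∈ unitary (E3 →L[ℝ] E3) := fun t =>
    NormedSpace.exp_mem_unitary_of_mem_skewAdjoint (hskew t)
  let g : ℝ → (E3 ≃ₗᵢ[ℝ] E3) := fun t => Unitary.linearIsometryEquiv ⟨_, hunit t⟩
  have hg : ∀ t x, g t x = NormedSpace.exp (t • A) x := fun t x => rfl
  have hd : ∀ t : ℝ, ∀ x : E3, HasDerivAt (fun s => g s x) (g t (A x)) t := by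
    intro t x
    have h1 := hasDerivAt_exp_smul_const (𝕂 := ℝ) A t
    have := h1.clm_apply (hasDerivAt_const t x)
    simpa [hg] using this
  have hexp : Continuous fun t : ℝ => NormedSpace.exp (t • A) :=
    continuous_iff_continuousAt.2 fun t => (hasDerivAt_exp_smul_const (𝕂 := ℝ) A t).continuousAt
  have hgc : Continuous fun p : ℝ × E3 => g p.1 p.2 := by
    simp only [hg]
    exact (hexp.comp continuous_fst).clm_apply continuous_snd
  have hpt : ∀ (t : ℝ) (ω : Metric.sphere (0 : E3) 1), ContDiffAt ℝ 1 G (r • g t ω) :=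
    fun t ω => hG ⟨g t ω, by simp⟩
  have key := hasDerivAt_integral_sphere (t₀ := 0) (U := univ)
    (F := fun t ω => G (r • g t ω)) (F' := fun t ω => fderiv ℝ G (r • g t ω) (r • g t (A ω)))
    univ_mem ?_ ?_ ?_
  · have hconst : (fun t => ∫ ω, G (r • g t (ω : E3)) ∂sphereMeasure) =
        fun _ => ∫ ω, G (r • (ω : E3)) ∂sphereMeasure := by
      ext t
      exact integral_sphere_comp_isometry (g t) (fun x => G (r • x))
    rw [hconst] at key
    have h0 := key.unique (hasDerivAt_const _ _)
    have hg0 : ∀ x, g 0 x = x := fun x => by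
      rw [hg, show (0 : ℝ) • A = 0 from zero_smul ℝ A, NormedSpace.exp_zero]; rfl
    simp only [hg0, map_smul, smul_eq_mul] at h0
    rw [integral_const_mul] at h0
    exact (mul_eq_zero.1 h0).resolve_left hr
  · refine Continuous.continuousOn ?_
    refine continuous_iff_continuousAt.2 fun p => ?_
    have : ContinuousAt (fun p : ℝ × Metric.sphere (0 : E3) 1 => r • g p.1 (p.2 : E3)) p := by
      have : Continuous (fun p : ℝ × Metric.sphere (0 : E3) 1 => r • g p.1 (p.2 : E3)) :=
        (hgc.comp (continuous_fst.prodMk (continuous_subtype_val.comp continuous_snd))).const_smul r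
      exact this.continuousAt
    exact ContinuousAt.comp (g := G) (hpt p.1 p.2).continuousAt this
  · refine Continuous.continuousOn ?_
    refine continuous_iff_continuousAt.2 fun p => ?_
    have h1 : Continuous (fun p : ℝ × Metric.sphere (0 : E3) 1 => r • g p.1 (p.2 : E3)) :=
      (hgc.comp (continuous_fst.prodMk (continuous_subtype_val.comp continuous_snd))).const_smul r
    have h2 : Continuous (fun p : ℝ × Metric.sphere (0 : E3) 1 => r • g p.1 (A (p.2 : E3))) :=
      (hgc.comp (continuous_fst.prodMk (A.continuous.comp
        (continuous_subtype_val.comp continuous_snd)))).const_smul r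
    have h3 : ContinuousAt (fderiv ℝ G) (r • g p.1 (p.2 : E3)) :=
      ((hpt p.1 p.2).fderiv_right (m := 0) (by simp)).continuousAt
    exact (ContinuousAt.comp (g := fderiv ℝ G) (f := fun p : ℝ × Metric.sphere (0 : E3) 1 =>
      r • g p.1 (p.2 : E3)) h3 h1.continuousAt).clm_apply h2.continuousAt
  · intro t _ ω
    exact ((hpt t ω).differentiableAt (by simp)).hasFDerivAt.comp_hasDerivAt t
      ((hd t ω).const_smul r)

/-- The infinitesimal rotation in the plane of the `i`-th and `j`-th coordinates. -/
def rotGen (i j : Fin 3) : E3 →L[ℝ] E3 :=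
  (EuclideanSpace.proj i : E3 →L[ℝ] ℝ).smulRight (EuclideanSpace.single j (1 : ℝ)) -
    (EuclideanSpace.proj j : E3 →L[ℝ] ℝ).smulRight (EuclideanSpace.single i (1 : ℝ))

lemma rotGen_apply (i j : Fin 3) (x : E3) : rotGen i j x =
    x i • EuclideanSpace.single j (1 : ℝ) - x j • EuclideanSpace.single i (1 : ℝ) := by
  simp [rotGen]

lemma star_rotGen (i j : Fin 3) : star (rotGen i j) = -rotGen i j := by
  rw [ContinuousLinearMap.star_eq_adjoint, eq_comm, ContinuousLinearMap.eq_adjoint_iff]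
  intro x y
  simp [rotGen_apply, inner_sub_left, inner_sub_right, inner_smul_left, inner_smul_right,
    EuclideanSpace.inner_single_left, EuclideanSpace.inner_single_right]
  ring

lemma laplacian_eq_sum (v : E3 → ℝ) (x : E3) : Laplacian.laplacian v x =
    ∑ i : Fin 3, fderiv ℝ (fderiv ℝ v) x (EuclideanSpace.single i 1)
      (EuclideanSpace.single i 1) := by
  rw [InnerProductSpace.laplacian_eq_iteratedFDeriv_orthonormalBasis v
    (EuclideanSpace.basisFun (Fin 3) ℝ)]
  simp [iteratedFDeriv_two_apply]

/-! ### Radial derivatives of spherical means -/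

lemma continuousOn_integral_sphere {F : ℝ → Metric.sphere (0 : E3) 1 → ℝ} {U : Set ℝ}
    (hU : IsCompact U) (hF : ContinuousOn (Function.uncurry F) (U ×ˢ univ)) :
    ContinuousOn (fun t => ∫ ω, F t ω ∂sphereMeasure) U := by
  obtain ⟨M, hM⟩ := (hU.prod (isCompact_univ (X := Metric.sphere (0 : E3) 1))).exists_bound_of_continuousOn hF
  refine continuousOn_of_dominated (bound := fun _ => M) ?_ ?_ (integrable_const _) ?_
  · intro t ht
    exact (hF.comp_continuous (f := fun ω => (t, ω)) (by fun_prop)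
      (fun ω => ⟨ht, mem_univ _⟩)).aestronglyMeasurable
  · exact fun t ht => Eventually.of_forall fun ω => hM (t, ω) ⟨ht, mem_univ _⟩
  · exact Eventually.of_forall fun ω => hF.comp (f := fun t => (t, ω)) (by fun_prop)
      (fun t ht => ⟨ht, mem_univ _⟩)

lemma fderiv_fderiv_symm {v : E3 → ℝ} {x : E3} (hv : ContDiffAt ℝ 2 v x) (y z : E3) :
    fderiv ℝ (fderiv ℝ v) x y z = fderiv ℝ (fderiv ℝ v) x z y :=
  (hv.isSymmSndFDerivAt (by simp)) y z

lemma norm_sq_coords (x : E3) : ‖x‖ ^ 2 = x 0 ^ 2 + x 1 ^ 2 + x 2 ^ 2 := by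
  simp [EuclideanSpace.norm_sq_eq, Fin.sum_univ_three]

lemma eq_sum_coords (x : E3) : x = x 0 • EuclideanSpace.single 0 (1 : ℝ) +
    x 1 • EuclideanSpace.single 1 (1 : ℝ) + x 2 • EuclideanSpace.single 2 (1 : ℝ) := by
  ext i
  fin_cases i <;> simp

/-- The sum of the second derivatives along the three infinitesimal rotations is the angular part
of the Laplacian. -/
lemma sum_rotGen_eq {v : E3 → ℝ} {r : ℝ} {ω : E3} (hω : ‖ω‖ = 1)
    (hv : ContDiffAt ℝ 2 v (r • ω)) :
    (∑ k : Fin 3, (r * fderiv ℝ (fderiv ℝ v) (r • ω) (rotGen k (k + 1) ω) (rotGen k (k + 1) ω) +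
      fderiv ℝ v (r • ω) (rotGen k (k + 1) (rotGen k (k + 1) ω)))) =
    r * Laplacian.laplacian v (r • ω) -
      (r * fderiv ℝ (fderiv ℝ v) (r • ω) ω ω + 2 * fderiv ℝ v (r • ω) ω) := by
  have h1 : ω 0 ^ 2 + ω 1 ^ 2 + ω 2 ^ 2 = 1 := by rw [← norm_sq_coords, hω]; norm_num
  have s01 := fderiv_fderiv_symm hv (EuclideanSpace.single 1 1) (EuclideanSpace.single 0 1)
  have s02 := fderiv_fderiv_symm hv (EuclideanSpace.single 2 1) (EuclideanSpace.single 0 1)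
  have s12 := fderiv_fderiv_symm hv (EuclideanSpace.single 2 1) (EuclideanSpace.single 1 1)
  rw [laplacian_eq_sum]
  generalize hB : fderiv ℝ (fderiv ℝ v) (r • ω) = B at *
  generalize hL : fderiv ℝ v (r • ω) = L at *
  have hBω : B ω ω = B (ω 0 • EuclideanSpace.single 0 (1 : ℝ) +
    ω 1 • EuclideanSpace.single 1 (1 : ℝ) + ω 2 • EuclideanSpace.single 2 (1 : ℝ))
      (ω 0 • EuclideanSpace.single 0 (1 : ℝ) +
    ω 1 • EuclideanSpace.single 1 (1 : ℝ) + ω 2 • EuclideanSpace.single 2 (1 : ℝ)) := by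
    rw [← eq_sum_coords]
  have hLω : L ω = L (ω 0 • EuclideanSpace.single 0 (1 : ℝ) +
    ω 1 • EuclideanSpace.single 1 (1 : ℝ) + ω 2 • EuclideanSpace.single 2 (1 : ℝ)) := by
    rw [← eq_sum_coords]
  rw [hBω, hLω]
  simp only [Fin.sum_univ_three, rotGen_apply, map_sub, map_smul, map_add,
    add_apply, sub_apply, smul_apply,
    smul_eq_mul, s01, s02, s12, PiLp.single_apply,
    Fin.isValue, show (1 : Fin 3) + 1 = 2 from rfl, show (2 : Fin 3) + 1 = 0 from rfl, zero_add]
  norm_num [Fin.ext_iff]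
  linear_combination (r * (B (EuclideanSpace.single 0 1) (EuclideanSpace.single 0 1) +
    B (EuclideanSpace.single 1 1) (EuclideanSpace.single 1 1) +
    B (EuclideanSpace.single 2 1) (EuclideanSpace.single 2 1))) * h1

/-- On a sphere where the Laplacian vanishes, the mean of its radial part vanishes, since the angular
part always has mean zero. -/
lemma integral_radial_laplacian {v : E3 → ℝ} {r : ℝ} (hr : r ≠ 0)
    (hv : ∀ ω : Metric.sphere (0 : E3) 1, ContDiffAt ℝ 2 v (r • (ω : E3)))
    (hΔ : ∀ ω : Metric.sphere (0 : E3) 1, Laplacian.laplacian v (r • (ω : E3)) = 0) :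
    ∫ ω, (r * fderiv ℝ (fderiv ℝ v) (r • (ω : E3)) ω ω + 2 * fderiv ℝ v (r • (ω : E3)) ω)
      ∂sphereMeasure = 0 := by
  have hG : ∀ (k : Fin 3) (ω : Metric.sphere (0 : E3) 1),
      ContDiffAt ℝ 1 (fun x => fderiv ℝ v x (rotGen k (k + 1) x)) (r • (ω : E3)) := fun k ω =>
    ((hv ω).fderiv_right (m := 1) (by norm_num)).clm_apply
      (rotGen k (k + 1)).contDiff.contDiffAt
  have hfd : ∀ (k : Fin 3) (ω : Metric.sphere (0 : E3) 1) (y : E3),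
      fderiv ℝ (fun x => fderiv ℝ v x (rotGen k (k + 1) x)) (r • (ω : E3)) y =
        r * fderiv ℝ (fderiv ℝ v) (r • (ω : E3)) y (rotGen k (k + 1) ω) +
        fderiv ℝ v (r • (ω : E3)) (rotGen k (k + 1) y) := by
    intro k ω y
    have h1 : DifferentiableAt ℝ (fderiv ℝ v) (r • (ω : E3)) :=
      ((hv ω).fderiv_right (m := 1) (by norm_num)).differentiableAt (by simp)
    rw [(h1.hasFDerivAt.clm_apply (rotGen k (k + 1)).hasFDerivAt).fderiv]
    simp [add_comm]
  have h0 : ∀ k : Fin 3, ∫ ω : Metric.sphere (0 : E3) 1,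
      (r * fderiv ℝ (fderiv ℝ v) (r • (ω : E3)) (rotGen k (k + 1) ω) (rotGen k (k + 1) ω) +
      fderiv ℝ v (r • (ω : E3)) (rotGen k (k + 1) (rotGen k (k + 1) (ω : E3)))) ∂sphereMeasure
      = 0 := by
    intro k
    rw [← integral_fderiv_skew (rotGen k (k + 1)) (star_rotGen _ _) hr (hG k)]
    simp only [hfd]
  have hcont : ∀ k : Fin 3, Continuous fun ω : Metric.sphere (0 : E3) 1 =>
      (r * fderiv ℝ (fderiv ℝ v) (r • (ω : E3)) (rotGen k (k + 1) ω) (rotGen k (k + 1) ω) +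
      fderiv ℝ v (r • (ω : E3)) (rotGen k (k + 1) (rotGen k (k + 1) (ω : E3)))) := by
    intro k
    have hs : Continuous fun ω : Metric.sphere (0 : E3) 1 => r • (ω : E3) := by fun_prop
    have h1 : Continuous fun ω : Metric.sphere (0 : E3) 1 => fderiv ℝ v (r • (ω : E3)) :=
      continuous_iff_continuousAt.2 fun ω => ContinuousAt.comp (g := fderiv ℝ v)
        (f := fun ω : Metric.sphere (0 : E3) 1 => r • (ω : E3))
        ((hv ω).fderiv_right (m := 0) (by norm_num)).continuousAt hs.continuousAt
    have h2 : Continuous fun ω : Metric.sphere (0 : E3) 1 =>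
        fderiv ℝ (fderiv ℝ v) (r • (ω : E3)) :=
      continuous_iff_continuousAt.2 fun ω => ContinuousAt.comp (g := fderiv ℝ (fderiv ℝ v))
        (f := fun ω : Metric.sphere (0 : E3) 1 => r • (ω : E3))
        (((hv ω).fderiv_right (m := 1) (by norm_num)).fderiv_right (m := 0)
          (by norm_num)).continuousAt hs.continuousAt
    have h3 : Continuous fun ω : Metric.sphere (0 : E3) 1 => rotGen k (k + 1) (ω : E3) := by
      fun_prop
    exact (continuous_const.mul ((h2.clm_apply h3).clm_apply h3)).add
      (h1.clm_apply ((rotGen k (k + 1)).continuous.comp h3))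
  have hsum := integral_finsetSum (μ := sphereMeasure) Finset.univ
    (fun (k : Fin 3) _ => integrable_sphere (hcont k))
  simp only [h0, Finset.sum_const_zero] at hsum
  rw [← neg_eq_zero, ← integral_neg, ← hsum]
  refine integral_congr_ae (Eventually.of_forall fun ω => ?_)
  simp only
  rw [sum_rotGen_eq (by simp) (hv ω), hΔ ω]
  ring

lemma harmonicAt_comp_add {u : E3 → ℝ} {c x : E3} (h : HarmonicAt u (c + x)) :
    HarmonicAt (fun y => u (c + y)) x := by
  refine ⟨h.1.comp x (by fun_prop : ContDiffAt ℝ 2 (fun y => c + y) x), ?_⟩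
  have : Tendsto (fun y : E3 => c + y) (𝓝 x) (𝓝 (c + x)) :=
    (continuous_const.add continuous_id).continuousAt
  filter_upwards [this.eventually h.2] with y hy
  simp only [laplacian_eq_sum, Pi.zero_apply] at hy ⊢
  rw [← hy]
  have h1 : fderiv ℝ (fun y => u (c + y)) = fun y => fderiv ℝ u (c + y) := by
    ext1 z
    exact fderiv_comp_add_left c
  rw [h1, fderiv_comp_add_left (f := fderiv ℝ u)]

lemma smul_sphere_norm {r : ℝ} (hr : 0 ≤ r) (ω : Metric.sphere (0 : E3) 1) :
    ‖r • (ω : E3)‖ = r := by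
  simp [norm_smul, abs_of_nonneg hr]

lemma hasDerivAt_radial {v : E3 → ℝ} {t : ℝ} {c x : E3}
    (hv : DifferentiableAt ℝ v (c + t • x)) :
    HasDerivAt (fun s : ℝ => v (c + s • x)) (fderiv ℝ v (c + t • x) x) t := by
  have h2 : HasDerivAt (fun s : ℝ => c + s • x) x t := by
    simpa using ((hasDerivAt_id t).smul_const x).const_add c
  exact hv.hasFDerivAt.comp_hasDerivAt t h2

lemma hasDerivAt_radial_fderiv {v : E3 → ℝ} {t : ℝ} {x : E3} (hv : ContDiffAt ℝ 2 v (t • x)) :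
    HasDerivAt (fun s : ℝ => fderiv ℝ v (s • x) x) (fderiv ℝ (fderiv ℝ v) (t • x) x x) t := by
  have h1 : DifferentiableAt ℝ (fderiv ℝ v) (t • x) :=
    (hv.fderiv_right (m := 1) (by norm_num)).differentiableAt (by simp)
  have h2 : HasDerivAt (fun s : ℝ => s • x) x t := by
    simpa using (hasDerivAt_id t).smul_const x
  have h3 : HasFDerivAt (fun y => fderiv ℝ v y x)
      ((fderiv ℝ (fderiv ℝ v) (t • x)).flip x) (t • x) := by
    have := h1.hasFDerivAt.clm_apply (hasFDerivAt_const x (t • x))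
    simpa using this
  exact h3.comp_hasDerivAt t h2

/-- The flux of a harmonic function through concentric spheres is constant. -/
lemma hasDerivAt_flux {u : E3 → ℝ} {c : E3} {a b : ℝ} (ha : 0 ≤ a)
    (hu : ∀ x, a < ‖x‖ → ‖x‖ < b → HarmonicAt u (c + x)) {r : ℝ} (hr : r ∈ Ioo a b) :
    HasDerivAt (fun r => r ^ 2 * ∫ ω : Metric.sphere (0 : E3) 1,
      fderiv ℝ u (c + r • (ω : E3)) (ω : E3) ∂sphereMeasure) 0 r := by
  set v : E3 → ℝ := fun y => u (c + y) with hv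
  have hvd : ∀ x, fderiv ℝ u (c + x) = fderiv ℝ v x := fun x => (fderiv_comp_add_left c).symm
  simp only [hvd]
  have hvh : ∀ x, a < ‖x‖ → ‖x‖ < b → HarmonicAt v x := fun x h1 h2 =>
    harmonicAt_comp_add (hu x h1 h2)
  have hvt : ∀ t ∈ Ioo a b, ∀ ω : Metric.sphere (0 : E3) 1, HarmonicAt v (t • (ω : E3)) := by
    intro t ht ω
    have := smul_sphere_norm (ha.trans ht.1.le) ω
    exact hvh _ (by rw [this]; exact ht.1) (by rw [this]; exact ht.2)
  have hsc : Continuous fun p : ℝ × Metric.sphere (0 : E3) 1 => p.1 • (p.2 : E3) := by fun_prop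
  have hD := hasDerivAt_integral_sphere (t₀ := r) (U := Ioo a b)
    (F := fun t ω => fderiv ℝ v (t • (ω : E3)) (ω : E3))
    (F' := fun t ω => fderiv ℝ (fderiv ℝ v) (t • (ω : E3)) (ω : E3) (ω : E3))
    (Ioo_mem_nhds hr.1 hr.2) ?_ ?_ ?_
  · have hr0 : r ≠ 0 := (ha.trans_lt hr.1).ne'
    have := ((hasDerivAt_id r).pow 2).mul hD
    refine this.congr_deriv ?_
    have h0 := integral_radial_laplacian hr0 (fun ω => (hvt r hr ω).1)
      (fun ω => (hvt r hr ω).2.self_of_nhds)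
    have hs : Continuous fun ω : Metric.sphere (0 : E3) 1 => r • (ω : E3) := by fun_prop
    rw [integral_add, integral_const_mul, integral_const_mul] at h0
    · simp only [id, Nat.cast_ofNat, Pi.pow_apply]
      linear_combination r * h0
    · refine (integrable_sphere ?_).const_mul _
      refine Continuous.clm_apply (Continuous.clm_apply ?_ (by fun_prop)) (by fun_prop)
      exact continuous_iff_continuousAt.2 fun ω => ContinuousAt.comp (g := fderiv ℝ (fderiv ℝ v))
        (f := fun ω : Metric.sphere (0 : E3) 1 => r • (ω : E3))
        (((hvt r hr ω).1.fderiv_right (m := 1) (by norm_num)).fderiv_right (m := 0)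
          (by norm_num)).continuousAt hs.continuousAt
    · refine (integrable_sphere ?_).const_mul _
      refine Continuous.clm_apply ?_ (by fun_prop)
      exact continuous_iff_continuousAt.2 fun ω => ContinuousAt.comp (g := fderiv ℝ v)
        (f := fun ω : Metric.sphere (0 : E3) 1 => r • (ω : E3))
        ((hvt r hr ω).1.fderiv_right (m := 0) (by norm_num)).continuousAt hs.continuousAt
  · intro p hp
    refine ContinuousAt.continuousWithinAt ?_
    refine ContinuousAt.clm_apply ?_ (by fun_prop)
    exact ContinuousAt.comp (g := fderiv ℝ v)
        (f := fun p : ℝ × Metric.sphere (0 : E3) 1 => p.1 • (p.2 : E3))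
        ((hvt p.1 hp.1 p.2).1.fderiv_right (m := 0) (by norm_num)).continuousAt hsc.continuousAt
  · intro p hp
    refine ContinuousAt.continuousWithinAt ?_
    refine ContinuousAt.clm_apply (ContinuousAt.clm_apply ?_ (by fun_prop)) (by fun_prop)
    exact ContinuousAt.comp (g := fderiv ℝ (fderiv ℝ v))
        (f := fun p : ℝ × Metric.sphere (0 : E3) 1 => p.1 • (p.2 : E3))
        (((hvt p.1 hp.1 p.2).1.fderiv_right (m := 1) (by norm_num)).fderiv_right (m := 0)
          (by norm_num)).continuousAt hsc.continuousAt
  · intro t ht ω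
    exact hasDerivAt_radial_fderiv (hvt t ht ω).1

/-! ### The mean value property and flux bounds -/

lemma continuous_add_smul_sphere (c : E3) (r : ℝ) :
    Continuous fun ω : Metric.sphere (0 : E3) 1 => c + r • (ω : E3) := by fun_prop

lemma mem_closedBall_add_smul {c : E3} {r R : ℝ} (hr : 0 ≤ r) (hR : r ≤ R)
    (ω : Metric.sphere (0 : E3) 1) : c + r • (ω : E3) ∈ Metric.closedBall c R := by
  simp [Metric.mem_closedBall, dist_eq_norm, smul_sphere_norm hr, hR]

/-- A harmonic function near a closed ball has no flux through smaller concentric spheres. -/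
lemma integral_fderiv_sphere_eq_zero {u : E3 → ℝ} {c : E3} {R : ℝ}
    (hu : HarmonicOnNhd u (Metric.closedBall c R)) {r : ℝ} (hr : r ∈ Ioo 0 R) :
    ∫ ω : Metric.sphere (0 : E3) 1, fderiv ℝ u (c + r • (ω : E3)) (ω : E3) ∂sphereMeasure = 0 := by
  set Φ : ℝ → ℝ := fun r => r ^ 2 * ∫ ω : Metric.sphere (0 : E3) 1,
      fderiv ℝ u (c + r • (ω : E3)) (ω : E3) ∂sphereMeasure with hΦ
  have hu' : ∀ x : E3, 0 < ‖x‖ → ‖x‖ < R → HarmonicAt u (c + x) := fun x _ h2 =>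
    hu _ (by simpa [Metric.mem_closedBall, dist_eq_norm] using h2.le)
  have hd : ∀ t ∈ Ioo 0 R, HasDerivAt Φ 0 t := fun t ht => hasDerivAt_flux le_rfl hu' ht
  have hconst : ∀ t ∈ Ioo 0 R, Φ t = Φ r := fun t ht =>
    isOpen_Ioo.is_const_of_deriv_eq_zero isPreconnected_Ioo
      (fun x hx => (hd x hx).differentiableAt.differentiableWithinAt) (fun x hx => (hd x hx).deriv) ht hr
  have hcont : ContinuousOn Φ (Icc 0 r) := by
    refine (continuousOn_id.pow 2).mul (continuousOn_integral_sphere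
      (F := fun t ω => fderiv ℝ u (c + t • (ω : E3)) (ω : E3)) isCompact_Icc ?_)
    intro p hp
    refine ContinuousAt.continuousWithinAt (ContinuousAt.clm_apply ?_ (by fun_prop))
    refine ContinuousAt.comp (g := fderiv ℝ u)
        (f := fun p : ℝ × Metric.sphere (0 : E3) 1 => c + p.1 • (p.2 : E3)) ?_ (by fun_prop)
    exact ((hu _ (mem_closedBall_add_smul hp.1.1 (hp.1.2.trans hr.2.le) p.2)).1.fderiv_right
      (m := 0) (by norm_num)).continuousAt
  have h0 : Tendsto Φ (𝓝[>] 0) (𝓝 (Φ 0)) := by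
    have h := hcont 0 ⟨le_rfl, hr.1.le⟩
    exact h.mono_of_mem_nhdsWithin (mem_of_superset (Ioo_mem_nhdsGT hr.1) Ioo_subset_Icc_self)
  have h1 : Tendsto Φ (𝓝[>] 0) (𝓝 (Φ r)) := by
    refine tendsto_const_nhds.congr' ?_
    filter_upwards [Ioo_mem_nhdsGT (hr.1.trans hr.2)] with t ht using (hconst t ht).symm
  have h2 := tendsto_nhds_unique h1 h0
  have h3 : Φ 0 = 0 := by simp [hΦ]
  rw [h3] at h2
  exact (mul_eq_zero.1 h2).resolve_left (pow_ne_zero 2 hr.1.ne')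

lemma exists_larger_ball {u : E3 → ℝ} {c : E3} {R : ℝ} (hR : 0 < R)
    (hu : HarmonicOnNhd u (Metric.closedBall c R)) :
    ∃ R' > R, HarmonicOnNhd u (Metric.closedBall c R') := by
  obtain ⟨δ, hδ, hsub⟩ := (isCompact_closedBall c R).exists_cthickening_subset_open
    (isOpen_setOfPred_harmonicAt (f := u)) (fun x hx => hu x hx)
  refine ⟨R + δ, by linarith, fun x hx => hsub ?_⟩
  rw [cthickening_closedBall hδ.le hR.le, add_comm]
  exact hx

/-- A harmonic function near a closed ball has no flux through its boundary, the boundary sphere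
included. -/
lemma integral_fderiv_sphere {u : E3 → ℝ} {c : E3} {R : ℝ} (hR : 0 < R)
    (hu : HarmonicOnNhd u (Metric.closedBall c R)) :
    ∫ ω : Metric.sphere (0 : E3) 1, fderiv ℝ u (c + R • (ω : E3)) (ω : E3) ∂sphereMeasure = 0 := by
  obtain ⟨R', hR', hu'⟩ := exists_larger_ball hR hu
  exact integral_fderiv_sphere_eq_zero hu' ⟨hR, hR'⟩

/-- The mean value property. -/
lemma integral_sphere_eq {u : E3 → ℝ} {c : E3} {R : ℝ} (hR : 0 < R)
    (hu : HarmonicOnNhd u (Metric.closedBall c R)) :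
    ∫ ω : Metric.sphere (0 : E3) 1, u (c + R • (ω : E3)) ∂sphereMeasure = 4 * π * u c := by
  obtain ⟨R', hR', hu'⟩ := exists_larger_ball hR hu
  set m : ℝ → ℝ := fun r => ∫ ω : Metric.sphere (0 : E3) 1, u (c + r • (ω : E3)) ∂sphereMeasure
    with hm
  have hc : ContinuousOn (fun p : ℝ × Metric.sphere (0 : E3) 1 => u (c + p.1 • (p.2 : E3)))
      (Icc 0 R' ×ˢ univ) := by
    intro p hp
    refine ContinuousAt.continuousWithinAt (ContinuousAt.comp (g := u)
        (f := fun p : ℝ × Metric.sphere (0 : E3) 1 => c + p.1 • (p.2 : E3)) ?_ (by fun_prop))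
    exact (hu' _ (mem_closedBall_add_smul hp.1.1 hp.1.2 p.2)).1.continuousAt
  have hc' : ContinuousOn (fun p : ℝ × Metric.sphere (0 : E3) 1 =>
      fderiv ℝ u (c + p.1 • (p.2 : E3)) (p.2 : E3)) (Icc 0 R' ×ˢ univ) := by
    intro p hp
    refine ContinuousAt.continuousWithinAt (ContinuousAt.clm_apply (ContinuousAt.comp
        (g := fderiv ℝ u)
        (f := fun p : ℝ × Metric.sphere (0 : E3) 1 => c + p.1 • (p.2 : E3)) ?_ (by fun_prop))
        (by fun_prop))
    exact ((hu' _ (mem_closedBall_add_smul hp.1.1 hp.1.2 p.2)).1.fderiv_right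
      (m := 0) (by norm_num)).continuousAt
  have hd : ∀ t ∈ Ioo 0 R', HasDerivAt m 0 t := by
    intro t ht
    have := hasDerivAt_integral_sphere (F := fun t ω => u (c + t • (ω : E3)))
      (F' := fun t ω => fderiv ℝ u (c + t • (ω : E3)) (ω : E3)) (Icc_mem_nhds ht.1 ht.2) hc hc'
      (fun s hs ω => hasDerivAt_radial
        ((hu' _ (mem_closedBall_add_smul hs.1 hs.2 ω)).1.differentiableAt (by norm_num)))
    rwa [integral_fderiv_sphere_eq_zero hu' ht] at this
  have hmc : ContinuousOn m (Icc 0 R) :=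
    (continuousOn_integral_sphere (F := fun t ω => u (c + t • (ω : E3))) isCompact_Icc hc).mono
      (Icc_subset_Icc le_rfl hR'.le)
  have h1 : m R = m 0 := by
    obtain ⟨t, ht, h⟩ := exists_hasDerivAt_eq_slope m (fun _ => 0) hR hmc
      (fun t ht => hd t ⟨ht.1, ht.2.trans hR'⟩)
    rw [eq_comm, div_eq_zero_iff] at h
    rcases h with h | h <;> linarith
  change m R = _
  rw [h1, hm]
  simp only [zero_smul, add_zero]
  rw [integral_const, sphereMeasure_real_univ, smul_eq_mul]

/-- For a function harmonic in a spherical shell and `C¹` up to the inner sphere, the flux through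
the inner sphere is determined by spherical means of the function. -/
lemma spherical_mean_sub {u : E3 → ℝ} {D : Set E3} {c : E3} {r b : ℝ} (hr : 0 < r) (hrb : r < b)
    (hD : UniqueDiffOn ℝ D) (hu : ContDiffOn ℝ 1 u D)
    (hsub : ∀ x, r ≤ ‖x‖ → ‖x‖ ≤ b → c + x ∈ D)
    (hint : ∀ x, r < ‖x‖ → ‖x‖ < b → D ∈ 𝓝 (c + x))
    (hh : ∀ x, r < ‖x‖ → ‖x‖ < b → HarmonicAt u (c + x)) :
    (∫ ω : Metric.sphere (0 : E3) 1, u (c + b • (ω : E3)) ∂sphereMeasure) -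
      ∫ ω : Metric.sphere (0 : E3) 1, u (c + r • (ω : E3)) ∂sphereMeasure =
      flux D u c r * (1 / r - 1 / b) := by
  have hnorm : ∀ t ∈ Icc r b, ∀ ω : Metric.sphere (0 : E3) 1, c + t • (ω : E3) ∈ D := by
    intro t ht ω
    have := smul_sphere_norm (hr.le.trans ht.1) ω
    exact hsub _ (by rw [this]; exact ht.1) (by rw [this]; exact ht.2)
  have hnorm' : ∀ t ∈ Ioo r b, ∀ ω : Metric.sphere (0 : E3) 1,
      r < ‖t • (ω : E3)‖ ∧ ‖t • (ω : E3)‖ < b := by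
    intro t ht ω
    rw [smul_sphere_norm (hr.le.trans ht.1.le) ω]
    exact ht
  have hmaps : MapsTo (fun p : ℝ × Metric.sphere (0 : E3) 1 => c + p.1 • (p.2 : E3))
      (Icc r b ×ˢ univ) D := fun p hp => hnorm p.1 hp.1 p.2
  have hc : ContinuousOn (fun p : ℝ × Metric.sphere (0 : E3) 1 => u (c + p.1 • (p.2 : E3)))
      (Icc r b ×ˢ univ) := hu.continuousOn.comp (by fun_prop) hmaps
  have hc' : ContinuousOn (fun p : ℝ × Metric.sphere (0 : E3) 1 =>
      fderivWithin ℝ u D (c + p.1 • (p.2 : E3)) (p.2 : E3)) (Icc r b ×ˢ univ) :=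
    ((hu.continuousOn_fderivWithin hD (by norm_num)).comp (by fun_prop) hmaps).clm_apply
      (by fun_prop)
  set m : ℝ → ℝ := fun t => ∫ ω : Metric.sphere (0 : E3) 1, u (c + t • (ω : E3)) ∂sphereMeasure
    with hm
  set J : ℝ → ℝ := fun t => ∫ ω : Metric.sphere (0 : E3) 1,
    fderivWithin ℝ u D (c + t • (ω : E3)) (ω : E3) ∂sphereMeasure with hJ
  have hmc : ContinuousOn m (Icc r b) :=
    continuousOn_integral_sphere (F := fun t ω => u (c + t • (ω : E3))) isCompact_Icc hc
  have hJc : ContinuousOn J (Icc r b) :=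
    continuousOn_integral_sphere
      (F := fun t ω => fderivWithin ℝ u D (c + t • (ω : E3)) (ω : E3)) isCompact_Icc hc'
  have hfw : ∀ t ∈ Ioo r b, ∀ ω : Metric.sphere (0 : E3) 1,
      fderivWithin ℝ u D (c + t • (ω : E3)) = fderiv ℝ u (c + t • (ω : E3)) := fun t ht ω =>
    fderivWithin_of_mem_nhds (hint _ (hnorm' t ht ω).1 (hnorm' t ht ω).2)
  have hmd : ∀ t ∈ Ioo r b, HasDerivAt m (J t) t := by
    intro t ht
    refine hasDerivAt_integral_sphere (F := fun t ω => u (c + t • (ω : E3)))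
      (F' := fun t ω => fderivWithin ℝ u D (c + t • (ω : E3)) (ω : E3)) (U := Ioo r b)
      (Ioo_mem_nhds ht.1 ht.2) (hc.mono (prod_mono Ioo_subset_Icc_self le_rfl))
      (hc'.mono (prod_mono Ioo_subset_Icc_self le_rfl)) (fun s hs ω => ?_)
    rw [hfw s hs ω]
    exact hasDerivAt_radial ((hh _ (hnorm' s hs ω).1 (hnorm' s hs ω).2).1.differentiableAt
      (by norm_num))
  have hJd : ∀ t ∈ Ioo r b, HasDerivAt (fun t => t ^ 2 * J t) 0 t := by
    intro t ht
    refine (hasDerivAt_flux hr.le hh ht).congr_of_eventuallyEq ?_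
    filter_upwards [Ioo_mem_nhds ht.1 ht.2] with s hs
    simp only [hJ, hfw s hs]
  have hJconst : ∀ t ∈ Ioo r b, t ^ 2 * J t = r ^ 2 * J r := by
    intro t ht
    obtain ⟨s, hs, h⟩ := exists_hasDerivAt_eq_slope (fun t => t ^ 2 * J t) (fun _ => 0) ht.1
      (((continuousOn_id.pow 2).mul hJc).mono (Icc_subset_Icc le_rfl ht.2.le))
      (fun s hs => hJd s ⟨hs.1, hs.2.trans ht.2⟩)
    have := ht.1
    rw [eq_comm, div_eq_zero_iff] at h
    rcases h with h | h <;> linarith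
  have hflux : flux D u c r = r ^ 2 * J r := by
    rw [flux, integral_const_mul]
  obtain ⟨s, hs, h⟩ := exists_hasDerivAt_eq_slope (fun t => m t + (r ^ 2 * J r) * t⁻¹)
    (fun t => J t + (r ^ 2 * J r) * (-(t ^ 2)⁻¹)) hrb
    (hmc.add (continuousOn_const.mul (continuousOn_id.inv₀ fun t ht => (hr.trans_le ht.1).ne')))
    (fun t ht => (hmd t ht).add 
      ((hasDerivAt_inv (hr.trans ht.1).ne').const_mul (r ^ 2 * J r)))
  have hs0 : s ≠ 0 := (hr.trans hs.1).ne'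
  have h0 : J s + (r ^ 2 * J r) * (-(s ^ 2)⁻¹) = 0 := by
    rw [← hJconst s hs]
    field_simp
    ring
  rw [h0, eq_comm, div_eq_zero_iff] at h
  have h3 : m b + (r ^ 2 * J r) * b⁻¹ - (m r + (r ^ 2 * J r) * r⁻¹) = 0 :=
    h.resolve_right (by linarith)
  change m b - m r = _
  rw [hflux]
  linear_combination h3

/-- The flux through the inner sphere of a shell is controlled by the supremum of the function. -/
lemma abs_flux_le {u : E3 → ℝ} {D : Set E3} {c : E3} {r b δ : ℝ} (hr : 0 < r) (hrb : r < b)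
    (hD : UniqueDiffOn ℝ D) (hu : ContDiffOn ℝ 1 u D)
    (hsub : ∀ x, r ≤ ‖x‖ → ‖x‖ ≤ b → c + x ∈ D)
    (hint : ∀ x, r < ‖x‖ → ‖x‖ < b → D ∈ 𝓝 (c + x))
    (hh : ∀ x, r < ‖x‖ → ‖x‖ < b → HarmonicAt u (c + x)) (hδ : ∀ x ∈ D, |u x| ≤ δ) :
    |flux D u c r| ≤ 8 * π / (1 / r - 1 / b) * δ := by
  have hb : 0 < b := hr.trans hrb
  have hpos : 0 < 1 / r - 1 / b := sub_pos.2 (one_div_lt_one_div_of_lt hr hrb)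
  have hm : ∀ t ∈ Icc r b,
      |∫ ω : Metric.sphere (0 : E3) 1, u (c + t • (ω : E3)) ∂sphereMeasure| ≤ δ * (4 * π) := by
    intro t ht
    rw [← sphereMeasure_real_univ, ← Real.norm_eq_abs]
    refine norm_integral_le_of_norm_le_const (Eventually.of_forall fun ω => hδ _ ?_)
    have := smul_sphere_norm (hr.le.trans ht.1) ω
    exact hsub _ (by rw [this]; exact ht.1) (by rw [this]; exact ht.2)
  have h := spherical_mean_sub hr hrb hD hu hsub hint hh
  have h1 := hm b ⟨hrb.le, le_rfl⟩
  have h2 := hm r ⟨le_rfl, hrb.le⟩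
  rw [div_mul_eq_mul_div, le_div_iff₀ hpos]
  conv_lhs => rw [← abs_of_pos hpos]
  rw [← abs_mul, ← h]
  rw [abs_le] at *
  constructor <;> linarith [h1.1, h1.2, h2.1, h2.2]

/-! ### The maximum principle, and differentiability up to the boundary -/

lemma tendsto_line (x e : E3) : Tendsto (fun s : ℝ => x + s • e) (𝓝 0) (𝓝 x) := by
  have : Continuous fun s : ℝ => x + s • e := by fun_prop
  simpa using this.tendsto 0

lemma hasDerivAt_fderiv_line {v : E3 → ℝ} {x : E3} (hv : ContDiffAt ℝ 2 v x) (e : E3) :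
    HasDerivAt (fun s : ℝ => fderiv ℝ v (x + s • e) e) (fderiv ℝ (fderiv ℝ v) x e e) 0 := by
  have h3 : HasFDerivAt (fun y => fderiv ℝ v y e) ((fderiv ℝ (fderiv ℝ v) x).flip e) x := by
    have h1 : DifferentiableAt ℝ (fderiv ℝ v) x :=
      (hv.fderiv_right (m := 1) (by norm_num)).differentiableAt (by simp)
    have := h1.hasFDerivAt.clm_apply (hasFDerivAt_const e x)
    simpa using this
  have hx : x = x + (0 : ℝ) • e := by simp
  have h4 : HasDerivAt (fun s : ℝ => x + s • e) e 0 := by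
    simpa using ((hasDerivAt_id (0 : ℝ)).smul_const e).const_add x
  rw [hx] at h3
  have := h3.comp_hasDerivAt (0 : ℝ) h4
  rwa [← hx] at this

/-- Second directional derivatives can be computed along a line. -/
lemma fderiv_fderiv_eq_of_hasDerivAt {v : E3 → ℝ} {x e : E3} (hv : ContDiffAt ℝ 2 v x)
    {g₁ : ℝ → ℝ} {g₂ : ℝ} (h₁ : ∀ᶠ s in 𝓝 (0 : ℝ), HasDerivAt (fun t => v (x + t • e)) (g₁ s) s)
    (h₂ : HasDerivAt g₁ g₂ 0) : fderiv ℝ (fderiv ℝ v) x e e = g₂ := by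
  have h6 : g₁ =ᶠ[𝓝 0] fun s : ℝ => fderiv ℝ v (x + s • e) e := by
    filter_upwards [h₁, (tendsto_line x e).eventually (hv.eventually (by simp))] with s hs hs'
    exact hs.unique (hasDerivAt_radial (hs'.differentiableAt (by norm_num)))
  exact (hasDerivAt_fderiv_line hv e).unique (h₂.congr_of_eventuallyEq h6.symm)

lemma fderiv_fderiv_nonpos_of_isLocalMax {v : E3 → ℝ} {x : E3} (hv : ContDiffAt ℝ 2 v x)
    (hx : IsLocalMax v x) (e : E3) : fderiv ℝ (fderiv ℝ v) x e e ≤ 0 := by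
  by_contra! hpos
  set g : ℝ → ℝ := fun s => v (x + s • e) with hg
  have hd : deriv g =ᶠ[𝓝 0] fun s : ℝ => fderiv ℝ v (x + s • e) e := by
    filter_upwards [(tendsto_line x e).eventually (hv.eventually (by simp))] with s hs'
    exact (hasDerivAt_radial (hs'.differentiableAt (by norm_num))).deriv
  have hdd : deriv (deriv g) 0 = fderiv ℝ (fderiv ℝ v) x e e := by
    rw [hd.deriv_eq, (hasDerivAt_fderiv_line hv e).deriv]
  have hmax : IsLocalMax g 0 := by
    have : ∀ᶠ s in 𝓝 (0 : ℝ), v (x + s • e) ≤ v x := (tendsto_line x e).eventually hx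
    simpa [IsLocalMax, IsMaxFilter, hg] using this
  have hgc : ContinuousAt g 0 := by
    have : ContinuousAt v (x + (0 : ℝ) • e) := by simpa using hv.continuousAt
    exact this.comp (f := fun s : ℝ => x + s • e) (by fun_prop)
  -- a strict local minimum that is a local maximum would force `g` to be locally constant
  have hmin : IsLocalMin g 0 :=
    isLocalMin_of_deriv_deriv_pos (by rw [hdd]; exact hpos) hmax.deriv_eq_zero hgc
  have hconst : g =ᶠ[𝓝 0] fun _ => g 0 := by
    filter_upwards [hmax, hmin] with s h1 h2 using le_antisymm h1 h2
  have h0 : deriv g =ᶠ[𝓝 0] fun _ => 0 := by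
    filter_upwards [hconst.eventually_nhds] with s hs
    have hs' : g =ᶠ[𝓝 s] fun _ => g 0 := hs
    rw [hs'.deriv_eq, deriv_const]
  rw [← hdd, h0.deriv_eq, deriv_const] at hpos
  exact lt_irrefl _ hpos

lemma laplacian_norm_sq (κ : ℝ) (x : E3) :
    Laplacian.laplacian (fun y : E3 => κ * ‖y‖ ^ 2) x = 6 * κ := by
  have h1 : fderiv ℝ (fun y : E3 => κ * ‖y‖ ^ 2) = fun y => (2 * κ) • innerSL ℝ y := by
    ext1 y
    have := ((hasStrictFDerivAt_norm_sq y).hasFDerivAt.const_mul κ).fderiv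
    rw [this]
    ext z
    simp
    ring
  have h2 : fderiv ℝ (fun y : E3 => (2 * κ) • innerSL ℝ y) x = (2 * κ) • innerSL ℝ :=
    ((innerSL ℝ (E := E3)).hasFDerivAt.const_smul (2 * κ)).fderiv
  have h3 : ∀ i : Fin 3, ((2 * κ) • innerSL ℝ (E := E3)) (EuclideanSpace.single i 1)
      (EuclideanSpace.single i 1) = 2 * κ := by
    intro i
    change (2 * κ) * inner ℝ (EuclideanSpace.single i (1 : ℝ)) (EuclideanSpace.single i 1) = _
    rw [real_inner_self_eq_norm_sq]
    simp
  rw [laplacian_eq_sum, h1, h2]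
  simp only [h3, Finset.sum_const, Finset.card_univ, Fintype.card_fin, nsmul_eq_mul]
  push_cast
  ring

/-- The maximum principle for harmonic functions on an unbounded region which vanish at infinity. -/
lemma le_of_le_boundary {Ω C : Set E3} (hΩ : IsOpen Ω) (hC : IsClosed C) (hsub : Ω ⊆ C)
    {e : E3 → ℝ} (hh : HarmonicOnNhd e Ω) (hc : ContinuousOn e C) {δ : ℝ} (hδ : 0 ≤ δ)
    (hb : ∀ x ∈ C, x ∉ Ω → e x ≤ δ) (hinf : Tendsto e (Bornology.cobounded E3) (𝓝 0)) :
    ∀ x ∈ C, e x ≤ δ := by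
  intro x₀ hx₀
  by_contra! hlt
  set η := (e x₀ - δ) / 3 with hη
  have hη0 : 0 < η := by rw [hη]; linarith
  have hev : ∀ᶠ x in Bornology.cobounded E3, e x < η := hinf.eventually_lt_const hη0
  rw [← comap_norm_atTop, eventually_comap] at hev
  obtain ⟨R, hR⟩ := eventually_atTop.1 (hev.and (eventually_gt_atTop ‖x₀‖))
  obtain ⟨hR1, hR2⟩ := hR R le_rfl
  have hR0 : 0 < R := (norm_nonneg _).trans_lt hR2
  -- a small multiple of the strictly subharmonic function `‖x‖ ^ 2` excludes interior maxima
  set κ := η / R ^ 2 with hκ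
  have hκ0 : 0 < κ := by positivity
  have hκR : κ * R ^ 2 = η := by rw [hκ]; field_simp
  have hK : IsCompact (C ∩ Metric.closedBall 0 R) := (isCompact_closedBall 0 R).inter_left hC
  obtain ⟨y, hyK, hymax⟩ := hK.exists_isMaxOn (f := fun x => e x + κ * ‖x‖ ^ 2)
    ⟨x₀, hx₀, by simpa using hR2.le⟩
    ((hc.mono inter_subset_left).add (by fun_prop))
  have hyR : ‖y‖ ≤ R := by simpa using hyK.2
  have hx₀y : e x₀ + κ * ‖x₀‖ ^ 2 ≤ e y + κ * ‖y‖ ^ 2 := hymax ⟨hx₀, by simpa using hR2.le⟩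
  have h1 : 0 ≤ κ * ‖x₀‖ ^ 2 := by positivity
  have h2 : κ * ‖y‖ ^ 2 ≤ η := by rw [← hκR]; gcongr
  have hyΩ : y ∈ Ω := by
    by_contra hyΩ
    have := hb y hyK.1 hyΩ
    linarith
  have hyR' : ‖y‖ < R := by
    refine lt_of_le_of_ne hyR fun h => ?_
    have := hR1 y h
    linarith
  have hloc : IsLocalMax (fun x => e x + κ * ‖x‖ ^ 2) y := by
    filter_upwards [hΩ.mem_nhds hyΩ, Metric.isOpen_ball.mem_nhds
      (show y ∈ Metric.ball (0 : E3) R by simpa using hyR')] with z hz1 hz2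
    exact hymax ⟨hsub hz1, Metric.ball_subset_closedBall hz2⟩
  have hcd : ContDiffAt ℝ 2 (fun x : E3 => κ * ‖x‖ ^ 2) y :=
    (contDiff_const.mul (contDiff_norm_sq ℝ)).contDiffAt
  have hsum : Laplacian.laplacian (fun x => e x + κ * ‖x‖ ^ 2) y ≤ 0 := by
    rw [laplacian_eq_sum]
    exact Finset.sum_nonpos fun i _ =>
      fderiv_fderiv_nonpos_of_isLocalMax ((hh y hyΩ).1.add hcd) hloc _
  have hadd := (hh y hyΩ).1.laplacian_add hcd
  have h0 : Laplacian.laplacian e y = 0 := (hh y hyΩ).2.self_of_nhds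
  rw [laplacian_norm_sq, h0] at hadd
  have : (e + fun x : E3 => κ * ‖x‖ ^ 2) = fun x => e x + κ * ‖x‖ ^ 2 := rfl
  rw [this] at hadd
  linarith

lemma abs_le_of_abs_le_boundary {Ω C : Set E3} (hΩ : IsOpen Ω) (hC : IsClosed C) (hsub : Ω ⊆ C)
    {e : E3 → ℝ} (hh : HarmonicOnNhd e Ω) (hc : ContinuousOn e C) {δ : ℝ} (hδ : 0 ≤ δ)
    (hb : ∀ x ∈ C, x ∉ Ω → |e x| ≤ δ) (hinf : Tendsto e (Bornology.cobounded E3) (𝓝 0)) :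
    ∀ x ∈ C, |e x| ≤ δ := by
  intro x hx
  refine abs_le'.2 ⟨le_of_le_boundary hΩ hC hsub hh hc hδ (fun y h1 h2 =>
    (le_abs_self _).trans (hb y h1 h2)) hinf x hx, ?_⟩
  exact le_of_le_boundary (e := -e) hΩ hC hsub hh.neg hc.neg hδ (fun y h1 h2 =>
    (neg_le_abs _).trans (hb y h1 h2)) (by simpa using! hinf.neg) x hx

/-- The complement of a ball contains a half space tangent to a concentric sphere, so that
derivatives within it are unique up to the boundary. -/
lemma uniqueDiffWithinAt_compl_ball (c : E3) {r : ℝ} (hr : 0 < r) {x : E3}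
    (hx : x ∈ (Metric.ball c r)ᶜ) : UniqueDiffWithinAt ℝ (Metric.ball c r)ᶜ x := by
  have hxr : r ≤ ‖x - c‖ := by simpa [dist_eq_norm] using hx
  have hpos : 0 < ‖x - c‖ := hr.trans_le hxr
  -- the half space tangent to the concentric sphere through `x`
  set S : Set E3 := {y | inner ℝ (x - c) x ≤ inner ℝ (x - c) y} with hS
  have hconv : Convex ℝ S := convex_halfSpace_ge (innerSL ℝ (x - c)).isLinear _
  have hopen : IsOpen {y : E3 | inner ℝ (x - c) x < inner ℝ (x - c) y} :=
    isOpen_lt (by fun_prop) (by fun_prop)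
  have hint : (interior S).Nonempty := by
    have hsub : {y : E3 | inner ℝ (x - c) x < inner ℝ (x - c) y} ⊆ S := fun y hy => by
      have hy' : inner ℝ (x - c) x < inner ℝ (x - c) y := hy
      change inner ℝ (x - c) x ≤ inner ℝ (x - c) y
      exact hy'.le
    refine ⟨x + (x - c), interior_maximal hsub hopen ?_⟩
    simp only [mem_ofPred_eq, inner_add_right, real_inner_self_eq_norm_sq]
    nlinarith
  refine (uniqueDiffWithinAt_convex hconv hint (subset_closure (by simp [hS]))).mono ?_
  intro y hy
  have hy' : inner ℝ (x - c) x ≤ inner ℝ (x - c) y := hy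
  have h1 : ‖x - c‖ ^ 2 ≤ inner ℝ (x - c) (y - c) := by
    rw [← real_inner_self_eq_norm_sq, inner_sub_right _ x c, inner_sub_right _ y c]
    linarith
  have h2 := (h1.trans (real_inner_le_norm _ _))
  have h3 : ‖x - c‖ ≤ ‖y - c‖ := by
    by_contra! h
    nlinarith
  simpa [dist_eq_norm] using hxr.trans h3

/-! ### Derivatives along lines for the Kelvin transform -/

/-- Inversion in the sphere with center `c` and radius `r`. The center is mapped to itself, which
is a junk value. -/
def inv3 (c : E3) (r : ℝ) (x : E3) : E3 := c + (r ^ 2 * (‖x - c‖⁻¹) ^ 2) • (x - c)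

/-- The Kelvin transform of `f` with respect to the sphere with center `c` and radius `r`. The
factor `r` makes it agree with `f` on the sphere. Its value at `c` is the junk value `0`. -/
def kelvin (c : E3) (r : ℝ) (f : E3 → ℝ) (x : E3) : ℝ := r * ‖x - c‖⁻¹ * f (inv3 c r x)

lemma hasDerivAt_norm_inv_line {y e : E3} (he : ‖e‖ = 1) {s : ℝ} (hy : y + s • e ≠ 0) :
    HasDerivAt (fun t : ℝ => ‖y + t • e‖⁻¹) (-(inner ℝ y e + s) * ‖y + s • e‖⁻¹ ^ 3) s := by
  have h1 : HasDerivAt (fun t : ℝ => y + t • e) e s := by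
    simpa using ((hasDerivAt_id s).smul_const e).const_add y
  have hpos : 0 < ‖y + s • e‖ := norm_pos_iff.2 hy
  have h2 := h1.norm_sq
  have h3 := h2.sqrt (by positivity)
  simp only [Real.sqrt_sq (norm_nonneg _)] at h3
  have h4 := h3.inv hpos.ne'
  refine h4.congr_deriv ?_
  rw [inner_add_left, inner_smul_left, real_inner_self_eq_norm_sq, he]
  simp
  field_simp
  ring

lemma inv3_add (c : E3) (r : ℝ) (y : E3) : inv3 c r (c + y) = c + (r ^ 2 * ‖y‖⁻¹ ^ 2) • y := by
  simp [inv3]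

lemma kelvin_add (c : E3) (r : ℝ) (f : E3 → ℝ) (y : E3) :
    kelvin c r f (c + y) = r * ‖y‖⁻¹ * f (c + (r ^ 2 * ‖y‖⁻¹ ^ 2) • y) := by
  simp [kelvin, inv3]

section LineDerivatives

variable {f : E3 → ℝ} {c y e : E3} {r : ℝ}

lemma hasDerivAt_inv_line (he : ‖e‖ = 1) {s : ℝ} (hy : y + s • e ≠ 0) :
    HasDerivAt (fun t : ℝ => c + (r ^ 2 * ‖y + t • e‖⁻¹ ^ 2) • (y + t • e))
      ((r ^ 2 * (2 * ‖y + s • e‖⁻¹ * (-(inner ℝ y e + s) * ‖y + s • e‖⁻¹ ^ 3))) • (y + s • e) +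
        (r ^ 2 * ‖y + s • e‖⁻¹ ^ 2) • e) s := by
  have hρ := hasDerivAt_norm_inv_line he hy
  have h1 : HasDerivAt (fun t : ℝ => y + t • e) e s := by
    simpa using ((hasDerivAt_id s).smul_const e).const_add y
  refine ((((hρ.fun_pow 2).const_mul (r ^ 2)).smul h1).const_add c).congr_deriv ?_
  rw [add_comm]
  simp

/-- The first derivative of a Kelvin transform along a line. -/
lemma hasDerivAt_kelvin_line (he : ‖e‖ = 1) {s : ℝ} (hy : y + s • e ≠ 0)
    (hf : DifferentiableAt ℝ f (c + (r ^ 2 * ‖y + s • e‖⁻¹ ^ 2) • (y + s • e))) :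
    HasDerivAt (fun t : ℝ => kelvin c r f (c + (y + t • e)))
      (r * (-(inner ℝ y e + s) * ‖y + s • e‖⁻¹ ^ 3) *
          f (c + (r ^ 2 * ‖y + s • e‖⁻¹ ^ 2) • (y + s • e)) +
        r * ‖y + s • e‖⁻¹ *
        (r ^ 2 * (-2 * (inner ℝ y e + s) * ‖y + s • e‖⁻¹ ^ 4) *
          fderiv ℝ f (c + (r ^ 2 * ‖y + s • e‖⁻¹ ^ 2) • (y + s • e)) (y + s • e) +
        r ^ 2 * ‖y + s • e‖⁻¹ ^ 2 *
          fderiv ℝ f (c + (r ^ 2 * ‖y + s • e‖⁻¹ ^ 2) • (y + s • e)) e)) s := by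
  simp only [kelvin_add]
  have hρ := hasDerivAt_norm_inv_line he hy
  have hγ := hasDerivAt_inv_line (c := c) (r := r) he hy
  have hfγ : HasDerivAt (fun t : ℝ => f (c + (r ^ 2 * ‖y + t • e‖⁻¹ ^ 2) • (y + t • e))) _ s :=
    hf.hasFDerivAt.comp_hasDerivAt s hγ
  refine ((hρ.const_mul r).mul hfγ).congr_deriv ?_
  simp only [map_add, map_smul, smul_eq_mul]
  ring

/-- The second derivative of a Kelvin transform along a line. -/
lemma hasDerivAt_kelvin_line_two (he : ‖e‖ = 1) (hy : y ≠ 0)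
    (hf : ContDiffAt ℝ 2 f (c + (r ^ 2 * ‖y‖⁻¹ ^ 2) • y)) {p q F : ℝ} {D : E3 →L[ℝ] ℝ}
    {B : E3 →L[ℝ] E3 →L[ℝ] ℝ} (hp : p = ‖y‖⁻¹) (hq : q = inner ℝ y e)
    (hF : F = f (c + (r ^ 2 * ‖y‖⁻¹ ^ 2) • y))
    (hD : D = fderiv ℝ f (c + (r ^ 2 * ‖y‖⁻¹ ^ 2) • y))
    (hB : B = fderiv ℝ (fderiv ℝ f) (c + (r ^ 2 * ‖y‖⁻¹ ^ 2) • y)) :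
    HasDerivAt (fun s : ℝ => r * (-(inner ℝ y e + s) * ‖y + s • e‖⁻¹ ^ 3) *
          f (c + (r ^ 2 * ‖y + s • e‖⁻¹ ^ 2) • (y + s • e)) +
        r * ‖y + s • e‖⁻¹ *
        (r ^ 2 * (-2 * (inner ℝ y e + s) * ‖y + s • e‖⁻¹ ^ 4) *
          fderiv ℝ f (c + (r ^ 2 * ‖y + s • e‖⁻¹ ^ 2) • (y + s • e)) (y + s • e) +
        r ^ 2 * ‖y + s • e‖⁻¹ ^ 2 *
          fderiv ℝ f (c + (r ^ 2 * ‖y + s • e‖⁻¹ ^ 2) • (y + s • e)) e))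
      (r * (-p ^ 3 + 3 * q ^ 2 * p ^ 5) * F +
        2 * (r * (-q * p ^ 3)) * (-2 * r ^ 2 * q * p ^ 4 * D y + r ^ 2 * p ^ 2 * D e) +
        r * p * (r ^ 2 * (-2 * p ^ 4 + 8 * q ^ 2 * p ^ 6) * D y -
          4 * r ^ 2 * q * p ^ 4 * D e -
          2 * r ^ 2 * q * p ^ 4 * (-2 * r ^ 2 * q * p ^ 4 * B y y + r ^ 2 * p ^ 2 * B e y) +
          r ^ 2 * p ^ 2 * (-2 * r ^ 2 * q * p ^ 4 * B y e + r ^ 2 * p ^ 2 * B e e))) 0 := by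
  have hy0 : y + (0 : ℝ) • e ≠ 0 := by simpa using hy
  have hz : HasDerivAt (fun t : ℝ => y + t • e) e 0 := by
    simpa using ((hasDerivAt_id (0 : ℝ)).smul_const e).const_add y
  have hρ := hasDerivAt_norm_inv_line he hy0
  have hγ := hasDerivAt_inv_line (c := c) (r := r) he hy0
  have hf0 : ContDiffAt ℝ 2 f (c + (r ^ 2 * ‖y + (0 : ℝ) • e‖⁻¹ ^ 2) • (y + (0 : ℝ) • e)) := by
    simpa using hf
  have hfγ : HasDerivAt (fun t : ℝ => f (c + (r ^ 2 * ‖y + t • e‖⁻¹ ^ 2) • (y + t • e))) _ 0 :=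
    (hf0.differentiableAt (by norm_num)).hasFDerivAt.comp_hasDerivAt 0 hγ
  have hDγ : HasDerivAt (fun t : ℝ => fderiv ℝ f (c + (r ^ 2 * ‖y + t • e‖⁻¹ ^ 2) • (y + t • e)))
      _ 0 :=
    ((hf0.fderiv_right (m := 1) (by norm_num)).differentiableAt
      (by simp)).hasFDerivAt.comp_hasDerivAt 0 hγ
  have hDz := hDγ.clm_apply hz
  have hDe := hDγ.clm_apply (hasDerivAt_const (0 : ℝ) e)
  have hqs : HasDerivAt (fun s : ℝ => inner ℝ y e + s) 1 0 := (hasDerivAt_id _).const_add _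
  have hA := (((hqs.neg.mul (hρ.fun_pow 3)).const_mul r).mul hfγ)
  have hE := ((((hqs.const_mul (-2)).mul (hρ.fun_pow 4)).const_mul (r ^ 2)).mul hDz).add
    (((hρ.fun_pow 2).const_mul (r ^ 2)).mul hDe)
  refine (hA.add ((hρ.const_mul r).mul hE)).congr_deriv ?_
  subst hp hq hF hD hB
  simp only [zero_smul, add_zero, map_add, map_smul, smul_eq_mul, add_apply,
    smul_apply, map_zero, Pi.mul_apply, Pi.neg_apply, Pi.add_apply]
  push_cast
  ring

end LineDerivatives

/-! ### The Kelvin transform -/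

section

variable {f : E3 → ℝ} {c x : E3} {r : ℝ}

lemma continuousAt_inv3 (hx : x ≠ c) : ContinuousAt (inv3 c r) x := by
  have : ‖x - c‖ ≠ 0 := norm_ne_zero_iff.2 (sub_ne_zero.2 hx)
  unfold inv3
  fun_prop (disch := assumption)

lemma contDiffAt_kelvin (hx : x ≠ c) (hf : ContDiffAt ℝ 2 f (inv3 c r x)) :
    ContDiffAt ℝ 2 (kelvin c r f) x := by
  have h0 : x - c ≠ 0 := sub_ne_zero.2 hx
  have h1 : ContDiffAt ℝ 2 (fun y : E3 => y - c) x := by fun_prop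
  have h2 : ContDiffAt ℝ 2 (fun y : E3 => ‖y - c‖⁻¹) x :=
    (h1.norm ℝ h0).inv (norm_ne_zero_iff.2 h0)
  have h3 : ContDiffAt ℝ 2 (inv3 c r) x :=
    contDiffAt_const.add ((contDiffAt_const.mul (h2.pow 2)).smul h1)
  exact (contDiffAt_const.mul h2).mul (hf.comp x h3)

/-- The Laplacian of a Kelvin transform. -/
lemma laplacian_kelvin (hx : x ≠ c) (hf : ContDiffAt ℝ 2 f (inv3 c r x)) :
    Laplacian.laplacian (kelvin c r f) x =
      r ^ 5 * ‖x - c‖⁻¹ ^ 5 * Laplacian.laplacian f (inv3 c r x) := by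
  obtain ⟨y, rfl⟩ : ∃ y, x = c + y := ⟨x - c, by abel⟩
  have hy : y ≠ 0 := by rintro rfl; simp at hx
  have hk := contDiffAt_kelvin hx hf
  rw [inv3_add] at hf
  set p := ‖y‖⁻¹ with hp
  set F := f (c + (r ^ 2 * ‖y‖⁻¹ ^ 2) • y) with hF
  obtain ⟨D, hD⟩ : ∃ D, D = fderiv ℝ f (c + (r ^ 2 * ‖y‖⁻¹ ^ 2) • y) := ⟨_, rfl⟩
  obtain ⟨B, hB⟩ : ∃ B, B = fderiv ℝ (fderiv ℝ f) (c + (r ^ 2 * ‖y‖⁻¹ ^ 2) • y) := ⟨_, rfl⟩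
  have hsnd : ∀ i : Fin 3, fderiv ℝ (fderiv ℝ (kelvin c r f)) (c + y)
      (EuclideanSpace.single i 1) (EuclideanSpace.single i 1) = _ := fun i => by
    refine fderiv_fderiv_eq_of_hasDerivAt hk ?_ (hasDerivAt_kelvin_line_two
      (e := EuclideanSpace.single i 1) (by simp) hy hf hp rfl hF hD hB)
    have h1 : ∀ᶠ s in 𝓝 (0 : ℝ), y + s • EuclideanSpace.single i (1 : ℝ) ≠ 0 :=
      (tendsto_line y _).eventually (isOpen_ne.mem_nhds hy)
    have h2 : ∀ᶠ s in 𝓝 (0 : ℝ), ContDiffAt ℝ 2 f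
        (inv3 c r (c + y + s • EuclideanSpace.single i (1 : ℝ))) := by
      refine (tendsto_line (c + y) _).eventually ((continuousAt_inv3 hx).eventually ?_)
      rw [inv3_add]
      exact hf.eventually (by simp)
    filter_upwards [h1, h2] with s hs1 hs2
    rw [add_assoc, inv3_add] at hs2
    simp only [add_assoc]
    exact hasDerivAt_kelvin_line (by simp) hs1 (hs2.differentiableAt (by norm_num))
  rw [laplacian_eq_sum, laplacian_eq_sum, inv3_add, ← hB]
  simp only [hsnd, add_sub_cancel_left]
  have hN : p ^ 2 * (y 0 ^ 2 + y 1 ^ 2 + y 2 ^ 2) = 1 := by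
    rw [← norm_sq_coords, hp]
    have := norm_ne_zero_iff.2 hy
    field_simp
  have s01 : B (EuclideanSpace.single 1 1) (EuclideanSpace.single 0 1) =
      B (EuclideanSpace.single 0 1) (EuclideanSpace.single 1 1) := by
    rw [hB]; exact fderiv_fderiv_symm hf _ _
  have s02 : B (EuclideanSpace.single 2 1) (EuclideanSpace.single 0 1) =
      B (EuclideanSpace.single 0 1) (EuclideanSpace.single 2 1) := by
    rw [hB]; exact fderiv_fderiv_symm hf _ _
  have s12 : B (EuclideanSpace.single 2 1) (EuclideanSpace.single 1 1) =
      B (EuclideanSpace.single 1 1) (EuclideanSpace.single 2 1) := by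
    rw [hB]; exact fderiv_fderiv_symm hf _ _
  have hyD : D y = D (y 0 • EuclideanSpace.single 0 (1 : ℝ) +
    y 1 • EuclideanSpace.single 1 (1 : ℝ) + y 2 • EuclideanSpace.single 2 (1 : ℝ)) := by
    rw [← eq_sum_coords]
  have hyB : B y = B (y 0 • EuclideanSpace.single 0 (1 : ℝ) +
    y 1 • EuclideanSpace.single 1 (1 : ℝ) + y 2 • EuclideanSpace.single 2 (1 : ℝ)) := by
    rw [← eq_sum_coords]
  have hyB' : ∀ z, B z y = B z (y 0 • EuclideanSpace.single 0 (1 : ℝ) +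
    y 1 • EuclideanSpace.single 1 (1 : ℝ) + y 2 • EuclideanSpace.single 2 (1 : ℝ)) := by
    intro z
    rw [← eq_sum_coords]
  have hBy : B y y = y 0 ^ 2 * B (EuclideanSpace.single 0 1) (EuclideanSpace.single 0 1) +
      y 1 ^ 2 * B (EuclideanSpace.single 1 1) (EuclideanSpace.single 1 1) +
      y 2 ^ 2 * B (EuclideanSpace.single 2 1) (EuclideanSpace.single 2 1) +
      2 * y 0 * y 1 * B (EuclideanSpace.single 0 1) (EuclideanSpace.single 1 1) +
      2 * y 0 * y 2 * B (EuclideanSpace.single 0 1) (EuclideanSpace.single 2 1) +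
      2 * y 1 * y 2 * B (EuclideanSpace.single 1 1) (EuclideanSpace.single 2 1) := by
    rw [hyB', hyB]
    simp only [map_add, map_smul, add_apply, smul_apply, smul_eq_mul, s01, s02, s12]
    ring
  have hDy : D y = y 0 * D (EuclideanSpace.single 0 1) + y 1 * D (EuclideanSpace.single 1 1) +
      y 2 * D (EuclideanSpace.single 2 1) := by
    rw [hyD]; simp only [map_add, map_smul, smul_eq_mul]
  have hB1 : ∀ z, B y z = y 0 * B (EuclideanSpace.single 0 1) z +
      y 1 * B (EuclideanSpace.single 1 1) z + y 2 * B (EuclideanSpace.single 2 1) z := by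
    intro z
    rw [hyB]; simp only [map_add, map_smul, add_apply, smul_apply, smul_eq_mul]
  have hB2 : ∀ z, B z y = y 0 * B z (EuclideanSpace.single 0 1) +
      y 1 * B z (EuclideanSpace.single 1 1) + y 2 * B z (EuclideanSpace.single 2 1) := by
    intro z
    rw [hyB']; simp only [map_add, map_smul, smul_eq_mul]
  simp only [hBy, hDy]
  simp only [hB1, hB2, Fin.sum_univ_three, EuclideanSpace.inner_single_right, s01, s02, s12]
  simp only [conj_trivial, one_mul]
  rw [← hp]
  clear_value F p
  linear_combination (3 * r * p ^ 3 * F + 12 * r ^ 3 * p ^ 5 *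
      (y 0 * D (EuclideanSpace.single 0 1) + y 1 * D (EuclideanSpace.single 1 1) +
      y 2 * D (EuclideanSpace.single 2 1)) + 4 * r ^ 5 * p ^ 7 *
      (y 0 ^ 2 * B (EuclideanSpace.single 0 1) (EuclideanSpace.single 0 1) +
      y 1 ^ 2 * B (EuclideanSpace.single 1 1) (EuclideanSpace.single 1 1) +
      y 2 ^ 2 * B (EuclideanSpace.single 2 1) (EuclideanSpace.single 2 1) +
      2 * y 0 * y 1 * B (EuclideanSpace.single 0 1) (EuclideanSpace.single 1 1) +
      2 * y 0 * y 2 * B (EuclideanSpace.single 0 1) (EuclideanSpace.single 2 1) +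
      2 * y 1 * y 2 * B (EuclideanSpace.single 1 1) (EuclideanSpace.single 2 1))) * hN

/-- Kelvin transforms of harmonic functions are harmonic. -/
lemma harmonicAt_kelvin (hx : x ≠ c) (hf : HarmonicAt f (inv3 c r x)) :
    HarmonicAt (kelvin c r f) x := by
  refine ⟨contDiffAt_kelvin hx hf.1, ?_⟩
  filter_upwards [(continuousAt_inv3 hx).eventually hf.eventually, isOpen_ne.mem_nhds hx]
    with z hz hzc
  rw [laplacian_kelvin hzc hz.1, hz.2.self_of_nhds]
  simp

lemma norm_inv3_sub (hx : x ≠ c) : ‖inv3 c r x - c‖ = r ^ 2 / ‖x - c‖ := by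
  have := norm_ne_zero_iff.2 (sub_ne_zero.2 hx)
  rw [inv3, add_sub_cancel_left, norm_smul]
  simp
  field_simp

lemma ne_of_mem_compl_ball (hr : 0 < r) (hx : x ∈ (Metric.ball c r)ᶜ) : x ≠ c := by
  rintro rfl
  simp [hr] at hx

lemma inv3_mem_closedBall (hr : 0 < r) (hx : x ∈ (Metric.ball c r)ᶜ) :
    inv3 c r x ∈ Metric.closedBall c r := by
  have hxr : r ≤ ‖x - c‖ := by simpa [dist_eq_norm] using hx
  rw [Metric.mem_closedBall, dist_eq_norm, norm_inv3_sub (ne_of_mem_compl_ball hr hx),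
    div_le_iff₀ (hr.trans_le hxr)]
  nlinarith

/-- The Kelvin transform of a function harmonic near a closed ball is harmonic near the complement
of the open ball. -/
lemma harmonicOnNhd_kelvin (hr : 0 < r) (hf : HarmonicOnNhd f (Metric.closedBall c r)) :
    HarmonicOnNhd (kelvin c r f) (Metric.ball c r)ᶜ := fun _ hx =>
  harmonicAt_kelvin (ne_of_mem_compl_ball hr hx) (hf _ (inv3_mem_closedBall hr hx))

lemma kelvin_eq_of_mem_sphere (hr : 0 < r) (hx : x ∈ Metric.sphere c r) :
    kelvin c r f x = f x := by
  have : ‖x - c‖ = r := by simpa [dist_eq_norm] using hx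
  have hr' := hr.ne'
  have h1 : r ^ 2 * r⁻¹ ^ 2 = 1 := by field_simp
  rw [kelvin, inv3, this, h1, mul_inv_cancel₀ hr']
  simp

lemma tendsto_kelvin (hf : ContinuousAt f c) :
    Tendsto (kelvin c r f) (Bornology.cobounded E3) (𝓝 0) := by
  have h0 : Tendsto (fun x : E3 => ‖x - c‖⁻¹) (Bornology.cobounded E3) (𝓝 0) := by
    refine tendsto_inv_atTop_zero.comp ?_
    refine tendsto_atTop_mono (fun x => norm_sub_norm_le x c) ?_
    exact tendsto_atTop_add_const_right _ _ tendsto_norm_cobounded_atTop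
  have h1 : Tendsto (inv3 c r) (Bornology.cobounded E3) (𝓝 c) := by
    rw [tendsto_iff_norm_sub_tendsto_zero]
    have h2 : Tendsto (fun x : E3 => r ^ 2 * ‖x - c‖⁻¹) (Bornology.cobounded E3) (𝓝 0) := by
      simpa using h0.const_mul (r ^ 2)
    refine h2.congr' ?_
    have h3 : ∀ᶠ x in Bornology.cobounded E3, x ≠ c := by
      filter_upwards [(Bornology.isBounded_singleton (x := c) : Bornology.IsBounded {c})]
        with x hx using hx
    filter_upwards [h3] with x hx
    rw [norm_inv3_sub hx, div_eq_mul_inv]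
  simpa [kelvin] using! (h0.const_mul r).mul (hf.tendsto.comp h1)

/-- The flux of a Kelvin transform through the sphere of inversion. -/
lemma flux_kelvin (hr : 0 < r) (hf : HarmonicOnNhd f (Metric.closedBall c r)) :
    ∫ ω : Metric.sphere (0 : E3) 1,
      r ^ 2 * fderiv ℝ (kelvin c r f) (c + r • (ω : E3)) (ω : E3) ∂sphereMeasure =
      -(4 * π) * (r * f c) := by
  have key : ∀ ω : Metric.sphere (0 : E3) 1,
      r ^ 2 * fderiv ℝ (kelvin c r f) (c + r • (ω : E3)) (ω : E3) =
      -r * f (c + r • (ω : E3)) + -r ^ 2 * fderiv ℝ f (c + r • (ω : E3)) (ω : E3) := by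
    intro ω
    have hmem : c + r • (ω : E3) ∈ Metric.sphere c r := by
      simp [norm_smul, abs_of_pos hr]
    have hmem' : c + r • (ω : E3) ∈ (Metric.ball c r)ᶜ := by
      rw [Metric.mem_sphere] at hmem
      simp only [mem_compl_iff, Metric.mem_ball, hmem, lt_irrefl, not_false_eq_true]
    have hd : DifferentiableAt ℝ (kelvin c r f) (c + r • (ω : E3)) :=
      (harmonicOnNhd_kelvin hr hf _ hmem').1.differentiableAt (by norm_num)
    have hdf : DifferentiableAt ℝ f (c + r • (ω : E3)) :=
      (hf _ (Metric.sphere_subset_closedBall hmem)).1.differentiableAt (by norm_num)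
    have h1 := hasDerivAt_radial hd
    have h2 : (fun s : ℝ => kelvin c r f (c + s • (ω : E3))) =ᶠ[𝓝 r]
        fun s : ℝ => r * s⁻¹ * f (c + (r ^ 2 * s⁻¹) • (ω : E3)) := by
      filter_upwards [lt_mem_nhds hr] with s hs
      have hn : ‖s • (ω : E3)‖ = s := smul_sphere_norm hs.le ω
      rw [kelvin_add, hn, smul_smul]
      congr 4
      field_simp
    have hs : HasDerivAt (fun s : ℝ => s⁻¹) (-(r ^ 2)⁻¹) r := hasDerivAt_inv hr.ne'
    have hrr : r ^ 2 * r⁻¹ = r := by field_simp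
    have hdf' : HasFDerivAt f (fderiv ℝ f (c + r • (ω : E3))) (c + (r ^ 2 * r⁻¹) • (ω : E3)) := by
      rw [hrr]; exact hdf.hasFDerivAt
    have h3 := (hs.const_mul r).mul (hdf'.comp_hasDerivAt r
      (((hs.const_mul (r ^ 2)).smul_const (ω : E3)).const_add c))
    have h4 := h1.unique (h3.congr_of_eventuallyEq h2)
    rw [h4]
    simp only [map_smul, smul_eq_mul, hrr, Function.comp_apply]
    field_simp
  have hcf : Continuous fun ω : Metric.sphere (0 : E3) 1 => f (c + r • (ω : E3)) :=
    hf.continuousOn.comp_continuous (continuous_add_smul_sphere c r)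
      (fun ω => mem_closedBall_add_smul hr.le le_rfl ω)
  have hcd : Continuous fun ω : Metric.sphere (0 : E3) 1 =>
      fderiv ℝ f (c + r • (ω : E3)) (ω : E3) := by
    refine Continuous.clm_apply (continuous_iff_continuousAt.2 fun ω =>
      ContinuousAt.comp (g := fderiv ℝ f) (f := fun ω : Metric.sphere (0 : E3) 1 =>
        c + r • (ω : E3)) ?_ (continuous_add_smul_sphere c r).continuousAt) (by fun_prop)
    exact ((hf _ (mem_closedBall_add_smul hr.le le_rfl ω)).1.fderiv_right
      (m := 0) (by norm_num)).continuousAt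
  simp only [key]
  rw [integral_add ((integrable_sphere hcf).const_mul _) ((integrable_sphere hcd).const_mul _),
    integral_const_mul, integral_const_mul, integral_sphere_eq hr hf, integral_fderiv_sphere hr hf]
  ring

end

/-! ### Flux, and repeated reflection in two spheres -/

section Flux

variable {D : Set E3} {u v : E3 → ℝ} {c : E3} {r : ℝ}

lemma integrable_flux (hD : UniqueDiffOn ℝ D) (hs : Metric.sphere c r ⊆ D) (hr : 0 ≤ r)
    (hu : ContDiffOn ℝ 1 u D) :
    Integrable (fun ω : Metric.sphere (0 : E3) 1 =>
      r ^ 2 * fderivWithin ℝ u D (c + r • (ω : E3)) (ω : E3)) sphereMeasure := by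
  refine integrable_sphere (continuous_const.mul (Continuous.clm_apply ?_ (by fun_prop)))
  refine (hu.continuousOn_fderivWithin hD (by norm_num)).comp_continuous
    (continuous_add_smul_sphere c r) (fun ω => hs ?_)
  simp [norm_smul, abs_of_nonneg hr]

lemma sphere_add_smul_mem (hr : 0 ≤ r) (ω : Metric.sphere (0 : E3) 1) :
    c + r • (ω : E3) ∈ Metric.sphere c r := by
  simp [norm_smul, abs_of_nonneg hr]

lemma flux_add (hD : UniqueDiffOn ℝ D) (hs : Metric.sphere c r ⊆ D) (hr : 0 ≤ r)
    (hu : ContDiffOn ℝ 1 u D) (hv : ContDiffOn ℝ 1 v D) :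
    flux D (u + v) c r = flux D u c r + flux D v c r := by
  rw [flux, flux, flux, ← integral_add (integrable_flux hD hs hr hu) (integrable_flux hD hs hr hv)]
  refine integral_congr_ae (Eventually.of_forall fun ω => ?_)
  have hx := hs (sphere_add_smul_mem (c := c) hr ω)
  simp only
  rw [fderivWithin_add (hD _ hx) (hu.differentiableOn (by norm_num) _ hx)
    (hv.differentiableOn (by norm_num) _ hx)]
  simp [mul_add]

lemma flux_const_mul (hD : UniqueDiffOn ℝ D) (hs : Metric.sphere c r ⊆ D) (hr : 0 ≤ r) (k : ℝ)
    (hu : ContDiffOn ℝ 1 u D) :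
    flux D (fun x => k * u x) c r = k * flux D u c r := by
  rw [flux, flux, ← integral_const_mul]
  refine integral_congr_ae (Eventually.of_forall fun ω => ?_)
  have hx := hs (sphere_add_smul_mem (c := c) hr ω)
  simp only
  rw [fderivWithin_const_mul (hD _ hx) (hu.differentiableOn (by norm_num) _ hx)]
  simp
  ring

lemma flux_sub (hD : UniqueDiffOn ℝ D) (hs : Metric.sphere c r ⊆ D) (hr : 0 ≤ r)
    (hu : ContDiffOn ℝ 1 u D) (hv : ContDiffOn ℝ 1 v D) :
    flux D (u - v) c r = flux D u c r - flux D v c r := by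
  have h : u - v = u + fun x => (-1) * v x := by ext x; simp [sub_eq_add_neg]
  rw [h, flux_add hD hs hr hu (contDiffOn_const.mul hv), flux_const_mul hD hs hr _ hv]
  ring

lemma flux_eq_fderiv (hD : UniqueDiffOn ℝ D) (hs : Metric.sphere c r ⊆ D) (hr : 0 ≤ r)
    (hu : ∀ x ∈ D, DifferentiableAt ℝ u x) :
    flux D u c r = ∫ ω : Metric.sphere (0 : E3) 1,
      r ^ 2 * fderiv ℝ u (c + r • (ω : E3)) (ω : E3) ∂sphereMeasure := by
  rw [flux]
  refine integral_congr_ae (Eventually.of_forall fun ω => ?_)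
  have hx := hs (sphere_add_smul_mem (c := c) hr ω)
  simp only
  rw [(hu _ hx).fderivWithin (hD _ hx)]

/-- A function harmonic near a closed ball has no flux through the sphere bounding it. -/
lemma flux_eq_zero (hD : UniqueDiffOn ℝ D) (hs : Metric.sphere c r ⊆ D) (hr : 0 < r)
    (hu : ∀ x ∈ D, DifferentiableAt ℝ u x) (h : HarmonicOnNhd u (Metric.closedBall c r)) :
    flux D u c r = 0 := by
  rw [flux_eq_fderiv hD hs hr.le hu, integral_const_mul, integral_fderiv_sphere hr h, mul_zero]

end Flux

section Images

variable {p₁ p₂ : E3} {r₁ r₂ : ℝ} {f₁ f₂ : E3 → ℝ}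

/-- The complement of two open balls. -/
def outside (p₁ : E3) (r₁ : ℝ) (p₂ : E3) (r₂ : ℝ) : Set E3 :=
  (Metric.ball p₁ r₁ ∪ Metric.ball p₂ r₂)ᶜ

/-- The complement of two closed balls. -/
def outsideOpen (p₁ : E3) (r₁ : ℝ) (p₂ : E3) (r₂ : ℝ) : Set E3 :=
  (Metric.closedBall p₁ r₁ ∪ Metric.closedBall p₂ r₂)ᶜ

lemma outside_comm : outside p₁ r₁ p₂ r₂ = outside p₂ r₂ p₁ r₁ := by
  rw [outside, union_comm, outside]

lemma outsideOpen_comm : outsideOpen p₁ r₁ p₂ r₂ = outsideOpen p₂ r₂ p₁ r₁ := by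
  rw [outsideOpen, union_comm, outsideOpen]

lemma isOpen_outsideOpen : IsOpen (outsideOpen p₁ r₁ p₂ r₂) :=
  (Metric.isClosed_closedBall.union Metric.isClosed_closedBall).isOpen_compl

lemma isClosed_outside : IsClosed (outside p₁ r₁ p₂ r₂) :=
  (Metric.isOpen_ball.union Metric.isOpen_ball).isClosed_compl

lemma outsideOpen_subset : outsideOpen p₁ r₁ p₂ r₂ ⊆ outside p₁ r₁ p₂ r₂ :=
  compl_subset_compl.2 (union_subset_union Metric.ball_subset_closedBall
    Metric.ball_subset_closedBall)

lemma outside_subset_left : outside p₁ r₁ p₂ r₂ ⊆ (Metric.ball p₁ r₁)ᶜ :=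
  compl_subset_compl.2 subset_union_left

lemma outside_subset_right : outside p₁ r₁ p₂ r₂ ⊆ (Metric.ball p₂ r₂)ᶜ :=
  compl_subset_compl.2 subset_union_right

lemma mem_outside_iff {x : E3} : x ∈ outside p₁ r₁ p₂ r₂ ↔ r₁ ≤ dist x p₁ ∧ r₂ ≤ dist x p₂ := by
  simp [outside]

lemma mem_outsideOpen_iff {x : E3} :
    x ∈ outsideOpen p₁ r₁ p₂ r₂ ↔ r₁ < dist x p₁ ∧ r₂ < dist x p₂ := by
  simp [outsideOpen]

lemma dist_lower {x : E3} {t : ℝ} (hx : dist x p₁ ≤ t) : dist p₁ p₂ - t ≤ dist x p₂ := by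
  have := dist_triangle p₁ x p₂
  rw [dist_comm p₁ x] at this
  linarith

lemma closedBall_subset_compl_ball (hd : r₁ + r₂ < dist p₁ p₂) :
    Metric.closedBall p₁ r₁ ⊆ (Metric.ball p₂ r₂)ᶜ := by
  intro x hx
  have := dist_lower (p₂ := p₂) (Metric.mem_closedBall.1 hx)
  simp only [mem_compl_iff, Metric.mem_ball, not_lt]
  linarith

lemma uniqueDiffOn_outside (h₁ : 0 < r₁) (h₂ : 0 < r₂) (hd : r₁ + r₂ < dist p₁ p₂) :
    UniqueDiffOn ℝ (outside p₁ r₁ p₂ r₂) := by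
  intro x hx
  have h12 : outside p₁ r₁ p₂ r₂ = (Metric.ball p₁ r₁)ᶜ ∩ (Metric.ball p₂ r₂)ᶜ := by
    rw [outside, compl_union]
  by_cases hx1 : dist x p₁ ≤ r₁
  · rw [h12]
    refine (uniqueDiffWithinAt_compl_ball p₁ h₁ (outside_subset_left hx)).inter ?_
    refine mem_of_superset ((Metric.isClosed_closedBall (x := p₂) (ε := r₂)).isOpen_compl.mem_nhds
      ?_) (compl_subset_compl.2 Metric.ball_subset_closedBall)
    have := dist_lower (p₂ := p₂) hx1
    simp only [mem_compl_iff, Metric.mem_closedBall, not_le]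
    linarith
  · rw [h12, inter_comm]
    refine (uniqueDiffWithinAt_compl_ball p₂ h₂ (outside_subset_right hx)).inter ?_
    refine mem_of_superset ((Metric.isClosed_closedBall (x := p₁) (ε := r₁)).isOpen_compl.mem_nhds
      ?_) (compl_subset_compl.2 Metric.ball_subset_closedBall)
    simpa using hx1

lemma sphere_subset_outside (hd : r₁ + r₂ < dist p₁ p₂) :
    Metric.sphere p₁ r₁ ⊆ outside p₁ r₁ p₂ r₂ := by
  intro x hx
  have hx' : dist x p₁ = r₁ := hx
  have := dist_lower (p₂ := p₂) hx'.le
  exact mem_outside_iff.2 ⟨hx'.ge, by linarith⟩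

/-- The iterated images of the boundary data `(f₁, f₂)`: the `n`-th pair consists of a function
harmonic near the first closed ball and one harmonic near the second closed ball, and reflecting
each of them in its ball produces, with components exchanged, the next pair. -/
def images (p₁ : E3) (r₁ : ℝ) (p₂ : E3) (r₂ : ℝ) (f₁ f₂ : E3 → ℝ) : ℕ → (E3 → ℝ) × (E3 → ℝ)
  | 0 => (f₁, f₂)
  | n + 1 => (kelvin p₂ r₂ (images p₁ r₁ p₂ r₂ f₁ f₂ n).2,
      kelvin p₁ r₁ (images p₁ r₁ p₂ r₂ f₁ f₂ n).1)

/-- The `N`-th partial sum of the method of images. -/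
def imageSum (p₁ : E3) (r₁ : ℝ) (p₂ : E3) (r₂ : ℝ) (f₁ f₂ : E3 → ℝ) (N : ℕ) :
    E3 → ℝ := fun x => ∑ n ∈ Finset.range N,
  (-1) ^ n * (kelvin p₁ r₁ (images p₁ r₁ p₂ r₂ f₁ f₂ n).1 x +
    kelvin p₂ r₂ (images p₁ r₁ p₂ r₂ f₁ f₂ n).2 x)

lemma images_swap (n : ℕ) :
    images p₂ r₂ p₁ r₁ f₂ f₁ n = (images p₁ r₁ p₂ r₂ f₁ f₂ n).swap := by
  induction n with
  | zero => rfl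
  | succ n ih => simp [images, ih]

lemma imageSum_swap (N : ℕ) :
    imageSum p₂ r₂ p₁ r₁ f₂ f₁ N = imageSum p₁ r₁ p₂ r₂ f₁ f₂ N := by
  ext x
  refine Finset.sum_congr rfl fun n _ => ?_
  rw [images_swap, Prod.fst_swap, Prod.snd_swap]
  ring

lemma harmonicOnNhd_images (h₁ : 0 < r₁) (h₂ : 0 < r₂) (hd : r₁ + r₂ < dist p₁ p₂)
    (hf₁ : HarmonicOnNhd f₁ univ) (hf₂ : HarmonicOnNhd f₂ univ) (n : ℕ) :
    HarmonicOnNhd (images p₁ r₁ p₂ r₂ f₁ f₂ n).1 (Metric.closedBall p₁ r₁) ∧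
    HarmonicOnNhd (images p₁ r₁ p₂ r₂ f₁ f₂ n).2 (Metric.closedBall p₂ r₂) := by
  induction n with
  | zero => exact ⟨hf₁.mono (subset_univ _), hf₂.mono (subset_univ _)⟩
  | succ n ih =>
    refine ⟨(harmonicOnNhd_kelvin h₂ ih.2).mono (closedBall_subset_compl_ball hd),
      (harmonicOnNhd_kelvin h₁ ih.1).mono (closedBall_subset_compl_ball ?_)⟩
    rwa [add_comm, dist_comm]

/-- On each sphere the image sum telescopes to the boundary value, up to one image. -/
lemma imageSum_eq_of_mem_sphere (h₁ : 0 < r₁) {x : E3} (hx : x ∈ Metric.sphere p₁ r₁) (N : ℕ) :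
    imageSum p₁ r₁ p₂ r₂ f₁ f₂ N x =
      f₁ x - (-1) ^ N * (images p₁ r₁ p₂ r₂ f₁ f₂ N).1 x := by
  induction N with
  | zero => simp [imageSum, images]
  | succ N ih =>
    rw [imageSum, Finset.sum_range_succ, ← imageSum, ih, kelvin_eq_of_mem_sphere h₁ hx]
    simp only [images]
    ring

lemma abs_kelvin_le {f : E3 → ℝ} {M δ : ℝ} (h₂ : 0 < r₂) (hδ : 0 < δ)
    (hd : r₁ + r₂ + δ ≤ dist p₁ p₂) (hf : ∀ x ∈ Metric.closedBall p₂ r₂, |f x| ≤ M)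
    {x : E3} (hx : x ∈ Metric.closedBall p₁ r₁) :
    |kelvin p₂ r₂ f x| ≤ r₂ / (r₂ + δ) * M := by
  have h3 := dist_lower (p₂ := p₂) (Metric.mem_closedBall.1 hx)
  have h4 : r₂ + δ ≤ ‖x - p₂‖ := by rw [← dist_eq_norm]; linarith
  have hM : |f (inv3 p₂ r₂ x)| ≤ M :=
    hf _ (inv3_mem_closedBall h₂ (closedBall_subset_compl_ball (by linarith) hx))
  rw [kelvin, abs_mul, abs_mul, abs_of_pos h₂, abs_inv, abs_norm, div_eq_mul_inv]
  gcongr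

/-- The iterated images decay geometrically. -/
lemma exists_images_bound (h₁ : 0 < r₁) (h₂ : 0 < r₂) (hd : r₁ + r₂ < dist p₁ p₂)
    (hf₁ : HarmonicOnNhd f₁ univ) (hf₂ : HarmonicOnNhd f₂ univ) :
    ∃ M ρ : ℝ, 0 ≤ M ∧ 0 ≤ ρ ∧ ρ < 1 ∧ ∀ n,
      (∀ x ∈ Metric.closedBall p₁ r₁, |(images p₁ r₁ p₂ r₂ f₁ f₂ n).1 x| ≤ M * ρ ^ n) ∧
      (∀ x ∈ Metric.closedBall p₂ r₂, |(images p₁ r₁ p₂ r₂ f₁ f₂ n).2 x| ≤ M * ρ ^ n) := by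
  obtain ⟨M₁, hM₁⟩ := (isCompact_closedBall p₁ r₁).exists_bound_of_continuousOn
    (hf₁.continuousOn.mono (subset_univ _))
  obtain ⟨M₂, hM₂⟩ := (isCompact_closedBall p₂ r₂).exists_bound_of_continuousOn
    (hf₂.continuousOn.mono (subset_univ _))
  set δ := dist p₁ p₂ - (r₁ + r₂) with hδ
  have hδ0 : 0 < δ := by linarith
  have hρ₁ : r₁ / (r₁ + δ) < 1 := (div_lt_one (by linarith)).2 (by linarith)
  have hρ₂ : r₂ / (r₂ + δ) < 1 := (div_lt_one (by linarith)).2 (by linarith)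
  have hM : 0 ≤ max M₁ M₂ := le_max_of_le_left
    ((norm_nonneg _).trans (hM₁ p₁ (Metric.mem_closedBall_self h₁.le)))
  have hρ : 0 ≤ max (r₁ / (r₁ + δ)) (r₂ / (r₂ + δ)) := le_max_of_le_left (by positivity)
  refine ⟨max M₁ M₂, max (r₁ / (r₁ + δ)) (r₂ / (r₂ + δ)), hM, hρ, max_lt hρ₁ hρ₂, fun n => ?_⟩
  induction n with
  | zero =>
    refine ⟨fun x hx => ?_, fun x hx => ?_⟩
    · simpa [images] using Or.inl (hM₁ x hx)
    · simpa [images] using Or.inr (hM₂ x hx)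
  | succ n ih =>
    have hn : 0 ≤ max M₁ M₂ * max (r₁ / (r₁ + δ)) (r₂ / (r₂ + δ)) ^ n := by positivity
    refine ⟨fun x hx => ?_, fun x hx => ?_⟩
    · refine (abs_kelvin_le h₂ hδ0 (by linarith) ih.2 hx).trans ?_
      rw [pow_succ', mul_left_comm]
      gcongr
      exact le_max_right _ _
    · refine (abs_kelvin_le h₁ hδ0 (by rw [dist_comm]; linarith) ih.1 hx).trans ?_
      rw [pow_succ', mul_left_comm]
      gcongr
      exact le_max_left _ _

end Images

/-! ### Convergence of the image series -/

section

variable {p₁ p₂ : E3} {r₁ r₂ : ℝ} {f₁ f₂ w : E3 → ℝ}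

lemma harmonicOnNhd_imageSum (h₁ : 0 < r₁) (h₂ : 0 < r₂) (hd : r₁ + r₂ < dist p₁ p₂)
    (hf₁ : HarmonicOnNhd f₁ univ) (hf₂ : HarmonicOnNhd f₂ univ) (N : ℕ) :
    HarmonicOnNhd (imageSum p₁ r₁ p₂ r₂ f₁ f₂ N) (outside p₁ r₁ p₂ r₂) := by
  induction N with
  | zero =>
    have : imageSum p₁ r₁ p₂ r₂ f₁ f₂ 0 = fun _ => 0 := by ext; simp [imageSum]
    rw [this]
    exact harmonicOnNhd_const 0
  | succ N ih =>
    have : imageSum p₁ r₁ p₂ r₂ f₁ f₂ (N + 1) = imageSum p₁ r₁ p₂ r₂ f₁ f₂ N +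
        ((-1 : ℝ) ^ N) • (kelvin p₁ r₁ (images p₁ r₁ p₂ r₂ f₁ f₂ N).1 +
          kelvin p₂ r₂ (images p₁ r₁ p₂ r₂ f₁ f₂ N).2) := by
      ext x; simp [imageSum, Finset.sum_range_succ, mul_add]
    rw [this]
    obtain ⟨hA, hB⟩ := harmonicOnNhd_images h₁ h₂ hd hf₁ hf₂ N
    exact ih.add (((harmonicOnNhd_kelvin h₁ hA).mono outside_subset_left).add
      ((harmonicOnNhd_kelvin h₂ hB).mono outside_subset_right)).const_smul

lemma tendsto_imageSum (h₁ : 0 < r₁) (h₂ : 0 < r₂) (hd : r₁ + r₂ < dist p₁ p₂)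
    (hf₁ : HarmonicOnNhd f₁ univ) (hf₂ : HarmonicOnNhd f₂ univ) (N : ℕ) :
    Tendsto (imageSum p₁ r₁ p₂ r₂ f₁ f₂ N) (Bornology.cobounded E3) (𝓝 0) := by
  have : ∀ n, Tendsto (fun x => (-1) ^ n * (kelvin p₁ r₁ (images p₁ r₁ p₂ r₂ f₁ f₂ n).1 x +
      kelvin p₂ r₂ (images p₁ r₁ p₂ r₂ f₁ f₂ n).2 x)) (Bornology.cobounded E3) (𝓝 0) := by
    intro n
    obtain ⟨hA, hB⟩ := harmonicOnNhd_images h₁ h₂ hd hf₁ hf₂ n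
    simpa using ((tendsto_kelvin (r := r₁)
      (hA _ (Metric.mem_closedBall_self h₁.le)).1.continuousAt).add (tendsto_kelvin (r := r₂)
      (hB _ (Metric.mem_closedBall_self h₂.le)).1.continuousAt)).const_mul ((-1 : ℝ) ^ n)
  have h := tendsto_finsetSum (Finset.range N) (fun n _ => this n)
  simpa [imageSum] using! h

lemma HarmonicOnNhd.contDiffOn_one {u : E3 → ℝ} {D : Set E3} (hu : HarmonicOnNhd u D) :
    ContDiffOn ℝ 1 u D := hu.contDiffOn.of_le (by norm_num)

/-- The flux of the image sum through the first sphere. -/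
lemma flux_imageSum (h₁ : 0 < r₁) (h₂ : 0 < r₂) (hd : r₁ + r₂ < dist p₁ p₂)
    (hf₁ : HarmonicOnNhd f₁ univ) (hf₂ : HarmonicOnNhd f₂ univ) (N : ℕ) :
    flux (outside p₁ r₁ p₂ r₂) (imageSum p₁ r₁ p₂ r₂ f₁ f₂ N) p₁ r₁ =
      -(4 * π) * ∑ n ∈ Finset.range N, (-1) ^ n * (r₁ * (images p₁ r₁ p₂ r₂ f₁ f₂ n).1 p₁) := by
  have hD := uniqueDiffOn_outside h₁ h₂ hd
  have hs := sphere_subset_outside hd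
  induction N with
  | zero =>
    have : imageSum p₁ r₁ p₂ r₂ f₁ f₂ 0 = fun _ => 0 := by ext; simp [imageSum]
    rw [this]
    simp [flux]
  | succ N ih =>
    have hsum : imageSum p₁ r₁ p₂ r₂ f₁ f₂ (N + 1) = imageSum p₁ r₁ p₂ r₂ f₁ f₂ N +
        fun x => ((-1 : ℝ) ^ N) * (kelvin p₁ r₁ (images p₁ r₁ p₂ r₂ f₁ f₂ N).1 +
          kelvin p₂ r₂ (images p₁ r₁ p₂ r₂ f₁ f₂ N).2) x := by
      ext x; simp [imageSum, Finset.sum_range_succ]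
    obtain ⟨hA, hB⟩ := harmonicOnNhd_images h₁ h₂ hd hf₁ hf₂ N
    have hkA := (harmonicOnNhd_kelvin h₁ hA).mono
      (outside_subset_left (p₂ := p₂) (r₂ := r₂))
    have hkB := (harmonicOnNhd_kelvin h₂ hB).mono
      (outside_subset_right (p₁ := p₁) (r₁ := r₁))
    have hkB' := (harmonicOnNhd_kelvin h₂ hB).mono (closedBall_subset_compl_ball hd)
    have hcA := HarmonicOnNhd.contDiffOn_one hkA
    have hcB := HarmonicOnNhd.contDiffOn_one hkB
    have hcAB : ContDiffOn ℝ 1 (kelvin p₁ r₁ (images p₁ r₁ p₂ r₂ f₁ f₂ N).1 +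
        kelvin p₂ r₂ (images p₁ r₁ p₂ r₂ f₁ f₂ N).2) (outside p₁ r₁ p₂ r₂) := hcA.add hcB
    rw [hsum, flux_add hD hs h₁.le (HarmonicOnNhd.contDiffOn_one
      (harmonicOnNhd_imageSum h₁ h₂ hd hf₁ hf₂ N)) (contDiffOn_const.mul hcAB), ih,
      flux_const_mul hD hs h₁.le _ hcAB, flux_add hD hs h₁.le hcA hcB,
      flux_eq_zero hD hs h₁ (fun x hx => (hkB x hx).1.differentiableAt (by norm_num)) hkB',
      flux_eq_fderiv hD hs h₁.le (fun x hx => (hkA x hx).1.differentiableAt (by norm_num)),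
      flux_kelvin h₁ hA, Finset.sum_range_succ]
    ring

/-- The flux through the first sphere of a function harmonic outside two balls, vanishing at
infinity, with boundary values given by the entire harmonic functions `f₁` and `f₂`, is obtained by
the method of images. -/
lemma tendsto_flux_images (h₁ : 0 < r₁) (h₂ : 0 < r₂) (hd : r₁ + r₂ < dist p₁ p₂)
    (hf₁ : HarmonicOnNhd f₁ univ) (hf₂ : HarmonicOnNhd f₂ univ)
    (hw : HarmonicOnNhd w (outsideOpen p₁ r₁ p₂ r₂))
    (hwc : ContDiffOn ℝ 1 w (outside p₁ r₁ p₂ r₂))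
    (hw₁ : ∀ x ∈ Metric.sphere p₁ r₁, w x = f₁ x) (hw₂ : ∀ x ∈ Metric.sphere p₂ r₂, w x = f₂ x)
    (hinf : Tendsto w (Bornology.cobounded E3) (𝓝 0)) :
    Tendsto (fun N => -(4 * π) * ∑ n ∈ Finset.range N,
      (-1) ^ n * (r₁ * (images p₁ r₁ p₂ r₂ f₁ f₂ n).1 p₁)) atTop
      (𝓝 (flux (outside p₁ r₁ p₂ r₂) w p₁ r₁)) := by
  have hD := uniqueDiffOn_outside h₁ h₂ hd
  have hs := sphere_subset_outside hd
  obtain ⟨M, ρ, hM, hρ0, hρ1, hbound⟩ := exists_images_bound h₁ h₂ hd hf₁ hf₂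
  -- by the maximum principle the image sums converge uniformly
  have herr : ∀ N, ∀ x ∈ outside p₁ r₁ p₂ r₂,
      |(w - imageSum p₁ r₁ p₂ r₂ f₁ f₂ N) x| ≤ M * ρ ^ N := by
    intro N
    have hh := harmonicOnNhd_imageSum h₁ h₂ hd hf₁ hf₂ N
    refine abs_le_of_abs_le_boundary isOpen_outsideOpen isClosed_outside outsideOpen_subset
      (hw.sub (hh.mono outsideOpen_subset)) (hwc.continuousOn.sub hh.continuousOn)
      (by positivity) (fun x hx hxΩ => ?_)
      (by simpa using! hinf.sub (tendsto_imageSum h₁ h₂ hd hf₁ hf₂ N))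
    have hx' := mem_outside_iff.1 hx
    rcases hx'.1.eq_or_lt with hx1 | hx1
    · have hxs : x ∈ Metric.sphere p₁ r₁ := hx1.symm
      simp only [Pi.sub_apply, hw₁ x hxs, imageSum_eq_of_mem_sphere h₁ hxs]
      rw [sub_sub_cancel, abs_mul, abs_pow, abs_neg, abs_one, one_pow, one_mul]
      exact (hbound N).1 x (Metric.sphere_subset_closedBall hxs)
    · rcases hx'.2.eq_or_lt with hx2 | hx2
      · have hxs : x ∈ Metric.sphere p₂ r₂ := hx2.symm
        simp only [Pi.sub_apply, hw₂ x hxs]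
        rw [← imageSum_swap, imageSum_eq_of_mem_sphere h₂ hxs, images_swap]
        rw [sub_sub_cancel, abs_mul, abs_pow, abs_neg, abs_one, one_pow, one_mul]
        exact (hbound N).2 x (Metric.sphere_subset_closedBall hxs)
      · exact absurd (mem_outsideOpen_iff.2 ⟨hx1, hx2⟩) hxΩ
  set b := r₁ + (dist p₁ p₂ - (r₁ + r₂)) with hb
  have hrb : r₁ < b := by linarith
  have hdist : ∀ x : E3, dist (p₁ + x) p₁ = ‖x‖ := fun x => by simp [dist_eq_norm]
  have hfl : ∀ N, |flux (outside p₁ r₁ p₂ r₂) (w - imageSum p₁ r₁ p₂ r₂ f₁ f₂ N) p₁ r₁| ≤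
      8 * π / (1 / r₁ - 1 / b) * (M * ρ ^ N) := by
    intro N
    have hh := harmonicOnNhd_imageSum h₁ h₂ hd hf₁ hf₂ N
    have hshell : ∀ x : E3, r₁ < ‖x‖ → ‖x‖ < b → p₁ + x ∈ outsideOpen p₁ r₁ p₂ r₂ := by
      intro x hx1 hx2
      have := dist_lower (p₂ := p₂) (hdist x).le
      exact mem_outsideOpen_iff.2 ⟨by rwa [hdist], by linarith⟩
    refine abs_flux_le h₁ hrb hD (hwc.sub (HarmonicOnNhd.contDiffOn_one hh)) (fun x hx1 hx2 => ?_)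
      (fun x hx1 hx2 => mem_of_superset (isOpen_outsideOpen.mem_nhds (hshell x hx1 hx2))
        outsideOpen_subset)
      (fun x hx1 hx2 => (hw.sub (hh.mono outsideOpen_subset)) _ (hshell x hx1 hx2)) (herr N)
    have := dist_lower (p₂ := p₂) (hdist x).le
    exact mem_outside_iff.2 ⟨by rwa [hdist], by linarith⟩
  rw [tendsto_iff_norm_sub_tendsto_zero]
  have hlim : Tendsto (fun N : ℕ => 8 * π / (1 / r₁ - 1 / b) * (M * ρ ^ N)) atTop (𝓝 0) := by
    simpa using ((tendsto_pow_atTop_nhds_zero_of_lt_one hρ0 hρ1).const_mul M).const_mul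
      (8 * π / (1 / r₁ - 1 / b))
  refine squeeze_zero (fun _ => norm_nonneg _) (fun N => ?_) hlim
  have hh := harmonicOnNhd_imageSum h₁ h₂ hd hf₁ hf₂ N
  rw [← flux_imageSum h₁ h₂ hd hf₁ hf₂, norm_sub_rev, Real.norm_eq_abs,
    ← flux_sub hD hs h₁.le hwc (HarmonicOnNhd.contDiffOn_one hh)]
  exact hfl N

end

/-! ### Image charges on the axis -/

lemma axisPoint_eq (t : ℝ) : axisPoint t = t • EuclideanSpace.single 2 (1 : ℝ) := by
  ext i
  fin_cases i <;> simp [axisPoint]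

lemma axisPoint_add (s t : ℝ) : axisPoint s + axisPoint t = axisPoint (s + t) := by
  simp only [axisPoint_eq, add_smul]

lemma axisPoint_sub (s t : ℝ) : axisPoint s - axisPoint t = axisPoint (s - t) := by
  simp only [axisPoint_eq, sub_smul]

lemma smul_axisPoint (s t : ℝ) : s • axisPoint t = axisPoint (s * t) := by
  simp only [axisPoint_eq, mul_smul]

lemma norm_axisPoint (t : ℝ) : ‖axisPoint t‖ = |t| := by
  simp [axisPoint_eq, norm_smul]

lemma dist_axisPoint (s t : ℝ) : dist (axisPoint s) (axisPoint t) = |s - t| := by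
  rw [dist_eq_norm, axisPoint_sub, norm_axisPoint]

lemma kelvin_axisPoint (q r t : ℝ) (f : E3 → ℝ) (ht : t ≠ q) :
    kelvin (axisPoint q) r f (axisPoint t) =
      r * |t - q|⁻¹ * f (axisPoint (q + r ^ 2 / (t - q))) := by
  have : t - q ≠ 0 := sub_ne_zero.2 ht
  rw [kelvin, inv3, axisPoint_sub, norm_axisPoint, smul_axisPoint, axisPoint_add, inv_pow, sq_abs]
  congr 4
  field_simp

/-- The weighted value `a / sinh θ * G (a coth θ)`: an image charge `a / sinh θ` sits at height
`a coth θ`. -/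
def charge (a : ℝ) (G : ℝ → ℝ) (θ : ℝ) : ℝ := a / sinh θ * G (a * (cosh θ / sinh θ))

lemma coth_add_coth {θ ξ : ℝ} (hθ : 0 < θ) (hξ : 0 < ξ) :
    cosh θ / sinh θ + cosh ξ / sinh ξ = sinh (θ + ξ) / (sinh θ * sinh ξ) := by
  have h1 := (sinh_pos_iff.2 hθ).ne'
  have h2 := (sinh_pos_iff.2 hξ).ne'
  rw [sinh_add]
  field_simp
  ring

lemma coth_sub_eq {θ ξ : ℝ} (hθ : 0 < θ) (hξ : 0 < ξ) :
    cosh ξ / sinh ξ - sinh θ / (sinh ξ * sinh (θ + ξ)) = cosh (θ + ξ) / sinh (θ + ξ) := by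
  have h1 := (sinh_pos_iff.2 hθ).ne'
  have h2 := (sinh_pos_iff.2 hξ).ne'
  have h3 := (sinh_pos_iff.2 (add_pos hθ hξ)).ne'
  field_simp
  rw [sinh_add, cosh_add]
  linear_combination sinh θ * Real.cosh_sq ξ

/-- Reflection in the sphere with center at height `a coth ξ` and radius `a / sinh ξ` shifts the
parameter of an image charge by `ξ`. -/
lemma charge_kelvin {a ξ θ : ℝ} (ha : 0 < a) (hξ : 0 < ξ) (hθ : 0 < θ) (f : E3 → ℝ) :
    charge a (fun t => kelvin (axisPoint (a * (cosh ξ / sinh ξ))) (a / sinh ξ) f (axisPoint (-t))) θ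
      = charge a (fun t => f (axisPoint t)) (θ + ξ) := by
  have h1 := (sinh_pos_iff.2 hθ)
  have h2 := (sinh_pos_iff.2 hξ)
  have h3 := (sinh_pos_iff.2 (add_pos hθ hξ))
  have hd : -(a * (cosh θ / sinh θ)) - a * (cosh ξ / sinh ξ) =
      -(a * (sinh (θ + ξ) / (sinh θ * sinh ξ))) := by
    rw [← coth_add_coth hθ hξ]; ring
  have hpos : 0 < a * (sinh (θ + ξ) / (sinh θ * sinh ξ)) := by positivity
  simp only [charge]
  rw [kelvin_axisPoint _ _ _ _ (by rw [← sub_ne_zero, hd]; exact neg_ne_zero.2 hpos.ne'), hd,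
    abs_neg, abs_of_pos hpos, ← coth_sub_eq hθ hξ]
  have e1 : a * (cosh ξ / sinh ξ) + (a / sinh ξ) ^ 2 / -(a * (sinh (θ + ξ) / (sinh θ * sinh ξ))) =
      a * (cosh ξ / sinh ξ - sinh θ / (sinh ξ * sinh (θ + ξ))) := by
    field_simp
    ring
  rw [e1, ← mul_assoc]
  congr 1
  field_simp

/-- The mirror image of `charge_kelvin`. -/
lemma charge_kelvin_neg {a ξ θ : ℝ} (ha : 0 < a) (hξ : 0 < ξ) (hθ : 0 < θ) (f : E3 → ℝ) :
    charge a (fun t => kelvin (axisPoint (-(a * (cosh ξ / sinh ξ)))) (a / sinh ξ) f (axisPoint t)) θ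
      = charge a (fun t => f (axisPoint (-t))) (θ + ξ) := by
  have h1 := (sinh_pos_iff.2 hθ)
  have h2 := (sinh_pos_iff.2 hξ)
  have h3 := (sinh_pos_iff.2 (add_pos hθ hξ))
  have hd : (a * (cosh θ / sinh θ)) - -(a * (cosh ξ / sinh ξ)) =
      (a * (sinh (θ + ξ) / (sinh θ * sinh ξ))) := by
    rw [← coth_add_coth hθ hξ]; ring
  have hpos : 0 < a * (sinh (θ + ξ) / (sinh θ * sinh ξ)) := by positivity
  simp only [charge]
  rw [kelvin_axisPoint _ _ _ _ (by rw [← sub_ne_zero, hd]; exact hpos.ne'), hd,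
    abs_of_pos hpos, ← coth_sub_eq hθ hξ]
  have e1 : -(a * (cosh ξ / sinh ξ)) + (a / sinh ξ) ^ 2 / (a * (sinh (θ + ξ) / (sinh θ * sinh ξ))) =
      -(a * (cosh ξ / sinh ξ - sinh θ / (sinh ξ * sinh (θ + ξ)))) := by
    field_simp
    ring
  rw [e1, ← mul_assoc]
  congr 1
  field_simp

/-- The `m`-th pair of image charges, with data `U` from the other sphere and `V` from the sphere
with parameter `ξ`, where `s = ξ₁ + ξ₂` is the shift by one pair of reflections. -/
def imageTerm (a s ξ : ℝ) (U V : ℝ → ℝ) (m : ℕ) : ℝ :=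
  charge a U ((m + 1) * s) - charge a V (m * s + ξ)

section AxisImages

variable {a ξ₁ ξ₂ : ℝ} {f₁ f₂ w : E3 → ℝ}

/-- The images of the boundary data, for the two spheres in bispherical coordinates. -/
abbrev axisImages (a ξ₁ ξ₂ : ℝ) (f₁ f₂ : E3 → ℝ) (n : ℕ) : (E3 → ℝ) × (E3 → ℝ) :=
  images (axisPoint (-(a * (cosh ξ₁ / sinh ξ₁)))) (a / sinh ξ₁)
    (axisPoint (a * (cosh ξ₂ / sinh ξ₂))) (a / sinh ξ₂) f₁ f₂ n

/-- Two consecutive reflections shift the parameter of an image charge by `ξ₁ + ξ₂`. -/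
lemma charge_axisImages (ha : 0 < a) (h₁ : 0 < ξ₁) (h₂ : 0 < ξ₂) (k : ℕ) :
    ∀ θ, 0 < θ →
    charge a (fun t => (axisImages a ξ₁ ξ₂ f₁ f₂ (2 * k)).1 (axisPoint (-t))) θ =
      charge a (fun t => f₁ (axisPoint (-t))) (k * (ξ₁ + ξ₂) + θ) ∧
    charge a (fun t => (axisImages a ξ₁ ξ₂ f₁ f₂ (2 * k)).2 (axisPoint t)) θ =
      charge a (fun t => f₂ (axisPoint t)) (k * (ξ₁ + ξ₂) + θ) := by
  induction k with
  | zero => intro θ _; simp [axisImages, images]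
  | succ k ih =>
    intro θ hθ
    have e : 2 * (k + 1) = (2 * k + 1) + 1 := by ring
    refine ⟨?_, ?_⟩
    · rw [e]
      simp only [axisImages, images]
      rw [charge_kelvin ha h₂ hθ, charge_kelvin_neg ha h₁ (add_pos hθ h₂),
        (ih _ (add_pos (add_pos hθ h₂) h₁)).1]
      push_cast
      congr 1
      ring
    · rw [e]
      simp only [axisImages, images]
      rw [charge_kelvin_neg ha h₁ hθ, charge_kelvin ha h₂ (add_pos hθ h₁),
        (ih _ (add_pos (add_pos hθ h₁) h₂)).2]
      push_cast
      congr 1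
      ring

/-- After an odd number of reflections the image stems from the boundary data of the other sphere. -/
lemma charge_axisImages_odd (ha : 0 < a) (h₁ : 0 < ξ₁) (h₂ : 0 < ξ₂) (k : ℕ) {θ : ℝ}
    (hθ : 0 < θ) :
    charge a (fun t => (axisImages a ξ₁ ξ₂ f₁ f₂ (2 * k + 1)).1 (axisPoint (-t))) θ =
      charge a (fun t => f₂ (axisPoint t)) (k * (ξ₁ + ξ₂) + (θ + ξ₂)) ∧
    charge a (fun t => (axisImages a ξ₁ ξ₂ f₁ f₂ (2 * k + 1)).2 (axisPoint t)) θ =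
      charge a (fun t => f₁ (axisPoint (-t))) (k * (ξ₁ + ξ₂) + (θ + ξ₁)) := by
  simp only [axisImages, images]
  rw [charge_kelvin ha h₂ hθ, charge_kelvin_neg ha h₁ hθ]
  exact ⟨(charge_axisImages ha h₁ h₂ k _ (add_pos hθ h₂)).2,
    (charge_axisImages ha h₁ h₂ k _ (add_pos hθ h₁)).1⟩

lemma sum_range_two_mul (F : ℕ → ℝ) (M : ℕ) :
    ∑ n ∈ Finset.range (2 * M), (-1) ^ n * F n =
      ∑ k ∈ Finset.range M, (F (2 * k) - F (2 * k + 1)) := by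
  induction M with
  | zero => simp
  | succ M ih =>
    rw [show 2 * (M + 1) = 2 * M + 1 + 1 by ring, Finset.sum_range_succ, Finset.sum_range_succ, ih,
      Finset.sum_range_succ]
    simp [pow_succ, pow_mul]
    ring

/-- The fluxes of an exterior harmonic function through the two spheres, as limits of sums over
image charges. -/
lemma tendsto_flux_charges (ha : 0 < a) (h₁ : 0 < ξ₁) (h₂ : 0 < ξ₂)
    {p₁ p₂ : E3} {r₁ r₂ : ℝ} (hp₁ : p₁ = axisPoint (-(a * (cosh ξ₁ / sinh ξ₁))))
    (hp₂ : p₂ = axisPoint (a * (cosh ξ₂ / sinh ξ₂)))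
    (hr₁ : r₁ = a / sinh ξ₁) (hr₂ : r₂ = a / sinh ξ₂) (hd : r₁ + r₂ < dist p₁ p₂)
    (hf₁ : HarmonicOnNhd f₁ univ) (hf₂ : HarmonicOnNhd f₂ univ)
    (hw : HarmonicOnNhd w (outsideOpen p₁ r₁ p₂ r₂))
    (hwc : ContDiffOn ℝ 1 w (outside p₁ r₁ p₂ r₂))
    (hw₁ : ∀ x ∈ Metric.sphere p₁ r₁, w x = f₁ x) (hw₂ : ∀ x ∈ Metric.sphere p₂ r₂, w x = f₂ x)
    (hinf : Tendsto w (Bornology.cobounded E3) (𝓝 0)) :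
    Tendsto (fun M => 4 * π * ∑ m ∈ Finset.range M, imageTerm a (ξ₁ + ξ₂) ξ₁
      (fun t => f₂ (axisPoint t)) (fun t => f₁ (axisPoint (-t))) m) atTop
      (𝓝 (flux (outside p₁ r₁ p₂ r₂) w p₁ r₁)) ∧
    Tendsto (fun M => 4 * π * ∑ m ∈ Finset.range M, imageTerm a (ξ₁ + ξ₂) ξ₂
      (fun t => f₁ (axisPoint (-t))) (fun t => f₂ (axisPoint t)) m) atTop
      (𝓝 (flux (outside p₁ r₁ p₂ r₂) w p₂ r₂)) := by
  have hs₁ := sinh_pos_iff.2 h₁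
  have hs₂ := sinh_pos_iff.2 h₂
  have hr₁0 : 0 < r₁ := by rw [hr₁]; positivity
  have hr₂0 : 0 < r₂ := by rw [hr₂]; positivity
  -- the images come in pairs of opposite sign, so only even partial sums are used
  have h2 : Tendsto (fun M : ℕ => 2 * M) atTop atTop :=
    tendsto_id.const_mul_atTop' (by norm_num)
  constructor
  · have := (tendsto_flux_images hr₁0 hr₂0 hd hf₁ hf₂ hw hwc hw₁ hw₂ hinf).comp h2
    refine this.congr fun M => ?_
    simp only [Function.comp_apply]
    rw [sum_range_two_mul, neg_mul, ← mul_neg, ← Finset.sum_neg_distrib]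
    congr 1
    refine Finset.sum_congr rfl fun k _ => ?_
    have e : ∀ n, r₁ * (images p₁ r₁ p₂ r₂ f₁ f₂ n).1 p₁ =
        charge a (fun t => (axisImages a ξ₁ ξ₂ f₁ f₂ n).1 (axisPoint (-t))) ξ₁ := by
      intro n
      rw [hp₁, hr₁, hp₂, hr₂]
      rfl
    rw [e, e, (charge_axisImages ha h₁ h₂ k ξ₁ h₁).1, (charge_axisImages_odd ha h₁ h₂ k h₁).1,
      imageTerm, neg_sub, add_mul, one_mul]
  · have hd' : r₂ + r₁ < dist p₂ p₁ := by rwa [add_comm, dist_comm]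
    have := (tendsto_flux_images hr₂0 hr₁0 hd' hf₂ hf₁ (by rwa [outsideOpen_comm])
      (by rwa [outside_comm]) hw₂ hw₁ hinf).comp h2
    rw [outside_comm]
    refine this.congr fun M => ?_
    simp only [Function.comp_apply]
    rw [sum_range_two_mul, neg_mul, ← mul_neg, ← Finset.sum_neg_distrib]
    congr 1
    refine Finset.sum_congr rfl fun k _ => ?_
    have e : ∀ n, r₂ * (images p₂ r₂ p₁ r₁ f₂ f₁ n).1 p₂ =
        charge a (fun t => (axisImages a ξ₁ ξ₂ f₁ f₂ n).2 (axisPoint t)) ξ₂ := by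
      intro n
      rw [images_swap, hp₁, hr₁, hp₂, hr₂]
      rfl
    rw [e, e, (charge_axisImages ha h₁ h₂ k ξ₂ h₂).2, (charge_axisImages_odd ha h₁ h₂ k h₂).2,
      imageTerm, neg_sub, add_mul, one_mul, add_comm ξ₂ ξ₁]

end AxisImages

/-! ### The hyperbolic cosecant near the origin -/

lemma sinh_taylor {x : ℝ} (h0 : 0 ≤ x) (h1 : x ≤ 1) : |sinh x - x - x ^ 3 / 6| ≤ x ^ 5 / 100 := by
  have e1 := Real.exp_bound (x := x) (by rwa [abs_of_nonneg h0]) (n := 5) (by norm_num)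
  have e2 := Real.exp_bound (x := -x) (by rwa [abs_neg, abs_of_nonneg h0]) (n := 5) (by norm_num)
  rw [abs_neg] at e2
  rw [abs_of_nonneg h0] at e1 e2
  simp only [Finset.sum_range_succ, Finset.sum_range_zero, Nat.factorial] at e1 e2
  norm_num at e1 e2
  rw [abs_le] at *
  rw [Real.sinh_eq]
  constructor <;> nlinarith [e1.1, e1.2, e2.1, e2.2]

lemma self_lt_sinh {x : ℝ} (h : 0 < x) : x < sinh x := Real.self_lt_sinh_iff.2 h

lemma sq_le_four_mul_sinh {x : ℝ} (h : 0 ≤ x) : x ^ 2 ≤ 4 * sinh x := by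
  have h1 := Real.quadratic_le_exp_of_nonneg h
  have h2 : exp (-x) ≤ 1 := by simpa using h
  rw [Real.sinh_eq]
  nlinarith

lemma cosh_sub_one_le {x : ℝ} (h : 0 < x) : cosh x - 1 ≤ x * sinh x := by
  obtain ⟨c, hc, he⟩ := exists_hasDerivAt_eq_slope cosh sinh h Real.continuous_cosh.continuousOn
    (fun t _ => Real.hasDerivAt_cosh t)
  rw [Real.cosh_zero, sub_zero, eq_div_iff h.ne'] at he
  rw [← he, mul_comm]
  have := Real.sinh_le_sinh.2 hc.2.le
  gcongr

lemma sinh_le_mul_cosh {x : ℝ} (h : 0 < x) : sinh x ≤ x * cosh x := by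
  obtain ⟨c, hc, he⟩ := exists_hasDerivAt_eq_slope sinh cosh h Real.continuous_sinh.continuousOn
    (fun t _ => Real.hasDerivAt_sinh t)
  rw [Real.sinh_zero, sub_zero, sub_zero, eq_div_iff h.ne'] at he
  rw [← he, mul_comm]
  have : cosh c ≤ cosh x := Real.cosh_le_cosh.2 (by
    rw [abs_of_pos hc.1, abs_of_pos h]; exact hc.2.le)
  gcongr

lemma one_div_le_coth {θ : ℝ} (h : 0 < θ) : 1 / θ ≤ cosh θ / sinh θ := by
  rw [div_le_div_iff₀ h (sinh_pos_iff.2 h)]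
  linarith [sinh_le_mul_cosh h]

lemma coth_le_one_add {θ : ℝ} (h : 0 < θ) : cosh θ / sinh θ ≤ 1 / θ + 1 := by
  have hs := sinh_pos_iff.2 h
  have h1 := Real.cosh_sub_sinh θ
  have h2 : exp (-θ) ≤ 1 := by simpa using h.le
  have h3 := self_lt_sinh h
  rw [div_add_one h.ne', div_le_div_iff₀ hs h]
  nlinarith

lemma coth_le_add_self {θ : ℝ} (h : 0 < θ) : cosh θ / sinh θ ≤ 1 / θ + θ := by
  have hs := sinh_pos_iff.2 h
  have h1 := cosh_sub_one_le h
  have h3 := self_lt_sinh h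
  rw [div_add' _ _ _ h.ne', div_le_div_iff₀ hs h]
  nlinarith

/-- The regular part `1 / sinh θ - 1 / θ` of the hyperbolic cosecant. -/
def cschReg (θ : ℝ) : ℝ := 1 / sinh θ - 1 / θ

/-- The derivative of `cschReg`. -/
def cschReg' (θ : ℝ) : ℝ := 1 / θ ^ 2 - cosh θ / sinh θ ^ 2

lemma hasDerivAt_cschReg {θ : ℝ} (h : 0 < θ) : HasDerivAt cschReg (cschReg' θ) θ := by
  have hs := (sinh_pos_iff.2 h).ne'
  have := ((Real.hasDerivAt_sinh θ).inv hs).sub (hasDerivAt_inv h.ne')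
  simp only [← one_div] at this
  refine (this.congr_deriv ?_).congr_of_eventuallyEq (Eventually.of_forall fun x => ?_)
  · rw [cschReg']; ring
  · simp [cschReg]

lemma hasDerivAt_cschReg' {θ : ℝ} (h : 0 < θ) :
    HasDerivAt cschReg' ((sinh θ ^ 2 + 2) / sinh θ ^ 3 - 2 / θ ^ 3) θ := by
  have hs := (sinh_pos_iff.2 h).ne'
  have h1 := ((hasDerivAt_pow 2 θ).inv (pow_ne_zero 2 h.ne')).sub
    ((Real.hasDerivAt_cosh θ).div ((Real.hasDerivAt_sinh θ).pow 2) (pow_ne_zero 2 hs))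
  refine (h1.congr_deriv ?_).congr_of_eventuallyEq (Eventually.of_forall fun x => ?_)
  · simp
    field_simp
    rw [Real.cosh_sq]
    ring
  · simp [cschReg']

/-- The second derivative of `cschReg` is bounded near `0`, where the poles cancel, and decays
quadratically at infinity. -/
lemma abs_cschReg_second_le {θ : ℝ} (h : 0 < θ) :
    |(sinh θ ^ 2 + 2) / sinh θ ^ 3 - 2 / θ ^ 3| ≤ 32 / (1 + θ) ^ 2 := by
  have hs := sinh_pos_iff.2 h
  have hlt := self_lt_sinh h
  rcases le_or_gt θ 1 with h1 | h1
  · have ht := abs_le.1 (sinh_taylor h.le h1)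
    obtain ⟨e, he⟩ : ∃ e, e = sinh θ - θ - θ ^ 3 / 6 := ⟨_, rfl⟩
    rw [← he] at ht
    obtain ⟨u, hu⟩ : ∃ u, u = θ ^ 3 / 6 + e := ⟨_, rfl⟩
    have hS : sinh θ = θ + u := by rw [hu, he]; ring
    have h3 : 0 < θ ^ 3 := by positivity
    have h53 : θ ^ 5 ≤ θ ^ 3 := pow_le_pow_of_le_one h.le h1 (by norm_num)
    have hu0 : 0 ≤ u := by linarith
    have hu1 : u ≤ θ ^ 3 / 5 := by linarith
    have hE : (sinh θ ^ 2 + 2) / sinh θ ^ 3 - 2 / θ ^ 3 =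
        (-6 * θ ^ 2 * e + 2 * θ ^ 4 * u + θ ^ 3 * u ^ 2 - 6 * θ * u ^ 2 - 2 * u ^ 3) /
          (θ ^ 3 * sinh θ ^ 3) := by
      rw [div_sub_div _ _ (by positivity) (by positivity), mul_comm (sinh θ ^ 3) (θ ^ 3)]
      congr 1
      rw [hS, show e = u - θ ^ 3 / 6 by rw [hu]; ring]
      ring
    rw [hE, abs_div, abs_of_pos (show 0 < θ ^ 3 * sinh θ ^ 3 by positivity)]
    have hnum : |-6 * θ ^ 2 * e + 2 * θ ^ 4 * u + θ ^ 3 * u ^ 2 - 6 * θ * u ^ 2 - 2 * u ^ 3| ≤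
        θ ^ 6 := by
      have hu2 : u ^ 2 ≤ θ ^ 6 / 25 := by
        calc u ^ 2 ≤ (θ ^ 3 / 5) ^ 2 := by gcongr
          _ = _ := by ring
      have hu3 : u ^ 3 ≤ θ ^ 9 / 125 := by
        calc u ^ 3 ≤ (θ ^ 3 / 5) ^ 3 := by gcongr
          _ = _ := by ring
      have h76 : θ ^ 7 ≤ θ ^ 6 := pow_le_pow_of_le_one h.le h1 (by norm_num)
      have h96 : θ ^ 9 ≤ θ ^ 6 := pow_le_pow_of_le_one h.le h1 (by norm_num)
      have t1 : |θ ^ 2 * e| ≤ θ ^ 7 / 100 := by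
        rw [abs_mul, abs_of_pos (by positivity : 0 < θ ^ 2)]
        calc θ ^ 2 * |e| ≤ θ ^ 2 * (θ ^ 5 / 100) := by gcongr; exact abs_le.2 ht
          _ = _ := by ring
      have t2 : θ ^ 4 * u ≤ θ ^ 7 / 5 := by
        calc θ ^ 4 * u ≤ θ ^ 4 * (θ ^ 3 / 5) := by gcongr
          _ = _ := by ring
      have t3 : θ ^ 3 * u ^ 2 ≤ θ ^ 9 / 25 := by
        calc θ ^ 3 * u ^ 2 ≤ θ ^ 3 * (θ ^ 6 / 25) := by gcongr
          _ = _ := by ring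
      have t4 : θ * u ^ 2 ≤ θ ^ 7 / 25 := by
        calc θ * u ^ 2 ≤ θ * (θ ^ 6 / 25) := by gcongr
          _ = _ := by ring
      have p2 : 0 ≤ θ ^ 4 * u := by positivity
      have p3 : 0 ≤ θ ^ 3 * u ^ 2 := by positivity
      have p4 : 0 ≤ θ * u ^ 2 := by positivity
      have p5 : 0 ≤ u ^ 3 := by positivity
      have p6 : 0 < θ ^ 6 := by positivity
      have t1' := abs_le.1 t1
      rw [abs_le]
      constructor <;> linarith [t1'.1, t1'.2]
    have hden : θ ^ 6 ≤ θ ^ 3 * sinh θ ^ 3 := by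
      calc θ ^ 6 = θ ^ 3 * θ ^ 3 := by ring
        _ ≤ _ := by gcongr
    calc _ ≤ 1 := (div_le_one (by positivity)).2 (hnum.trans hden)
      _ ≤ 32 / (1 + θ) ^ 2 := by
        rw [le_div_iff₀ (by positivity)]
        nlinarith
  · have h4 := sq_le_four_mul_sinh h.le
    have hθ0 : 0 < θ ^ 2 := by positivity
    have e1 : (sinh θ ^ 2 + 2) / sinh θ ^ 3 = 1 / sinh θ + 2 / sinh θ ^ 3 := by
      field_simp
    have b1 : 1 / sinh θ ≤ 4 / θ ^ 2 := by
      rw [div_le_div_iff₀ hs hθ0]; linarith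
    have b0 : 2 / θ ^ 3 ≤ 2 / θ ^ 2 :=
      div_le_div_of_nonneg_left (by norm_num) hθ0 (pow_le_pow_right₀ h1.le (by norm_num))
    have b2 : 2 / sinh θ ^ 3 ≤ 2 / θ ^ 3 := by gcongr
    have b3 : 8 / θ ^ 2 ≤ 32 / (1 + θ) ^ 2 := by
      rw [div_le_div_iff₀ hθ0 (by positivity)]; nlinarith
    have c1 : 0 < 1 / sinh θ := by positivity
    have c2 : 0 < 2 / sinh θ ^ 3 := by positivity
    have c3 : 0 < 2 / θ ^ 3 := by positivity
    have b4 : 4 / θ ^ 2 + 2 / θ ^ 2 + 2 / θ ^ 2 = 8 / θ ^ 2 := by ring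
    have b5 : 0 < 2 / θ ^ 2 := by positivity
    have b6 : 0 < 4 / θ ^ 2 := by positivity
    rw [e1, abs_le]
    constructor <;> linarith

lemma cschReg_nonpos {θ : ℝ} (h : 0 < θ) : cschReg θ ≤ 0 := by
  have := one_div_le_one_div_of_le h (self_lt_sinh h).le
  rw [cschReg]; linarith

lemma abs_cschReg_le_inv {θ : ℝ} (h : 0 < θ) : |cschReg θ| ≤ 1 / θ := by
  have hs := sinh_pos_iff.2 h
  have h1 : 0 < 1 / sinh θ := by positivity
  rw [abs_of_nonpos (cschReg_nonpos h), cschReg]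
  linarith

lemma abs_cschReg_le_self {θ : ℝ} (h : 0 < θ) : |cschReg θ| ≤ θ := by
  have hs := sinh_pos_iff.2 h
  have h1 := sinh_le_mul_cosh h
  have h2 := cosh_sub_one_le h
  have h3 : sinh θ ≤ θ + θ ^ 2 * sinh θ := by nlinarith
  have h4 : 1 / θ ≤ 1 / sinh θ + θ := by
    rw [div_add' _ _ _ hs.ne', div_le_div_iff₀ h hs]
    nlinarith
  rw [abs_of_nonpos (cschReg_nonpos h), cschReg]
  linarith

lemma sum_inv_sq_le {s : ℝ} (hs : 0 < s) (N : ℕ) :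
    ∑ m ∈ Finset.range N, s / (1 + m * s) ^ 2 ≤ s + 1 := by
  have key : ∀ N : ℕ, ∑ m ∈ Finset.range (N + 1), s / (1 + m * s) ^ 2 ≤
      s + 1 - 1 / (1 + N * s) := by
    intro N
    induction N with
    | zero => simp
    | succ N ih =>
      rw [Finset.sum_range_succ]
      have h1 : 0 < 1 + N * s := by positivity
      have h2 : 0 < 1 + (N + 1 : ℝ) * s := by positivity
      have : s / (1 + (N + 1 : ℝ) * s) ^ 2 ≤ 1 / (1 + N * s) - 1 / (1 + (N + 1 : ℝ) * s) := by
        rw [div_sub_div _ _ h1.ne' h2.ne', div_le_div_iff₀ (by positivity) (by positivity)]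
        nlinarith [mul_pos hs h2, mul_pos (mul_pos hs hs) h2]
      push_cast
      linarith
  rcases N with _ | N
  · simp; linarith
  · have := key N
    have h1 : 0 < 1 / (1 + N * s) := by positivity
    linarith

/-- Riemann sums of the derivative of `cschReg` with mesh `s` are bounded independently of `s`,
because the integral of this derivative over `(0, ∞)` vanishes. -/
lemma abs_sum_cschReg'_le {s ξ : ℝ} (hs : 0 < s) (hs1 : s ≤ 1) (hξ : 0 < ξ) (hξs : ξ ≤ s)
    (z : ℕ → ℝ) (hz : ∀ m : ℕ, z m ∈ Icc (m * s + ξ) ((m + 1) * s + ξ)) (N : ℕ) :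
    |∑ m ∈ Finset.range N, s * cschReg' (z m)| ≤ |cschReg (N * s + ξ)| + 65 * s := by
  have hterm : ∀ m : ℕ, |s * cschReg' (z m) -
      (cschReg ((m + 1 : ℕ) * s + ξ) - cschReg (m * s + ξ))| ≤ 32 * s * (s / (1 + m * s) ^ 2) := by
    intro m
    have hx : 0 < m * s + ξ := by positivity
    have hlt : m * s + ξ < (m + 1) * s + ξ := by linarith
    have hpos : ∀ t ∈ Icc (m * s + ξ) ((m + 1) * s + ξ), 0 < t := fun t ht => hx.trans_le ht.1
    obtain ⟨c, hc, he⟩ := exists_hasDerivAt_eq_slope cschReg cschReg' hlt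
      (fun t ht => (hasDerivAt_cschReg (hpos t ht)).continuousAt.continuousWithinAt)
      (fun t ht => hasDerivAt_cschReg (hpos t ⟨ht.1.le, ht.2.le⟩))
    have hlen : (m + 1) * s + ξ - (m * s + ξ) = s := by ring
    rw [hlen, eq_div_iff hs.ne'] at he
    have hlip := (convex_Icc (m * s + ξ) ((m + 1) * s + ξ)).norm_image_sub_le_of_norm_hasDerivWithin_le
      (f := cschReg') (C := 32 / (1 + m * s) ^ 2)
      (fun t ht => (hasDerivAt_cschReg' (hpos t ht)).hasDerivWithinAt) (fun t ht => by
        refine (abs_cschReg_second_le (hpos t ht)).trans ?_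
        have := ht.1
        gcongr
        linarith) ⟨hc.1.le, hc.2.le⟩ (hz m)
    rw [Real.norm_eq_abs, Real.norm_eq_abs] at hlip
    have hzc : |z m - c| ≤ s := by
      rw [abs_le]
      have := hz m
      constructor <;> linarith [this.1, this.2, hc.1, hc.2]
    push_cast
    rw [← he, mul_comm _ s, ← mul_sub, abs_mul, abs_of_pos hs]
    calc s * |cschReg' (z m) - cschReg' c| ≤ s * (32 / (1 + m * s) ^ 2 * s) := by
          gcongr
          exact hlip.trans (by gcongr)
      _ = _ := by ring
  have htel : ∑ m ∈ Finset.range N, (cschReg ((m + 1 : ℕ) * s + ξ) - cschReg (m * s + ξ)) =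
      cschReg (N * s + ξ) - cschReg ξ := by
    rw [Finset.sum_range_sub (fun m : ℕ => cschReg (m * s + ξ))]
    simp
  have hsum : |∑ m ∈ Finset.range N, s * cschReg' (z m) - (cschReg (N * s + ξ) - cschReg ξ)| ≤
      64 * s := by
    rw [← htel, ← Finset.sum_sub_distrib]
    refine (Finset.abs_sum_le_sum_abs _ _).trans ((Finset.sum_le_sum fun m _ => hterm m).trans ?_)
    rw [← Finset.mul_sum]
    calc 32 * s * ∑ m ∈ Finset.range N, s / (1 + m * s) ^ 2 ≤ 32 * s * (s + 1) := by
          gcongr; exact sum_inv_sq_le hs N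
      _ ≤ 64 * s := by nlinarith
  have h1 := abs_cschReg_le_self hξ
  have h2 := abs_le.1 hsum
  have h3 := abs_le.1 h1
  have h4 := le_abs_self (cschReg (N * s + ξ))
  have h5 := neg_abs_le (cschReg (N * s + ξ))
  rw [abs_le]
  constructor <;> linarith [h2.1, h2.2, h3.1, h3.2]

/-- A sum that is logarithmically divergent as `t → 0`. -/
lemma sum_log_le {t : ℝ} (ht : 0 < t) (N : ℕ) :
    ∑ m ∈ Finset.range N, 1 / ((m + 1) * (1 + t * (m + 1))) ≤ 1 + log ((1 + t) / t) := by
  have key : ∀ N : ℕ, ∑ m ∈ Finset.range (N + 1), 1 / ((m + 1 : ℝ) * (1 + t * (m + 1))) ≤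
      1 + log ((1 + t) * (N + 1) / (1 + t * (N + 1))) := by
    intro N
    induction N with
    | zero =>
      have ht1 : 1 + t ≠ 0 := by positivity
      have h1 : (1 + t) * ((0 : ℕ) + 1 : ℝ) / (1 + t * ((0 : ℕ) + 1)) = 1 := by
        simp [ht1]
      rw [h1]
      simp
      exact inv_le_one_of_one_le₀ (by linarith)
    | succ N ih =>
      rw [Finset.sum_range_succ]
      have h1 : 0 < 1 + t * (N + 1 : ℝ) := by positivity
      have h2 : 0 < 1 + t * (N + 1 + 1 : ℝ) := by positivity
      have hN : (0 : ℝ) < N + 1 := by positivity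
      have hN2 : (0 : ℝ) < N + 1 + 1 := by positivity
      have ht1 : 0 < 1 + t := by positivity
      have hq : 0 < ((N + 1 + 1 : ℝ) * (1 + t * (N + 1))) / ((N + 1) * (1 + t * (N + 1 + 1))) := by
        positivity
      have hlog := Real.one_sub_inv_le_log_of_pos hq
      have e1 : (1 + t) * (N + 1 + 1) / (1 + t * (N + 1 + 1)) =
          ((1 + t) * (N + 1) / (1 + t * (N + 1))) *
          (((N + 1 + 1 : ℝ) * (1 + t * (N + 1))) / ((N + 1) * (1 + t * (N + 1 + 1)))) := by
        field_simp
      have e2 : 1 - (((N + 1 + 1 : ℝ) * (1 + t * (N + 1))) / ((N + 1) * (1 + t * (N + 1 + 1))))⁻¹ =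
          1 / ((N + 1 + 1) * (1 + t * (N + 1))) := by
        field_simp
        ring
      have e3 : 1 / ((N + 1 + 1 : ℝ) * (1 + t * (N + 1 + 1))) ≤
          1 / ((N + 1 + 1) * (1 + t * (N + 1))) := by
        gcongr
        linarith
      push_cast
      rw [e1, Real.log_mul (by positivity) hq.ne']
      linarith
  rcases N with _ | N
  · have : 0 ≤ log ((1 + t) / t) := Real.log_nonneg (by rw [le_div_iff₀ ht]; linarith)
    simp; linarith
  · refine (key N).trans ?_
    have h1 : 0 < 1 + t * (N + 1 : ℝ) := by positivity
    have hN : (0 : ℝ) < N + 1 := by positivity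
    have ht1 : 0 < 1 + t := by positivity
    have : log ((1 + t) * (N + 1) / (1 + t * (N + 1))) ≤ log ((1 + t) / t) := by
      refine Real.log_le_log (by positivity) ?_
      rw [div_le_div_iff₀ h1 ht]
      nlinarith
    linarith

/-! ### Comparison with the touching spheres: hyperbolic terms -/

/-- On `[-T, T]` the function `K` varies like a `C²` function with a critical point at `0`: it is
Lipschitz between `t` and `t'` with a constant proportional to `|t| + |t'|`. -/
def QuadLip (K : ℝ → ℝ) (M T : ℝ) : Prop :=
  ∀ t ∈ Icc (-T) T, ∀ t' ∈ Icc (-T) T, |K t - K t'| ≤ M * (|t| + |t'|) * |t - t'|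

lemma exists_quadLip {G : ℝ → ℝ} (hG : ContDiff ℝ 2 G) (T : ℝ) :
    ∃ M, 0 ≤ M ∧ QuadLip (fun t => G t - G 0 - deriv G 0 * t) M T := by
  have hG1 : ContDiff ℝ 1 (deriv G) := by
    have : ContDiff ℝ (1 + 1) G := by norm_num; exact hG
    exact (contDiff_succ_iff_deriv.1 this).2.2
  obtain ⟨M, hM⟩ := (isCompact_Icc (a := -T) (b := T)).exists_bound_of_continuousOn
    (hG1.continuous_deriv (by norm_num)).continuousOn
  have hd : ∀ t, HasDerivAt G (deriv G t) t := fun t =>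
    (hG.differentiable (by norm_num) t).hasDerivAt
  have hd2 : ∀ t, HasDerivAt (deriv G) (deriv (deriv G) t) t := fun t =>
    (hG1.differentiable (by norm_num) t).hasDerivAt
  have hM' : ∀ t ∈ Icc (-T) T, ‖deriv (deriv G) t‖ ≤ max M 0 := fun t ht =>
    (hM t ht).trans (le_max_left _ _)
  have hM0 : 0 ≤ max M 0 := le_max_right _ _
  refine ⟨max M 0, hM0, fun t ht t' ht' => ?_⟩
  have hsub : uIcc t' t ⊆ Icc (-T) T := ordConnected_Icc.uIcc_subset ht' ht
  have h0 : (0 : ℝ) ∈ Icc (-T) T := ⟨by linarith [ht.1, ht.2], by linarith [ht.1, ht.2]⟩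
  have hK : ∀ x, HasDerivAt (fun t => G t - G 0 - deriv G 0 * t) (deriv G x - deriv G 0) x := by
    intro x
    simpa using! ((hd x).sub_const (G 0)).sub ((hasDerivAt_id x).const_mul (deriv G 0))
  refine (convex_uIcc t' t).norm_image_sub_le_of_norm_hasDerivWithin_le
    (f := fun t => G t - G 0 - deriv G 0 * t) (C := max M 0 * (|t| + |t'|))
    (fun x _ => (hK x).hasDerivWithinAt) (fun x hx => ?_) left_mem_uIcc right_mem_uIcc
  have h1 := (convex_Icc (-T) T).norm_image_sub_le_of_norm_hasDerivWithin_le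
    (f := deriv G) (fun y _ => (hd2 y).hasDerivWithinAt) hM' h0 (hsub hx)
  refine h1.trans ?_
  have h2 : |x| ≤ |t| + |t'| := by
    rw [uIcc, mem_Icc] at hx
    have a1 := abs_nonneg t
    have a2 := abs_nonneg t'
    rw [abs_le]
    constructor
    · refine le_trans ?_ hx.1
      refine le_inf ?_ ?_
      · linarith [neg_abs_le t']
      · linarith [neg_abs_le t]
    · refine hx.2.trans (sup_le ?_ ?_)
      · linarith [le_abs_self t']
      · linarith [le_abs_self t]
  rw [sub_zero, Real.norm_eq_abs]
  gcongr

/-- The limit of `imageTerm a s ξ` as the spheres come to touch, where `a / s` tends to `l` and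
`ξ / s` to `η`. -/
def flatTerm (l η : ℝ) (U V : ℝ → ℝ) (m : ℕ) : ℝ :=
  l / (m + 1) * U (l / (m + 1)) - l / (m + η) * V (l / (m + η))

/-- For data vanishing to second order, one image charge differs from its rational approximation by
`O(a³)`, with a factor whose sum over `θ = m s + ξ` diverges only logarithmically. -/
lemma abs_charge_sub_le {a θ M T : ℝ} {K : ℝ → ℝ} (ha : 0 < a) (hθ : 0 < θ) (hM : 0 ≤ M)
    (hK : QuadLip K M T) (hK0 : K 0 = 0) (hT : a * (1 / θ + 1) ≤ T) :
    |charge a K θ - a / θ * K (a / θ)| ≤ 34 * M * (a ^ 3 / (θ * (1 + θ))) := by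
  have hs := sinh_pos_iff.2 hθ
  set A := a * (cosh θ / sinh θ) with hA
  set B := a / θ with hB
  have hB0 : 0 < B := by positivity
  have hAT : A ≤ a * (1 / θ + 1) := by rw [hA]; gcongr; exact coth_le_one_add hθ
  have hBA : B ≤ A := by
    rw [hA, hB, div_eq_mul_one_div]
    exact mul_le_mul_of_nonneg_left (one_div_le_coth hθ) ha.le
  have hd1 : A - B ≤ a * 1 := by
    have := coth_le_one_add hθ
    rw [hA, hB, div_eq_mul_one_div a θ, ← mul_sub]; gcongr; linarith
  have hd2 : A - B ≤ a * θ := by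
    have := coth_le_add_self hθ
    rw [hA, hB, div_eq_mul_one_div a θ, ← mul_sub]; gcongr; linarith
  have hmA : A ∈ Icc (-T) T := ⟨by linarith, by linarith⟩
  have hmB : B ∈ Icc (-T) T := ⟨by linarith, by linarith⟩
  have hm0 : (0 : ℝ) ∈ Icc (-T) T := ⟨by linarith, by linarith⟩
  have k1 := hK A hmA B hmB
  have k2 := hK B hmB 0 hm0
  rw [hK0, sub_zero, abs_zero, add_zero, sub_zero, abs_of_pos hB0] at k2
  rw [abs_of_pos hB0, abs_of_pos (hB0.trans_le hBA), abs_of_nonneg (sub_nonneg.2 hBA)] at k1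
  have hsplit : charge a K θ - a / θ * K (a / θ) =
      a / sinh θ * (K A - K B) + a * cschReg θ * K B := by
    rw [charge, cschReg]; ring
  have e1 : |a / sinh θ * (K A - K B)| ≤ 32 * M * (a ^ 3 / (θ * (1 + θ))) := by
    rw [abs_mul, abs_of_pos (by positivity : 0 < a / sinh θ)]
    have hmin : (1 + θ) ^ 2 * (A - B) ≤ 16 * a * sinh θ := by
      rcases le_total θ 1 with h1 | h1
      · have h3 := self_lt_sinh hθ
        calc (1 + θ) ^ 2 * (A - B) ≤ 4 * (a * θ) := by
              gcongr
              nlinarith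
          _ ≤ _ := by nlinarith
      · have h3 := sq_le_four_mul_sinh hθ.le
        calc (1 + θ) ^ 2 * (A - B) ≤ (4 * θ ^ 2) * (a * 1) := by
              gcongr
              nlinarith
          _ ≤ _ := by nlinarith
    have hAeq : a * (1 / θ + 1) = a * (1 + θ) / θ := by field_simp
    calc a / sinh θ * |K A - K B| ≤ a / sinh θ * (M * (A + A) * (A - B)) := by
          gcongr
          refine k1.trans ?_
          have : 0 ≤ A - B := sub_nonneg.2 hBA
          gcongr
      _ ≤ a / sinh θ * (M * (2 * (a * (1 + θ) / θ)) * (A - B)) := by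
          have : 0 ≤ A - B := sub_nonneg.2 hBA
          gcongr
          linarith
      _ = 2 * M * a ^ 2 / (sinh θ * (θ * (1 + θ))) * ((1 + θ) ^ 2 * (A - B)) := by
          field_simp
      _ ≤ 2 * M * a ^ 2 / (sinh θ * (θ * (1 + θ))) * (16 * a * sinh θ) := by gcongr
      _ = _ := by field_simp; ring
  have e2 : |a * cschReg θ * K B| ≤ 2 * M * (a ^ 3 / (θ * (1 + θ))) := by
    have hφ : |cschReg θ| * (1 + θ) ≤ 2 * θ := by
      rcases le_total θ 1 with h1 | h1
      · have := abs_cschReg_le_self hθ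
        nlinarith [abs_nonneg (cschReg θ)]
      · have := abs_cschReg_le_inv hθ
        rw [le_div_iff₀ hθ] at this
        nlinarith [abs_nonneg (cschReg θ)]
    rw [abs_mul, abs_mul, abs_of_pos ha]
    calc a * |cschReg θ| * |K B| ≤ a * |cschReg θ| * (M * B * B) := by gcongr
      _ = M * a ^ 3 / (θ ^ 2 * (1 + θ)) * (|cschReg θ| * (1 + θ)) := by rw [hB]; field_simp
      _ ≤ M * a ^ 3 / (θ ^ 2 * (1 + θ)) * (2 * θ) := by gcongr
      _ = _ := by field_simp
  rw [hsplit]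
  refine (abs_add_le _ _).trans ((add_le_add e1 e2).trans (le_of_eq ?_))
  ring

/-- Partial sums over image charges, compared with the corresponding sums with `1 / θ` in place of
the hyperbolic functions. -/
lemma abs_sum_imageTerm_sub_le {a s ξ κ g₀ g₁ M T : ℝ} {U V : ℝ → ℝ} (hκ : 0 < κ) (ha : 0 < a)
    (ha1 : a ≤ 1) (hκξ : κ * a ≤ ξ) (hξs : ξ ≤ s) (hs1 : s ≤ 1) (hT : 1 / κ + 1 ≤ T) (hM : 0 ≤ M)
    (hU : QuadLip (fun t => U t - g₀ - g₁ * t) M T) (hU0 : U 0 = g₀)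
    (hV : QuadLip (fun t => V t - g₀ - -g₁ * t) M T) (hV0 : V 0 = g₀) (N : ℕ) :
    |∑ m ∈ Finset.range N, (imageTerm a s ξ U V m - flatTerm (a / s) (ξ / s) U V m)| ≤
      a * |g₀| * (|cschReg (N * s + ξ)| + 65 * s) +
      2 * a ^ 2 * |g₁| * (|cschReg (N * s + ξ)| / s + 65) +
      68 * M * (a ^ 2 / κ) * (1 + log ((1 + κ * a) / (κ * a))) := by
  have hκa : 0 < κ * a := by positivity
  have hξ : 0 < ξ := hκa.trans_le hκξ
  have hs : 0 < s := hξ.trans_le hξs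
  set KU : ℝ → ℝ := fun t => U t - g₀ - g₁ * t with hKU
  set KV : ℝ → ℝ := fun t => V t - g₀ - -g₁ * t with hKV
  set EU : ℝ → ℝ := fun θ => charge a KU θ - a / θ * KU (a / θ) with hEU
  set EV : ℝ → ℝ := fun θ => charge a KV θ - a / θ * KV (a / θ) with hEV
  set x : ℕ → ℝ := fun m => m * s + ξ with hx
  set y : ℕ → ℝ := fun m => (m + 1) * s with hy
  have hxpos : ∀ m, 0 < x m := fun m => by simp only [hx]; positivity
  have hypos : ∀ m, 0 < y m := fun m => by simp only [hy]; positivity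
  have hxy : ∀ m, x m ≤ y m := fun m => by simp only [hx, hy]; linarith
  -- for constant data, the error of the `m`-th pair is a difference of values of `cschReg`
  have hmid : ∀ m, ∃ z ∈ Icc (x m) ((m + 1) * s + ξ),
      cschReg (y m) - cschReg (x m) = (s - ξ) * cschReg' z := by
    intro m
    rcases (hxy m).eq_or_lt with h | h
    · have : s = ξ := by simp only [hx, hy] at h; linarith
      exact ⟨x m, ⟨le_rfl, by simp only [hx]; linarith⟩, by rw [h, this]; simp⟩
    · obtain ⟨c, hc, he⟩ := exists_hasDerivAt_eq_slope cschReg cschReg' h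
        (fun t ht => (hasDerivAt_cschReg ((hxpos m).trans_le ht.1)).continuousAt.continuousWithinAt)
        (fun t ht => hasDerivAt_cschReg ((hxpos m).trans ht.1))
      refine ⟨c, ⟨hc.1.le, ?_⟩, ?_⟩
      · have := hc.2
        simp only [hy] at this
        linarith
      · have hlen : y m - x m = s - ξ := by simp only [hx, hy]; ring
        rw [he, hlen]
        rw [mul_div_cancel₀]
        rw [← hlen]; linarith
  choose z hz hzeq using hmid
  -- the constant and the linear parts of the data contribute derivatives of `cschReg` only:
  -- for linear data, `1 / θ ^ 2 - cosh θ / sinh θ ^ 2` is `cschReg' θ`, and the odd symmetry of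
  -- the slopes of `U` and `V` makes both charges of a pair contribute with the same sign
  have hterm : ∀ m, imageTerm a s ξ U V m - flatTerm (a / s) (ξ / s) U V m =
      a * g₀ * ((s - ξ) * cschReg' (z m)) - a ^ 2 * g₁ * (cschReg' (y m) + cschReg' (x m)) +
        (EU (y m) - EV (x m)) := by
    intro m
    have hsy := (sinh_pos_iff.2 (hypos m)).ne'
    have hsx := (sinh_pos_iff.2 (hxpos m)).ne'
    have ey : a / s / (m + 1) = a / y m := by simp only [hy]; field_simp
    have ex : a / s / (m + ξ / s) = a / x m := by simp only [hx]; field_simp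
    have fU : ∀ t, U t = g₀ + g₁ * t + KU t := fun t => by simp only [hKU]; ring
    have fV : ∀ t, V t = g₀ - g₁ * t + KV t := fun t => by simp only [hKV]; ring
    rw [imageTerm, flatTerm, ey, ex, ← hzeq]
    change charge a U (y m) - charge a V (x m) - _ = _
    simp only [hEU, hEV, charge, cschReg, cschReg', fU, fV]
    have hyn := (hypos m).ne'
    have hxn := (hxpos m).ne'
    ring_nf
  have hzI := abs_sum_cschReg'_le hs hs1 hξ hξs z (fun m => hz m) N
  have hxI := abs_sum_cschReg'_le hs hs1 hξ hξs x
    (fun m => ⟨le_rfl, by simp only [hx]; linarith⟩) N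
  have hyI := abs_sum_cschReg'_le hs hs1 hξ hξs y
    (fun m => ⟨hxy m, by simp only [hy]; linarith⟩) N
  set Φ := |cschReg (N * s + ξ)| with hΦ
  rw [← Finset.mul_sum, abs_mul, abs_of_pos hs] at hzI hxI hyI
  have hlow : ∀ m : ℕ, κ * a * (m + 1) ≤ x m := by
    intro m
    simp only [hx]
    have : (m : ℝ) * (κ * a) ≤ m * s := by gcongr; linarith
    linarith
  have hE : ∀ (K : ℝ → ℝ), QuadLip K M T → K 0 = 0 → ∀ m θ, x m ≤ θ →
      |charge a K θ - a / θ * K (a / θ)| ≤ 34 * M * (a ^ 2 / κ) *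
        (1 / ((m + 1) * (1 + κ * a * (m + 1)))) := by
    intro K hK hK0 m θ hθ
    have h1 : κ * a * (m + 1) ≤ θ := (hlow m).trans hθ
    have h1' : κ * a ≤ θ := le_trans (by nlinarith [hκa.le, (Nat.cast_nonneg m : (0 : ℝ) ≤ m)]) h1
    have hθ0 : 0 < θ := hκa.trans_le h1'
    refine (abs_charge_sub_le ha hθ0 hM hK hK0 ?_).trans ?_
    · refine le_trans ?_ hT
      have : a * (1 / θ) ≤ 1 / κ := by
        rw [mul_one_div, div_le_div_iff₀ hθ0 hκ]; linarith
      linarith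
    · have : a ^ 3 / (θ * (1 + θ)) ≤ a ^ 3 / ((κ * a * (m + 1)) * (1 + κ * a * (m + 1))) := by
        gcongr
      calc 34 * M * (a ^ 3 / (θ * (1 + θ))) ≤
            34 * M * (a ^ 3 / ((κ * a * (m + 1)) * (1 + κ * a * (m + 1)))) := by gcongr
        _ = _ := by field_simp
  have hEs : |∑ m ∈ Finset.range N, (EU (y m) - EV (x m))| ≤
      68 * M * (a ^ 2 / κ) * (1 + log ((1 + κ * a) / (κ * a))) := by
    refine (Finset.abs_sum_le_sum_abs _ _).trans ?_
    calc ∑ m ∈ Finset.range N, |EU (y m) - EV (x m)| ≤ ∑ m ∈ Finset.range N,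
          68 * M * (a ^ 2 / κ) * (1 / (((m : ℝ) + 1) * (1 + κ * a * (m + 1)))) := by
          refine Finset.sum_le_sum fun m _ => ?_
          have b1 := hE KU hU (by simp [hKU, hU0]) m (y m) (hxy m)
          have b2 := hE KV hV (by simp [hKV, hV0]) m (x m) le_rfl
          refine (abs_sub _ _).trans ?_
          refine (add_le_add b1 b2).trans (le_of_eq ?_)
          ring
      _ ≤ _ := by
          rw [← Finset.mul_sum]
          gcongr
          exact sum_log_le hκa N
  have hsum : ∑ m ∈ Finset.range N, (imageTerm a s ξ U V m - flatTerm (a / s) (ξ / s) U V m) =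
      a * g₀ * ((s - ξ) * ∑ m ∈ Finset.range N, cschReg' (z m)) -
      a ^ 2 * g₁ * (∑ m ∈ Finset.range N, cschReg' (y m) + ∑ m ∈ Finset.range N, cschReg' (x m)) +
      ∑ m ∈ Finset.range N, (EU (y m) - EV (x m)) := by
    simp only [hterm, Finset.sum_add_distrib, Finset.sum_sub_distrib, Finset.mul_sum, mul_add]
  rw [hsum]
  set Sz := ∑ m ∈ Finset.range N, cschReg' (z m)
  set Sy := ∑ m ∈ Finset.range N, cschReg' (y m)
  set Sx := ∑ m ∈ Finset.range N, cschReg' (x m)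
  have b1 : |a * g₀ * ((s - ξ) * Sz)| ≤ a * |g₀| * (Φ + 65 * s) := by
    rw [abs_mul, abs_mul, abs_of_pos ha, abs_mul, abs_of_nonneg (by linarith : 0 ≤ s - ξ)]
    gcongr
    refine le_trans ?_ hzI
    gcongr
    linarith
  have b2 : |a ^ 2 * g₁ * (Sy + Sx)| ≤ 2 * a ^ 2 * |g₁| * (Φ / s + 65) := by
    have c1 : |Sy| ≤ Φ / s + 65 := by
      rw [div_add' _ _ _ hs.ne', le_div_iff₀ hs]; linarith
    have c2 : |Sx| ≤ Φ / s + 65 := by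
      rw [div_add' _ _ _ hs.ne', le_div_iff₀ hs]; linarith
    rw [abs_mul, abs_mul, abs_of_pos (by positivity : 0 < a ^ 2)]
    calc a ^ 2 * |g₁| * |Sy + Sx| ≤ a ^ 2 * |g₁| * ((Φ / s + 65) + (Φ / s + 65)) := by
          gcongr
          exact (abs_add_le _ _).trans (add_le_add c1 c2)
      _ = _ := by ring
  refine (abs_add_le _ _).trans (add_le_add ((abs_sub _ _).trans (add_le_add b1 b2)) hEs)

/-! ### Asymptotics of the sums over image charges -/

lemma quadLip_mul {K : ℝ → ℝ} {g M T : ℝ} (hM : 0 ≤ M) (hK : QuadLip K M T) (hK0 : K 0 = 0)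
    {t t' : ℝ} (ht : t ∈ Icc 0 T) (ht' : t' ∈ Icc 0 T) :
    |t * (g * t + K t) - t' * (g * t' + K t')| ≤ (|g| + 2 * M * T) * (t + t') * |t - t'| := by
  have hT : 0 ≤ T := ht.1.trans ht.2
  have m1 : t ∈ Icc (-T) T := ⟨by linarith [ht.1], ht.2⟩
  have m2 : t' ∈ Icc (-T) T := ⟨by linarith [ht'.1], ht'.2⟩
  have k1 := hK t m1 t' m2
  have k2 := hK t' m2 0 ⟨by linarith, hT⟩
  rw [hK0, sub_zero, abs_zero, add_zero, sub_zero, abs_of_nonneg ht'.1] at k2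
  rw [abs_of_nonneg ht.1, abs_of_nonneg ht'.1] at k1
  have e : t * (g * t + K t) - t' * (g * t' + K t') =
      g * (t + t') * (t - t') + t * (K t - K t') + (t - t') * K t' := by ring
  have h0 := abs_nonneg (t - t')
  have b1 : |g * (t + t') * (t - t')| = |g| * (t + t') * |t - t'| := by
    rw [abs_mul, abs_mul, abs_of_nonneg (add_nonneg ht.1 ht'.1)]
  have b2 : |t * (K t - K t')| ≤ T * (M * (t + t') * |t - t'|) := by
    rw [abs_mul, abs_of_nonneg ht.1]
    exact mul_le_mul ht.2 k1 (abs_nonneg _) hT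
  have b3 : |(t - t') * K t'| ≤ |t - t'| * (M * T * (t + t')) := by
    rw [abs_mul]
    gcongr
    refine k2.trans ?_
    have := ht.1
    have := ht'.1
    have := ht'.2
    rw [mul_assoc, mul_assoc]
    gcongr
    linarith
  rw [e]
  refine (abs_add_le _ _).trans ((add_le_add ((abs_add_le _ _).trans
    (add_le_add b1.le b2)) b3).trans (le_of_eq ?_))
  ring

/-- Dependence of `flatTerm` on its parameters, uniformly for `η` away from `0`. For constant data the
two parts of the term have to be taken together, for summability over `m`. -/
lemma abs_flatTerm_sub_le {κ Λ g₀ g₁ M T l l₀ η η₀ : ℝ} {U V : ℝ → ℝ} (hκ : 0 < κ) (hκ1 : κ ≤ 1)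
    (hη : η ∈ Icc κ 1) (hη₀ : η₀ ∈ Icc κ 1) (hl : l ∈ Icc 0 Λ) (hl₀ : l₀ ∈ Icc 0 Λ)
    (hT : Λ / κ ≤ T) (hM : 0 ≤ M)
    (hU : QuadLip (fun t => U t - g₀ - g₁ * t) M T) (hU0 : U 0 = g₀)
    (hV : QuadLip (fun t => V t - g₀ - -g₁ * t) M T) (hV0 : V 0 = g₀) (m : ℕ) :
    |flatTerm l η U V m - flatTerm l₀ η₀ U V m| ≤
      (|g₀| + 4 * (|g₁| + 2 * M * T) * (Λ / κ)) * (|l - l₀| / κ + Λ * |η - η₀| / κ ^ 2) *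
        (1 / ((m : ℝ) + 1) ^ 2) := by
  set X := |l - l₀| / κ + Λ * |η - η₀| / κ ^ 2 with hX
  have hΛ : 0 ≤ Λ := hl.1.trans hl.2
  have hm : (0 : ℝ) < (m : ℝ) + 1 := by positivity
  have hlow : ∀ e ∈ Icc κ 1, κ * ((m : ℝ) + 1) ≤ m + e := by
    intro e he
    have : (m : ℝ) * κ ≤ m * 1 := by gcongr
    linarith [he.1]
  have hpos : ∀ e ∈ Icc κ 1, 0 < (m : ℝ) + e := fun e he =>
    (by positivity : 0 < κ * ((m : ℝ) + 1)).trans_le (hlow e he)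
  have h1mem : (1 : ℝ) ∈ Icc κ 1 := ⟨hκ1, le_rfl⟩
  have hle : ∀ e ∈ Icc κ 1, ∀ x ∈ Icc 0 Λ, x / (m + e) ≤ Λ / κ / (m + 1) := by
    intro e he x hx
    have := hlow e he
    have := hx.2
    rw [div_div]
    gcongr
  have hmem : ∀ e ∈ Icc κ 1, ∀ x ∈ Icc 0 Λ, x / (m + e) ∈ Icc 0 T := by
    intro e he x hx
    refine ⟨div_nonneg hx.1 (hpos e he).le, (hle e he x hx).trans (le_trans ?_ hT)⟩
    apply div_le_self (by positivity)
    linarith [(Nat.cast_nonneg m : (0 : ℝ) ≤ m)]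
  have hdiff : ∀ e ∈ Icc κ 1, ∀ e₀ ∈ Icc κ 1, |e - e₀| ≤ |η - η₀| →
      |l / (m + e) - l₀ / (m + e₀)| ≤ X * (1 / ((m : ℝ) + 1)) := by
    intro e he e₀ he₀ hee
    have p := hpos e he
    have p₀ := hpos e₀ he₀
    have : l / (m + e) - l₀ / (m + e₀) =
        (l - l₀) / (m + e) + l₀ * (e₀ - e) / ((m + e) * (m + e₀)) := by field_simp; ring
    rw [this, hX, add_mul (|l - l₀| / κ)]
    refine (abs_add_le _ _).trans (add_le_add ?_ ?_)
    · rw [abs_div, abs_of_pos p, mul_one_div, div_div]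
      gcongr
      exact hlow e he
    · rw [abs_div, abs_of_pos (mul_pos p p₀), abs_mul, abs_of_nonneg hl₀.1, mul_one_div, div_div,
        abs_sub_comm]
      have q := hlow e he
      have q₀ := hlow e₀ he₀
      have hl2 := hl₀.2
      have : κ ^ 2 * ((m : ℝ) + 1) ≤ (m + e) * (m + e₀) := by
        calc κ ^ 2 * ((m : ℝ) + 1) ≤ κ ^ 2 * ((m : ℝ) + 1) ^ 2 := by
              gcongr
              nlinarith [(Nat.cast_nonneg m : (0 : ℝ) ≤ m)]
          _ = (κ * ((m : ℝ) + 1)) * (κ * ((m : ℝ) + 1)) := by ring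
          _ ≤ _ := by gcongr
      gcongr
  have hX0 : 0 ≤ X := by positivity
  have hmain : |(l / (m + 1) - l / (m + η)) - (l₀ / (m + 1) - l₀ / (m + η₀))| ≤
      X * (1 / ((m : ℝ) + 1) ^ 2) := by
    have p := hpos η hη
    have p₀ := hpos η₀ hη₀
    have q := hlow η hη
    have q₀ := hlow η₀ hη₀
    have : (l / (m + 1) - l / (m + η)) - (l₀ / (m + 1) - l₀ / (m + η₀)) =
        (l - l₀) * (η - 1) / ((m + 1) * (m + η)) + l₀ * (η - η₀) / ((m + η) * (m + η₀)) := by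
      field_simp; ring
    rw [this, hX, add_mul (|l - l₀| / κ)]
    refine (abs_add_le _ _).trans (add_le_add ?_ ?_)
    · rw [abs_div, abs_of_pos (mul_pos hm p), abs_mul, mul_one_div, div_div]
      have h1 : |η - 1| ≤ 1 := by rw [abs_le]; constructor <;> linarith [hη.1, hη.2]
      calc |l - l₀| * |η - 1| / (((m : ℝ) + 1) * (m + η)) ≤
            |l - l₀| * 1 / (((m : ℝ) + 1) * (κ * (m + 1))) := by gcongr
        _ = _ := by rw [mul_one]; congr 1; ring
    · rw [abs_div, abs_of_pos (mul_pos p p₀), abs_mul, abs_of_nonneg hl₀.1, mul_one_div, div_div]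
      have hl2 := hl₀.2
      have : κ ^ 2 * ((m : ℝ) + 1) ^ 2 ≤ (m + η) * (m + η₀) := by
        calc κ ^ 2 * ((m : ℝ) + 1) ^ 2
           = (κ * ((m : ℝ) + 1)) * (κ * ((m : ℝ) + 1)) := by ring
          _ ≤ _ := by gcongr
      gcongr
  have hP : ∀ (K : ℝ → ℝ) (g : ℝ), |g| = |g₁| → QuadLip K M T → K 0 = 0 →
      ∀ e ∈ Icc κ 1, ∀ e₀ ∈ Icc κ 1, |e - e₀| ≤ |η - η₀| →
      |l / (m + e) * (g * (l / (m + e)) + K (l / (m + e))) -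
        l₀ / (m + e₀) * (g * (l₀ / (m + e₀)) + K (l₀ / (m + e₀)))| ≤
      2 * (|g₁| + 2 * M * T) * (Λ / κ) * X * (1 / ((m : ℝ) + 1) ^ 2) := by
    intro K g hg hK hK0 e he e₀ he₀ hee
    have b := quadLip_mul (g := g) hM hK hK0 (hmem e he l hl) (hmem e₀ he₀ l₀ hl₀)
    have hT0 : 0 ≤ T := le_trans (by positivity) hT
    rw [hg] at b
    calc _ ≤ _ := b
      _ ≤ (|g₁| + 2 * M * T) * (Λ / κ / (m + 1) + Λ / κ / (m + 1)) * (X * (1 / ((m : ℝ) + 1))) := by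
          have := hle e he l hl
          have := hle e₀ he₀ l₀ hl₀
          have := hdiff e he e₀ he₀ hee
          gcongr
      _ = _ := by field_simp; ring
  have pU := hP _ g₁ rfl hU (by simp [hU0]) 1 h1mem 1 h1mem (by simp)
  have pV := hP _ (-g₁) (abs_neg _) hV (by simp [hV0]) η hη η₀ hη₀ le_rfl
  set A := l / ((m : ℝ) + 1)
  set A₀ := l₀ / ((m : ℝ) + 1)
  set B := l / ((m : ℝ) + η)
  set B₀ := l₀ / ((m : ℝ) + η₀)
  have hsplit : flatTerm l η U V m - flatTerm l₀ η₀ U V m =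
      g₀ * ((A - B) - (A₀ - B₀)) +
      (A * (g₁ * A + (U A - g₀ - g₁ * A)) - A₀ * (g₁ * A₀ + (U A₀ - g₀ - g₁ * A₀))) -
      (B * (-g₁ * B + (V B - g₀ - -g₁ * B)) - B₀ * (-g₁ * B₀ + (V B₀ - g₀ - -g₁ * B₀))) := by
    change (A * U A - B * V B) - (A₀ * U A₀ - B₀ * V B₀) = _
    ring
  rw [hsplit]
  have b0 : |g₀ * ((A - B) - (A₀ - B₀))| ≤ |g₀| * (X * (1 / ((m : ℝ) + 1) ^ 2)) := by
    rw [abs_mul]; gcongr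
  refine (abs_sub _ _).trans ((add_le_add ((abs_add_le _ _).trans (add_le_add b0 pU)) pV).trans
    (le_of_eq ?_))
  ring

lemma summable_one_div_succ_sq : Summable fun m : ℕ => 1 / ((m : ℝ) + 1) ^ 2 := by
  have := (summable_nat_add_iff 1).2 (Real.summable_one_div_nat_pow.2 (by norm_num : 1 < 2))
  simpa using this

lemma arsinh_bounds {x : ℝ} (hx : 0 < x) (hx1 : x ≤ 1 / 2) :
    0 < arsinh x ∧ arsinh x ≤ x ∧ x - x ^ 3 ≤ arsinh x ∧ x / 2 ≤ arsinh x := by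
  have h0 : 0 < arsinh x := arsinh_pos_iff.2 hx
  have h1 := self_lt_sinh h0
  rw [sinh_arsinh] at h1
  have h2 := sinh_taylor h0.le (by linarith)
  rw [sinh_arsinh] at h2
  set θ := arsinh x
  have h3 := (abs_le.1 h2).2
  have h4 : θ ^ 3 ≤ x ^ 3 := by gcongr
  have h5 : θ ^ 5 ≤ θ ^ 3 := pow_le_pow_of_le_one h0.le (by linarith) (by norm_num)
  have h6 : 0 ≤ θ ^ 3 := by positivity
  have h7 : x - x ^ 3 ≤ θ := by nlinarith
  refine ⟨h0, h1.le, h7, ?_⟩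
  nlinarith [mul_pos hx hx]

/-- For small `a`, the ratios `a / s` and `ξ / s`, where `sinh ξ = a / r₁`, `sinh ζ = a / r₂` and
`s = ξ + ζ`, differ from their limits by `O(a²)`. -/
lemma foci_params {r₁ r₂ a : ℝ} (h₁ : 0 < r₁) (h₂ : 0 < r₂) (ha0 : 0 < a) (ha2 : a ≤ r₁ / 2)
    (ha3 : a ≤ r₂ / 2) :
    let R := r₁ * r₂ / (r₁ + r₂)
    let e := r₂ / (r₁ + r₂)
    let c := 1 / r₁ ^ 3 + 1 / r₂ ^ 3
    let ξ := arsinh (a / r₁)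
    let s := arsinh (a / r₁) + arsinh (a / r₂)
    0 < s ∧ s ≤ a / R ∧ a / r₁ / 2 ≤ ξ ∧ ξ ≤ s ∧ a / s ≤ 2 * R ∧ e / 2 ≤ ξ / s ∧
      |a / s - R| ≤ 2 * R ^ 2 * c * a ^ 2 ∧ |ξ / s - e| ≤ 2 * R * c * a ^ 2 := by
  intro R e c ξ s
  have hR : R = r₁ * r₂ / (r₁ + r₂) := rfl
  have he : e = r₂ / (r₁ + r₂) := rfl
  have hc : c = 1 / r₁ ^ 3 + 1 / r₂ ^ 3 := rfl
  have hR0 : 0 < R := by positivity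
  have he0 : 0 < e := by positivity
  have hc0 : 0 < c := by positivity
  set x := a / r₁ with hx
  set y := a / r₂ with hy
  have hx0 : 0 < x := by positivity
  have hy0 : 0 < y := by positivity
  obtain ⟨b1, b2, b3, b4⟩ := arsinh_bounds hx0 (by rw [hx, div_le_iff₀ h₁]; linarith)
  obtain ⟨d1, d2, d3, d4⟩ := arsinh_bounds hy0 (by rw [hy, div_le_iff₀ h₂]; linarith)
  have hξ : ξ = arsinh x := rfl
  have hs : s = arsinh x + arsinh y := rfl
  rw [← hξ] at b1 b2 b3 b4 hs
  set ζ := arsinh y with hζ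
  have hs0 : 0 < s := by rw [hs]; positivity
  have hσ : x + y = a / R := by rw [hx, hy, hR]; field_simp; ring
  have hsle : s ≤ a / R := by linarith
  have hsge : a / R / 2 ≤ s := by linarith
  have hcube : x ^ 3 + y ^ 3 = c * a ^ 3 := by rw [hx, hy, hc]; field_simp
  have hl : a / s ≤ 2 * R := by
    rw [div_le_iff₀ hs0]
    have : a = 2 * R * (a / R / 2) := by field_simp
    nlinarith
  have hη : e / 2 ≤ ξ / s := by
    have hexy : e = x / (x + y) := by rw [hx, hy, he]; field_simp; rw [add_comm]
    rw [hexy, le_div_iff₀ hs0]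
    have : x / (x + y) / 2 * s ≤ x / (x + y) / 2 * (x + y) := by gcongr; linarith
    refine this.trans (le_trans (le_of_eq ?_) b4)
    field_simp
  have hlR : |a / s - R| ≤ 2 * R ^ 2 * c * a ^ 2 := by
    have e1 : a / s - R = R * (a / R - s) / s := by field_simp
    have e2 : 0 ≤ a / R - s := by linarith
    have e3 : a / R - s ≤ c * a ^ 3 := by rw [← hcube, ← hσ]; linarith
    rw [e1, abs_of_nonneg (by positivity), div_le_iff₀ hs0]
    calc R * (a / R - s) ≤ R * (c * a ^ 3) := by gcongr
      _ = 2 * R ^ 2 * c * a ^ 2 * (a / R / 2) := by field_simp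
      _ ≤ _ := by gcongr
  have hηe : |ξ / s - e| ≤ 2 * R * c * a ^ 2 := by
    have hexy : e = x / (x + y) := by rw [hx, hy, he]; field_simp; rw [add_comm]
    have e1 : ξ / s - e = ((ξ - x) * y + x * (y - ζ)) / (s * (x + y)) := by
      rw [hexy, div_sub_div _ _ hs0.ne' (by positivity), hs]; congr 1; ring
    have e2 : |(ξ - x) * y + x * (y - ζ)| ≤ c * a ^ 3 * (x + y) := by
      rw [← hcube, abs_le]
      have p1 := mul_le_mul_of_nonneg_right (by linarith : x - ξ ≤ x ^ 3) hy0.le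
      have p2 := mul_nonneg (by linarith : 0 ≤ x - ξ) hy0.le
      have p3 := mul_le_mul_of_nonneg_left (by linarith : y - ζ ≤ y ^ 3) hx0.le
      have p4 := mul_nonneg hx0.le (by linarith : 0 ≤ y - ζ)
      have p5 : 0 ≤ x ^ 3 * x := by positivity
      have p6 : 0 ≤ x ^ 3 * y := by positivity
      have p7 : 0 ≤ y ^ 3 * x := by positivity
      have p8 : 0 ≤ y ^ 3 * y := by positivity
      constructor <;> linarith
    rw [e1, abs_div, abs_of_pos (by positivity : 0 < s * (x + y)), div_le_iff₀ (by positivity)]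
    refine e2.trans ?_
    rw [← mul_assoc]
    refine mul_le_mul_of_nonneg_right ?_ (by positivity)
    calc c * a ^ 3 = 2 * R * c * a ^ 2 * (a / R / 2) := by field_simp
      _ ≤ _ := by gcongr
  exact ⟨hs0, hsle, b4, by linarith, hl, hη, hlR, hηe⟩

/-- The sum over image charges, as the half distance `a` of the foci tends to `0`. -/
theorem imageTerm_asymptotics {r₁ r₂ : ℝ} (h₁ : 0 < r₁) (h₂ : 0 < r₂) {U V : ℝ → ℝ}
    (hU : ContDiff ℝ 2 U) (hV : ContDiff ℝ 2 V) (h0 : V 0 = U 0) (hd : deriv V 0 = -deriv U 0) :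
    Summable (flatTerm (r₁ * r₂ / (r₁ + r₂)) (r₂ / (r₁ + r₂)) U V) ∧
    ∃ C, ∃ a₀ > 0, ∀ a ∈ Ioo 0 a₀, ∀ L, Tendsto (fun N => ∑ m ∈ Finset.range N,
        imageTerm a (arsinh (a / r₁) + arsinh (a / r₂)) (arsinh (a / r₁)) U V m) atTop (𝓝 L) →
      |L - ∑' m, flatTerm (r₁ * r₂ / (r₁ + r₂)) (r₂ / (r₁ + r₂)) U V m| ≤
        C * (a ^ 2 * (1 + |log a|)) := by
  set R := r₁ * r₂ / (r₁ + r₂) with hR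
  set e := r₂ / (r₁ + r₂) with he
  have hR0 : 0 < R := by positivity
  have he0 : 0 < e := by positivity
  have he1 : e ≤ 1 := by rw [he, div_le_one (by positivity)]; linarith
  set κ := e / 2 with hκ
  have hκ0 : 0 < κ := by positivity
  have hκ1 : κ ≤ 1 := by linarith
  set κ₁ := 1 / (2 * r₁) with hκ₁
  have hκ₁0 : 0 < κ₁ := by positivity
  set Λ := 2 * R with hΛ
  have hΛ0 : 0 < Λ := by positivity
  set T := max (1 / κ₁ + 1) (Λ / κ) with hT
  set g₀ := U 0 with hg₀
  set g₁ := deriv U 0 with hg₁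
  obtain ⟨M₁, hM₁, hUq'⟩ := exists_quadLip hU T
  obtain ⟨M₂, hM₂, hVq'⟩ := exists_quadLip hV T
  set M := M₁ + M₂ with hMd
  have hM : 0 ≤ M := add_nonneg hM₁ hM₂
  have hmono : ∀ {K : ℝ → ℝ} {M' : ℝ}, QuadLip K M' T → M' ≤ M → QuadLip K M T := by
    intro K M' hK hle t ht t' ht'
    refine (hK t ht t' ht').trans ?_
    gcongr
  have hUq := hmono hUq' (by linarith)
  have hVq : QuadLip (fun t => V t - g₀ - -g₁ * t) M T := by
    have := hmono hVq' (by linarith)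
    rwa [h0, hd] at this
  set D := |g₀| + 4 * (|g₁| + 2 * M * T) * (Λ / κ) with hD
  have hT0 : 0 ≤ T := le_trans (by positivity : 0 ≤ Λ / κ) (le_max_right _ _)
  have hD0 : 0 ≤ D := by positivity
  have hem : e ∈ Icc κ 1 := ⟨by linarith, he1⟩
  have hcmp : ∀ l ∈ Icc 0 Λ, ∀ l₀ ∈ Icc 0 Λ, ∀ η ∈ Icc κ 1, ∀ η₀ ∈ Icc κ 1, ∀ m,
      |flatTerm l η U V m - flatTerm l₀ η₀ U V m| ≤
      D * (|l - l₀| / κ + Λ * |η - η₀| / κ ^ 2) * (1 / ((m : ℝ) + 1) ^ 2) :=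
    fun l hl l₀ hl₀ η hη η₀ hη₀ m => abs_flatTerm_sub_le hκ0 hκ1 hη hη₀ hl hl₀ (le_max_right _ _)
      hM hUq rfl hVq h0 m
  have hsumm : ∀ l ∈ Icc 0 Λ, ∀ η ∈ Icc κ 1, Summable (flatTerm l η U V) := by
    intro l hl η hη
    refine Summable.of_norm_bounded (summable_one_div_succ_sq.mul_left
      (D * (|l - 0| / κ + Λ * |η - η| / κ ^ 2))) fun m => ?_
    have := hcmp l hl 0 ⟨le_rfl, hΛ0.le⟩ η hη η hη m
    have hz : flatTerm 0 η U V m = 0 := by simp [flatTerm]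
    rwa [hz, sub_zero] at this
  have hRm : R ∈ Icc 0 Λ := ⟨hR0.le, by linarith⟩
  refine ⟨hsumm R hRm e hem, ?_⟩
  set Z := ∑' m : ℕ, 1 / ((m : ℝ) + 1) ^ 2 with hZ
  have hZ0 : 0 ≤ Z := tsum_nonneg fun m => by positivity
  set c := 1 / r₁ ^ 3 + 1 / r₂ ^ 3 with hc
  have hc0 : 0 < c := by positivity
  set E := |log ((1 + κ₁) / κ₁)| with hE
  set C₁ := 65 * |g₀| / R + 130 * |g₁| + 68 * M / κ₁ * (1 + E) with hC₁
  set C₂ := D * (2 * R ^ 2 * c / κ + Λ * (2 * R * c) / κ ^ 2) * Z with hC₂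
  have hC₁0 : 0 ≤ C₁ := by positivity
  have hC₂0 : 0 ≤ C₂ := by positivity
  refine ⟨C₁ + C₂, min 1 (min (r₁ / 2) (min (r₂ / 2) R)), by positivity, fun a ha L hL => ?_⟩
  have ha0 : 0 < a := ha.1
  obtain ⟨ha1, ha2, ha3, ha4⟩ : a < 1 ∧ a < r₁ / 2 ∧ a < r₂ / 2 ∧ a < R := by
    simpa only [lt_min_iff] using ha.2
  obtain ⟨hs0, hsle, b4, hξs, hl', hη', hlR, hηe⟩ := foci_params h₁ h₂ ha0 ha2.le ha3.le
  set ξ := arsinh (a / r₁)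
  set s := ξ + arsinh (a / r₂)
  rw [← hR] at hlR hηe hl' hsle
  rw [← he] at hηe hη'
  rw [← hc] at hηe hlR
  have hs1 : s ≤ 1 := hsle.trans ((div_le_one hR0).2 ha4.le)
  have hl : a / s ∈ Icc 0 Λ := ⟨by positivity, hl'⟩
  have hη : ξ / s ∈ Icc κ 1 := ⟨hη', (div_le_one hs0).2 hξs⟩
  have hflat := hsumm _ hl _ hη
  have hκξ : κ₁ * a ≤ ξ := by
    refine le_trans (le_of_eq ?_) b4
    rw [hκ₁]; field_simp
  have hthird : log ((1 + κ₁ * a) / (κ₁ * a)) ≤ E + |log a| := by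
    have h1 : (1 + κ₁ * a) / (κ₁ * a) ≤ (1 + κ₁) / κ₁ * (1 / a) := by
      rw [div_mul_div_comm, mul_one]
      gcongr
      exact mul_le_of_le_one_right hκ₁0.le ha1.le
    refine (log_le_log (by positivity) h1).trans ?_
    rw [log_mul (by positivity) (by positivity), one_div, log_inv]
    exact add_le_add (le_abs_self _) (neg_le_abs _)
  have hlog0 : 0 ≤ 1 + log ((1 + κ₁ * a) / (κ₁ * a)) := by
    have : 1 ≤ (1 + κ₁ * a) / (κ₁ * a) := by
      rw [le_div_iff₀ (by positivity)]; linarith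
    linarith [log_nonneg this]
  -- replace hyperbolic functions by rational ones, with the actual `a / s` and `ξ / s`
  have hstage1 : |L - ∑' m, flatTerm (a / s) (ξ / s) U V m| ≤ C₁ * (a ^ 2 * (1 + |log a|)) := by
    have hlim : Tendsto (fun N => |∑ m ∈ Finset.range N,
        (imageTerm a s ξ U V m - flatTerm (a / s) (ξ / s) U V m)|) atTop
        (𝓝 |L - ∑' m, flatTerm (a / s) (ξ / s) U V m|) := by
      refine Tendsto.abs ?_
      simp only [Finset.sum_sub_distrib]
      exact hL.sub hflat.hasSum.tendsto_sum_nat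
    have hθ : Tendsto (fun N : ℕ => (N : ℝ) * s + ξ) atTop atTop :=
      tendsto_atTop_add_const_right _ _ (tendsto_natCast_atTop_atTop.atTop_mul_const hs0)
    have hcs : Tendsto (fun N : ℕ => |cschReg ((N : ℝ) * s + ξ)|) atTop (𝓝 0) := by
      refine squeeze_zero (fun _ => abs_nonneg _) (fun N => abs_cschReg_le_inv
        (add_pos_of_nonneg_of_pos (by positivity) ((by positivity : 0 < κ₁ * a).trans_le hκξ))) ?_
      simpa using! hθ.inv_tendsto_atTop
    have hb : Tendsto (fun N : ℕ => a * |g₀| * (|cschReg (N * s + ξ)| + 65 * s) +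
        2 * a ^ 2 * |g₁| * (|cschReg (N * s + ξ)| / s + 65) +
        68 * M * (a ^ 2 / κ₁) * (1 + log ((1 + κ₁ * a) / (κ₁ * a)))) atTop
        (𝓝 (a * |g₀| * (0 + 65 * s) + 2 * a ^ 2 * |g₁| * (0 / s + 65) +
        68 * M * (a ^ 2 / κ₁) * (1 + log ((1 + κ₁ * a) / (κ₁ * a))))) :=
      (((hcs.add_const _).const_mul _).add (((hcs.div_const _).add_const _).const_mul _)).add_const _
    refine (le_of_tendsto_of_tendsto' hlim hb fun N =>
      abs_sum_imageTerm_sub_le hκ₁0 ha0 ha1.le hκξ hξs hs1 (le_max_left _ _) hM hUq rfl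
        hVq h0 N).trans ?_
    have q0 : 0 ≤ |log a| := abs_nonneg _
    have hE0 : 0 ≤ E := abs_nonneg _
    have t1 : a * |g₀| * (0 + 65 * s) ≤ 65 * |g₀| / R * (a ^ 2 * (1 + |log a|)) := by
      calc a * |g₀| * (0 + 65 * s) ≤ a * |g₀| * (0 + 65 * (a / R)) := by gcongr
        _ = 65 * |g₀| / R * (a ^ 2 * (1 + 0)) := by field_simp; ring
        _ ≤ _ := by gcongr
    have t2 : 2 * a ^ 2 * |g₁| * (0 / s + 65) ≤ 130 * |g₁| * (a ^ 2 * (1 + |log a|)) := by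
      calc 2 * a ^ 2 * |g₁| * (0 / s + 65) = 130 * |g₁| * (a ^ 2 * (1 + 0)) := by
            rw [zero_div]; ring
        _ ≤ _ := by gcongr
    have t3 : 68 * M * (a ^ 2 / κ₁) * (1 + log ((1 + κ₁ * a) / (κ₁ * a))) ≤
        68 * M / κ₁ * (1 + E) * (a ^ 2 * (1 + |log a|)) := by
      calc _ ≤ 68 * M * (a ^ 2 / κ₁) * (1 + (E + |log a|)) := by gcongr
        _ ≤ 68 * M * (a ^ 2 / κ₁) * ((1 + E) * (1 + |log a|)) := by
            gcongr
            linarith [mul_nonneg hE0 q0]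
        _ = _ := by ring
    rw [hC₁]
    linarith
  -- replace `a / s` and `ξ / s` by their limits `R` and `e`
  have hstage2 : |∑' m, flatTerm (a / s) (ξ / s) U V m - ∑' m, flatTerm R e U V m| ≤
      C₂ * (a ^ 2 * (1 + |log a|)) := by
    rw [← (hflat.tsum_sub (hsumm R hRm e hem)), ← Real.norm_eq_abs]
    refine (tsum_of_norm_bounded (summable_one_div_succ_sq.hasSum.mul_left
      (D * (|a / s - R| / κ + Λ * |ξ / s - e| / κ ^ 2)))
      (fun m => hcmp _ hl _ hRm _ hη _ hem m)).trans ?_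
    calc D * (|a / s - R| / κ + Λ * |ξ / s - e| / κ ^ 2) * Z ≤
        D * (2 * R ^ 2 * c * a ^ 2 / κ + Λ * (2 * R * c * a ^ 2) / κ ^ 2) * Z := by gcongr
      _ = C₂ * (a ^ 2 * (1 + 0)) := by rw [hC₂]; ring
      _ ≤ _ := by gcongr; exact abs_nonneg _
  calc _ ≤ _ := abs_sub_le _ (∑' m, flatTerm (a / s) (ξ / s) U V m) _
    _ ≤ _ := add_le_add hstage1 hstage2
    _ = _ := by ring

/-! ### The digamma and polygamma series -/

/-- The `m`-th term of the series for the `k`-th derivative of `ψ(z) + γ`. The second clause has the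
order `k + 1`, so that its sign is `(-1) ^ k`. -/
def polyTerm : ℕ → ℕ → ℂ → ℂ
  | 0, m, z => 1 / ((m : ℂ) + 1) - 1 / (m + z)
  | k + 1, m, z => (-1) ^ k * ((k + 1).factorial : ℂ) / (m + z) ^ (k + 2)

lemma natCast_add_ne_zero {z : ℂ} (hz : 0 < z.re) (m : ℕ) : (m : ℂ) + z ≠ 0 := by
  intro h
  have := congrArg Complex.re h
  simp only [Complex.add_re, Complex.natCast_re, Complex.zero_re] at this
  have : (0 : ℝ) ≤ m := Nat.cast_nonneg m
  linarith

lemma hasDerivAt_polyTerm (k m : ℕ) {z : ℂ} (hz : 0 < z.re) :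
    HasDerivAt (polyTerm k m) (polyTerm (k + 1) m z) z := by
  have hne := natCast_add_ne_zero hz m
  have h1 : HasDerivAt (fun z : ℂ => (m : ℂ) + z) 1 z := (hasDerivAt_id z).const_add _
  cases k with
  | zero =>
    have := (h1.inv hne).const_sub (1 / ((m : ℂ) + 1))
    refine (this.congr_deriv ?_).congr_of_eventuallyEq (Eventually.of_forall fun y => ?_)
    · simp [polyTerm]; ring_nf
    · simp [polyTerm]
  | succ k =>
    have := ((h1.pow (k + 2)).inv (pow_ne_zero _ hne)).const_mul
      ((-1) ^ k * ((k + 1).factorial : ℂ))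
    refine (this.congr_deriv ?_).congr_of_eventuallyEq (Eventually.of_forall fun y => ?_)
    · rw [polyTerm, Nat.factorial_succ (k + 1), Pi.pow_apply]
      push_cast
      field_simp
      ring
    · simp [polyTerm, div_eq_mul_inv]

/-- Open convex subsets exhausting the right half plane. -/
def halfPlanePart (κ B : ℝ) : Set ℂ := {z | κ < z.re} ∩ Metric.ball 0 B

lemma isOpen_halfPlanePart (κ B : ℝ) : IsOpen (halfPlanePart κ B) :=
  (isOpen_lt continuous_const Complex.continuous_re).inter Metric.isOpen_ball

lemma exists_polyTerm_bound {κ : ℝ} (hκ : 0 < κ) (hκ1 : κ ≤ 1) (B : ℝ) (k : ℕ) :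
    ∃ C, ∀ m, ∀ z ∈ halfPlanePart κ B, ‖polyTerm k m z‖ ≤ C * (1 / ((m : ℝ) + 1) ^ 2) := by
  have hlow : ∀ m : ℕ, ∀ z ∈ halfPlanePart κ B, κ * ((m : ℝ) + 1) ≤ ‖(m : ℂ) + z‖ := by
    intro m z hz
    have h1 : κ < z.re := hz.1
    have h2 : ((m : ℂ) + z).re ≤ ‖(m : ℂ) + z‖ := Complex.re_le_norm _
    have h3 : (m : ℝ) * κ ≤ m * 1 := by gcongr
    simp only [Complex.add_re, Complex.natCast_re] at h2
    linarith
  cases k with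
  | zero =>
    refine ⟨(B + 1) / κ, fun m z hz => ?_⟩
    have hzpos : 0 < z.re := hκ.trans hz.1
    have hne := natCast_add_ne_zero hzpos m
    have hne1 : (m : ℂ) + 1 ≠ 0 := natCast_add_ne_zero (by simp) m
    have hB : ‖z‖ < B := by simpa using hz.2
    have e : polyTerm 0 m z = (z - 1) / (((m : ℂ) + 1) * (m + z)) := by
      simp only [polyTerm]; field_simp; ring
    have hn1 : ‖(m : ℂ) + 1‖ = (m : ℝ) + 1 := by
      rw [← Nat.cast_succ, Complex.norm_natCast]; simp
    rw [e, norm_div, norm_mul, hn1]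
    have hz1 : ‖z - 1‖ ≤ B + 1 := (norm_sub_le _ _).trans (by rw [norm_one]; linarith)
    have hB0 : 0 ≤ B + 1 := (norm_nonneg _).trans hz1
    calc ‖z - 1‖ / (((m : ℝ) + 1) * ‖(m : ℂ) + z‖) ≤
          (B + 1) / (((m : ℝ) + 1) * (κ * (m + 1))) := by gcongr; exact hlow m z hz
      _ = _ := by field_simp
  | succ k =>
    refine ⟨((k + 1).factorial : ℝ) / κ ^ (k + 2), fun m z hz => ?_⟩
    rw [polyTerm, norm_div, norm_mul, norm_pow, norm_neg, norm_one, one_pow, one_mul, norm_pow,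
      Complex.norm_natCast, div_mul_div_comm, mul_one]
    gcongr
    calc κ ^ (k + 2) * ((m : ℝ) + 1) ^ 2 ≤ κ ^ (k + 2) * ((m : ℝ) + 1) ^ (k + 2) := by
          gcongr
          · linarith [(Nat.cast_nonneg m : (0 : ℝ) ≤ m)]
          · omega
      _ = (κ * ((m : ℝ) + 1)) ^ (k + 2) := (mul_pow _ _ _).symm
      _ ≤ _ := by gcongr; exact hlow m z hz

lemma exists_mem_halfPlanePart {z : ℂ} (hz : 0 < z.re) :
    ∃ κ B, 0 < κ ∧ κ ≤ 1 ∧ z ∈ halfPlanePart κ B := by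
  refine ⟨min 1 (z.re / 2), ‖z‖ + 1, by positivity, min_le_left _ _, ?_, by simp⟩
  exact (min_le_right _ _).trans_lt (half_lt_self hz)

lemma re_pos_of_mem_halfPlanePart {κ B : ℝ} (hκ : 0 < κ) {z : ℂ} (hz : z ∈ halfPlanePart κ B) :
    0 < z.re := hκ.trans hz.1

/-- The series may be differentiated term by term, by locally uniform convergence. -/
lemma hasSum_polyTerm_deriv {f : ℂ → ℂ} {k : ℕ}
    (h : ∀ z : ℂ, 0 < z.re → HasSum (fun m => polyTerm k m z) (f z)) {z : ℂ} (hz : 0 < z.re) :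
    HasSum (fun m => polyTerm (k + 1) m z) (deriv f z) := by
  obtain ⟨κ, B, hκ, hκ1, hmem⟩ := exists_mem_halfPlanePart hz
  obtain ⟨C, hC⟩ := exists_polyTerm_bound hκ hκ1 B k
  have h1 := Complex.hasSum_deriv_of_summable_norm (summable_one_div_succ_sq.mul_left C)
    (fun m w hw => ((hasDerivAt_polyTerm k m
      (re_pos_of_mem_halfPlanePart hκ hw)).differentiableAt).differentiableWithinAt)
    (isOpen_halfPlanePart κ B) hC hmem
  have h2 : (fun w => ∑' m, polyTerm k m w) =ᶠ[𝓝 z] f := by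
    filter_upwards [(isOpen_halfPlanePart κ B).mem_nhds hmem] with w hw
    exact (h w (re_pos_of_mem_halfPlanePart hκ hw)).tsum_eq
  rw [h2.deriv_eq] at h1
  simpa only [(hasDerivAt_polyTerm k _ hz).deriv] using h1

lemma summable_polyTerm (k : ℕ) {z : ℂ} (hz : 0 < z.re) : Summable fun m => polyTerm k m z := by
  obtain ⟨κ, B, hκ, hκ1, hmem⟩ := exists_mem_halfPlanePart hz
  obtain ⟨C, hC⟩ := exists_polyTerm_bound hκ hκ1 B k
  exact Summable.of_norm_bounded (summable_one_div_succ_sq.mul_left C) fun m => hC m z hmem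

/-- On the positive reals, the digamma function is the derivative of `log Γ`. -/
lemma digamma_ofReal {x : ℝ} (hx : 0 < x) :
    Complex.digamma x = (deriv (log ∘ Gamma) x : ℝ) := by
  have hne : ∀ m : ℕ, x ≠ -m := fun m h => by
    have : (0 : ℝ) ≤ m := Nat.cast_nonneg m
    linarith
  have hneC : ∀ m : ℕ, (x : ℂ) ≠ -m := fun m h => hne m (by exact_mod_cast h)
  have h1 := (Complex.differentiableAt_Gamma _ hneC).hasDerivAt.comp_ofReal
  have h2 := ((differentiableAt_Gamma hne).hasDerivAt).ofReal_comp
  have h3 : deriv Complex.Gamma x = ((deriv Gamma x : ℝ) : ℂ) := by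
    refine h1.unique (h2.congr_of_eventuallyEq (Eventually.of_forall fun y => ?_))
    exact Complex.Gamma_ofReal y
  rw [Complex.digamma_def, logDeriv_apply, h3, Complex.Gamma_ofReal, Function.comp_def,
    deriv.log (differentiableAt_Gamma hne) (Gamma_pos_of_pos hx).ne']
  push_cast
  rfl

lemma deriv_log_Gamma_add_one {x : ℝ} (hx : 0 < x) :
    deriv (log ∘ Gamma) (x + 1) = deriv (log ∘ Gamma) x + 1 / x := by
  have h := Complex.digamma_apply_add_one x (fun m h => by
    have h' : x = -m := by exact_mod_cast h
    have : (0 : ℝ) ≤ m := Nat.cast_nonneg m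
    linarith)
  have e : (x : ℂ) + 1 = ((x + 1 : ℝ) : ℂ) := by push_cast; rfl
  rw [e, digamma_ofReal (by linarith), digamma_ofReal hx] at h
  rw [one_div]
  exact_mod_cast h

lemma deriv_log_Gamma_add_nat {x : ℝ} (hx : 0 < x) (n : ℕ) :
    deriv (log ∘ Gamma) (x + n) =
      deriv (log ∘ Gamma) x + ∑ m ∈ Finset.range n, 1 / ((m : ℝ) + x) := by
  induction n with
  | zero => simp
  | succ n ih =>
    rw [Finset.sum_range_succ, Nat.cast_succ, ← add_assoc, deriv_log_Gamma_add_one (by positivity),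
      ih, add_comm x, add_assoc]

/-- The digamma series on `(1, 2)`: as `ψ` is increasing, `ψ(x + n) - ψ(1 + n)` lies between `0` and
`ψ(2 + n) - ψ(1 + n) = 1 / (n + 1)`, and the functional equation telescopes. -/
lemma hasSum_digamma_real {x : ℝ} (hx : x ∈ Ioo 1 2) :
    ∑' m, polyTerm 0 m x = Complex.digamma x + eulerMascheroniConstant := by
  have hx0 : 0 < x := by linarith [hx.1]
  set d := deriv (log ∘ Gamma) with hd
  have hd1 : d 1 = -eulerMascheroniConstant := by
    have := digamma_ofReal one_pos
    rw [Complex.ofReal_one, Complex.digamma_one] at this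
    exact_mod_cast this.symm
  have hmono : MonotoneOn d (Ioi 0) := convexOn_log_Gamma.monotoneOn_deriv fun y hy => by
    have hy' : (0 : ℝ) < y := hy
    refine DifferentiableAt.log (differentiableAt_Gamma fun m h => ?_) (Gamma_pos_of_pos hy').ne'
    have : (0 : ℝ) ≤ m := Nat.cast_nonneg m
    linarith
  have hlim : Tendsto (fun n : ℕ => d (x + n) - d (1 + n)) atTop (𝓝 0) := by
    refine squeeze_zero (fun n => ?_) (fun n => ?_) (tendsto_one_div_add_atTop_nhds_zero_nat (𝕜 := ℝ))
    · refine sub_nonneg.2 (hmono ?_ ?_ (by linarith [hx.1]))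
      · change (0 : ℝ) < 1 + n; positivity
      · change (0 : ℝ) < x + n; positivity
    · have h1 : d (x + n) ≤ d (1 + n + 1) := by
        refine hmono ?_ ?_ (by linarith [hx.2])
        · change (0 : ℝ) < x + n; positivity
        · change (0 : ℝ) < 1 + n + 1; positivity
      rw [hd, deriv_log_Gamma_add_one (by positivity), add_comm (1 : ℝ) n] at h1
      rw [hd, add_comm (1 : ℝ) n]
      linarith
  have hpart : ∀ n : ℕ, ∑ m ∈ Finset.range n, polyTerm 0 m x =
      ((d x + eulerMascheroniConstant - (d (x + n) - d (1 + n)) : ℝ) : ℂ) := by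
    intro n
    rw [hd, deriv_log_Gamma_add_nat hx0, deriv_log_Gamma_add_nat one_pos, ← hd, hd1]
    simp only [polyTerm, Finset.sum_sub_distrib]
    push_cast
    ring
  have h1 : HasSum (fun m => polyTerm 0 m x) ((d x + eulerMascheroniConstant : ℝ) : ℂ) := by
    rw [(summable_polyTerm 0 (by simpa using hx0)).hasSum_iff_tendsto_nat]
    simp only [hpart]
    refine (Complex.continuous_ofReal.tendsto _).comp ?_
    simpa using hlim.const_sub (d x + eulerMascheroniConstant)
  rw [h1.tsum_eq, digamma_ofReal hx0]
  push_cast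
  rfl

/-- The series of the digamma function. It holds on an interval of the real axis because `log Γ` is
convex, and extends to the right half plane by the identity theorem. -/
lemma hasSum_digamma {z : ℂ} (hz : 0 < z.re) :
    HasSum (fun m => polyTerm 0 m z) (Complex.digamma z + eulerMascheroniConstant) := by
  set U : Set ℂ := {w | 0 < w.re} with hU
  have hUo : IsOpen U := isOpen_lt continuous_const Complex.continuous_re
  have hneC : ∀ w ∈ U, ∀ m : ℕ, w ≠ -m := fun w hw m h => by
    have h1 : 0 < w.re := hw
    rw [h] at h1
    simp only [Complex.neg_re, Complex.natCast_re] at h1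
    have : (0 : ℝ) ≤ m := Nat.cast_nonneg m
    linarith
  have hf : AnalyticOnNhd ℂ (fun w => ∑' m, polyTerm 0 m w) U := by
    refine DifferentiableOn.analyticOnNhd (fun w hw => ?_) hUo
    obtain ⟨κ, B, hκ, hκ1, hmem⟩ := exists_mem_halfPlanePart hw
    obtain ⟨C, hC⟩ := exists_polyTerm_bound hκ hκ1 B 0
    have h1 := Complex.differentiableOn_tsum_of_summable_norm (summable_one_div_succ_sq.mul_left C)
      (fun m w hw => ((hasDerivAt_polyTerm 0 m
        (re_pos_of_mem_halfPlanePart hκ hw)).differentiableAt).differentiableWithinAt)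
      (isOpen_halfPlanePart κ B) hC
    exact (h1.differentiableAt ((isOpen_halfPlanePart κ B).mem_nhds hmem)).differentiableWithinAt
  have hGd : DifferentiableOn ℂ Complex.Gamma U := fun w hw =>
    (Complex.differentiableAt_Gamma w (hneC w hw)).differentiableWithinAt
  have hg : AnalyticOnNhd ℂ (fun w => Complex.digamma w + eulerMascheroniConstant) U := by
    refine DifferentiableOn.analyticOnNhd ?_ hUo
    refine DifferentiableOn.add_const _ ?_
    rw [Complex.digamma_def]
    refine DifferentiableOn.div (hGd.deriv hUo) hGd fun w hw => ?_
    exact Complex.Gamma_ne_zero (hneC w hw)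
  have hfr : ∃ᶠ w in 𝓝[≠] (3 / 2 : ℂ), (fun w => ∑' m, polyTerm 0 m w) w =
      (fun w => Complex.digamma w + eulerMascheroniConstant) w := by
    have h1 : ∃ᶠ x in 𝓝[≠] (3 / 2 : ℝ), x ∈ Ioo (1 : ℝ) 2 :=
      (eventually_nhdsWithin_of_eventually_nhds
        (Ioo_mem_nhds (by norm_num) (by norm_num))).frequently
    have h2 : Tendsto (fun x : ℝ => (x : ℂ)) (𝓝[≠] (3 / 2 : ℝ)) (𝓝[≠] (3 / 2 : ℂ)) := by
      refine tendsto_nhdsWithin_iff.2 ⟨?_, ?_⟩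
      · have := (Complex.continuous_ofReal.tendsto (3 / 2 : ℝ)).mono_left
          (nhdsWithin_le_nhds (s := {3 / 2}ᶜ))
        simpa using this
      · filter_upwards [self_mem_nhdsWithin] with x hx h
        refine hx ?_
        have h3 : (x : ℂ) = ((3 / 2 : ℝ) : ℂ) := by
          push_cast; exact h
        exact_mod_cast h3
    exact h2.frequently (h1.mono fun x hx => hasSum_digamma_real hx)
  have hconv : Convex ℝ U := convex_halfSpace_re_gt 0
  have := hf.eqOn_of_preconnected_of_frequently_eq hg hconv.isPreconnected
    (by rw [hU]; change (0 : ℝ) < (3 / 2 : ℂ).re; norm_num) hfr hz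
  have h2 := (summable_polyTerm 0 hz).hasSum
  simp only at this
  rwa [this] at h2

lemma hasSum_iteratedDeriv_digamma (k : ℕ) {z : ℂ} (hz : 0 < z.re) :
    HasSum (fun m => polyTerm (k + 1) m z) (iteratedDeriv (k + 1) Complex.digamma z) := by
  induction k generalizing z with
  | zero =>
    have := hasSum_polyTerm_deriv (fun w hw => hasSum_digamma hw) hz
    rw [deriv_add_const] at this
    rwa [zero_add, iteratedDeriv_one]
  | succ k ih =>
    rw [iteratedDeriv_succ]
    exact hasSum_polyTerm_deriv (fun w hw => ih hw) hz

lemma hasSum_psi_zero {x : ℝ} (hx : 0 < x) :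
    HasSum (fun m : ℕ => 1 / ((m : ℝ) + 1) - 1 / (m + x)) (psi 0 x + eulerMascheroniConstant) := by
  have h := Complex.hasSum_re (hasSum_digamma (z := x) (by simpa using hx))
  rw [psi, iteratedDeriv_zero]
  simp only [Complex.add_re, Complex.ofReal_re] at h
  convert h using 1
  funext m
  have : polyTerm 0 m x = ((1 / ((m : ℝ) + 1) - 1 / (m + x) : ℝ) : ℂ) := by
    simp only [polyTerm]; push_cast; rfl
  rw [this, Complex.ofReal_re]

lemma hasSum_psi_succ (k : ℕ) {x : ℝ} (hx : 0 < x) :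
    HasSum (fun m : ℕ => 1 / ((m : ℝ) + x) ^ (k + 2))
      ((-1) ^ k * psi (k + 1) x / ((k + 1).factorial : ℝ)) := by
  have h := Complex.hasSum_re (hasSum_iteratedDeriv_digamma k (z := x) (by simpa using hx))
  rw [psi]
  have h2 := h.mul_left ((-1) ^ k / ((k + 1).factorial : ℝ))
  have e1 : (-1) ^ k / ((k + 1).factorial : ℝ) * (iteratedDeriv (k + 1) Complex.digamma x).re =
      (-1) ^ k * (iteratedDeriv (k + 1) Complex.digamma x).re / ((k + 1).factorial : ℝ) := by ring
  rw [e1] at h2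
  have e2 : (fun m : ℕ => 1 / ((m : ℝ) + x) ^ (k + 2)) =
      fun m => (-1) ^ k / ((k + 1).factorial : ℝ) * (polyTerm (k + 1) m x).re := by
    funext m
    have : polyTerm (k + 1) m x =
        (((-1) ^ k * ((k + 1).factorial : ℝ) / (m + x) ^ (k + 2) : ℝ) : ℂ) := by
      simp only [polyTerm]; push_cast; rfl
    rw [this, Complex.ofReal_re]
    have hf : ((k + 1).factorial : ℝ) ≠ 0 := by positivity
    have hs : ((-1 : ℝ) ^ k) * (-1) ^ k = 1 := by rw [← mul_pow]; simp
    calc 1 / ((m : ℝ) + x) ^ (k + 2) = ((-1 : ℝ) ^ k * (-1) ^ k) * (1 / ((m : ℝ) + x) ^ (k + 2)) := by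
          rw [hs, one_mul]
      _ = _ := by field_simp
  rw [e2]
  exact h2

lemma hasSum_riemannZeta (k : ℕ) :
    HasSum (fun m : ℕ => 1 / ((m : ℝ) + 1) ^ (k + 2)) (riemannZeta (((k + 1 : ℕ) : ℂ) + 1)).re := by
  have hs : Summable fun m : ℕ => 1 / ((m : ℝ) + 1) ^ (k + 2) := by
    have := (summable_nat_add_iff 1).2
      (Real.summable_one_div_nat_pow.2 (by omega : 1 < k + 2))
    simpa using this
  have h := zeta_eq_tsum_one_div_nat_add_one_cpow (s := ((k + 1 : ℕ) : ℂ) + 1) (by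
    simp; positivity)
  have e : ∀ m : ℕ, 1 / ((m : ℂ) + 1) ^ (((k + 1 : ℕ) : ℂ) + 1) =
      ((1 / ((m : ℝ) + 1) ^ (k + 2) : ℝ) : ℂ) := by
    intro m
    rw [← Nat.cast_succ (k + 1), Complex.cpow_natCast]
    push_cast
    rfl
  simp only [e] at h
  rw [h, ← Complex.ofReal_tsum, Complex.ofReal_re]
  exact hs.hasSum

/-! ### Taylor expansion of harmonic functions on the axis -/

/-- Integral against the third coordinate over the unit sphere about `x`; for a harmonic function
it is the derivative in the direction of the axis. -/
def axisDeriv (f : E3 → ℝ) (x : E3) : ℝ :=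
  3 / (4 * π) * ∫ ω : Metric.sphere (0 : E3) 1, (ω : E3) 2 * f (x + (ω : E3)) ∂sphereMeasure

/-- The function `f` has a derivative in the direction of the axis, which is given by an integral
over each sphere. Unlike harmonicity, this passes to the derivative without any regularity. -/
structure HasSphericalAxisDeriv (f : E3 → ℝ) : Prop where
  continuous : Continuous f
  hasDerivAt : ∀ x, HasDerivAt (fun t => f (x + axisPoint t)) (axisDeriv f x) 0
  eq_integral : ∀ x r, 0 < r → axisDeriv f x = 3 / (4 * π * r) *
    ∫ ω : Metric.sphere (0 : E3) 1, (ω : E3) 2 * f (x + r • (ω : E3)) ∂sphereMeasure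

lemma continuous_axisPoint : Continuous axisPoint := by
  have : axisPoint = fun t => t • EuclideanSpace.single (2 : Fin 3) (1 : ℝ) := funext axisPoint_eq
  rw [this]; fun_prop

lemma axisPoint_zero : axisPoint 0 = 0 := by rw [axisPoint_eq, zero_smul]

lemma continuous_axisDeriv {f : E3 → ℝ} (hf : Continuous f) : Continuous (axisDeriv f) := by
  have h := continuous_parametric_integral_of_continuous (μ := sphereMeasure)
    (f := fun (x : E3) (ω : Metric.sphere (0 : E3) 1) => (ω : E3) 2 * f (x + (ω : E3)))
    (by
      change Continuous fun p : E3 × Metric.sphere (0 : E3) 1 => (p.2 : E3) 2 * f (p.1 + (p.2 : E3))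
      fun_prop) isCompact_univ
  simp only [Measure.restrict_univ] at h
  exact continuous_const.mul h

lemma HasSphericalAxisDeriv.hasDerivAt_add {f : E3 → ℝ} (hf : HasSphericalAxisDeriv f) (x : E3)
    (t : ℝ) : HasDerivAt (fun t => f (x + axisPoint t)) (axisDeriv f (x + axisPoint t)) t := by
  have h := hf.hasDerivAt (x + axisPoint t)
  have h2 := HasDerivAt.comp_sub_const t t (by rwa [sub_self]) (f := fun s => f (x + axisPoint t + axisPoint s))
  refine h2.congr_of_eventuallyEq (Eventually.of_forall fun s => ?_)
  simp only
  rw [add_assoc, axisPoint_add]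
  congr 3
  ring

/-- Differentiating the integral formula along the axis shows that it is inherited by the derivative. -/
lemma HasSphericalAxisDeriv.axisDeriv {f : E3 → ℝ} (hf : HasSphericalAxisDeriv f) :
    HasSphericalAxisDeriv (axisDeriv f) := by
  have hc := continuous_axisDeriv hf.continuous
  have hca := continuous_axisPoint
  have hfc := hf.continuous
  have key : ∀ x r, 0 < r → HasDerivAt (fun t => TwoSpheres.axisDeriv f (x + axisPoint t))
      (3 / (4 * π * r) * ∫ ω : Metric.sphere (0 : E3) 1,
        (ω : E3) 2 * TwoSpheres.axisDeriv f (x + r • (ω : E3)) ∂sphereMeasure) 0 := by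
    intro x r hr
    have h := hasDerivAt_integral_sphere (t₀ := 0) (U := univ)
      (F := fun t ω => (ω : E3) 2 * f (x + r • (ω : E3) + axisPoint t))
      (F' := fun t ω => (ω : E3) 2 * TwoSpheres.axisDeriv f (x + r • (ω : E3) + axisPoint t))
      univ_mem
      (Continuous.continuousOn (by
        change Continuous fun p : ℝ × Metric.sphere (0 : E3) 1 =>
          (p.2 : E3) 2 * f (x + r • (p.2 : E3) + axisPoint p.1)
        fun_prop))
      (Continuous.continuousOn (by
        change Continuous fun p : ℝ × Metric.sphere (0 : E3) 1 =>
          (p.2 : E3) 2 * TwoSpheres.axisDeriv f (x + r • (p.2 : E3) + axisPoint p.1)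
        fun_prop))
      (fun t _ ω => (hf.hasDerivAt_add _ t).const_mul _)
    have h2 := h.const_mul (3 / (4 * π * r))
    simp only [axisPoint_zero, add_zero] at h2
    refine h2.congr_of_eventuallyEq (Eventually.of_forall fun t => ?_)
    simp only
    rw [hf.eq_integral _ r hr]
    simp only [add_right_comm]
  have h1 : ∀ x, HasDerivAt (fun t => TwoSpheres.axisDeriv f (x + axisPoint t))
      (TwoSpheres.axisDeriv (TwoSpheres.axisDeriv f) x) 0 := fun x => by
    have h := key x 1 one_pos
    simp only [mul_one, one_smul] at h
    exact h
  exact ⟨hc, h1, fun x r hr => (h1 x).unique (key x r hr)⟩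

lemma abs_axisDeriv_le {f : E3 → ℝ} (hf : HasSphericalAxisDeriv f) {x : E3} {r M : ℝ} (hr : 0 < r)
    (hM : ∀ y ∈ Metric.closedBall x r, |f y| ≤ M) : |axisDeriv f x| ≤ 3 / r * M := by
  rw [hf.eq_integral x r hr, abs_mul, abs_of_pos (by positivity)]
  have h1 : |∫ ω : Metric.sphere (0 : E3) 1, (ω : E3) 2 * f (x + r • (ω : E3)) ∂sphereMeasure| ≤
      M * (4 * π) := by
    rw [← sphereMeasure_real_univ, ← Real.norm_eq_abs]
    refine norm_integral_le_of_norm_le_const (Eventually.of_forall fun ω => ?_)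
    have h2 : |(ω : E3) 2| ≤ 1 := by
      have := PiLp.norm_apply_le (ω : E3) 2
      rwa [Real.norm_eq_abs, norm_eq_of_mem_sphere] at this
    have h3 := hM _ (mem_closedBall_add_smul hr.le le_rfl ω)
    rw [norm_mul]
    calc _ ≤ 1 * M := mul_le_mul h2 h3 (abs_nonneg _) zero_le_one
      _ = M := one_mul M
  calc 3 / (4 * π * r) * _ ≤ 3 / (4 * π * r) * (M * (4 * π)) := by gcongr
    _ = _ := by field_simp

lemma HasSphericalAxisDeriv.iterate {f : E3 → ℝ} (hf : HasSphericalAxisDeriv f) (k : ℕ) :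
    HasSphericalAxisDeriv (TwoSpheres.axisDeriv^[k] f) := by
  induction k with
  | zero => exact hf
  | succ k ih => rw [Function.iterate_succ_apply']; exact ih.axisDeriv

/-- Cauchy type estimates: each of the `k` derivatives is taken over a sphere of radius `r`. -/
lemma abs_axisDeriv_iterate_le (k : ℕ) {f : E3 → ℝ} (hf : HasSphericalAxisDeriv f) {x : E3}
    {r M : ℝ} (hr : 0 < r) (hM : ∀ y ∈ Metric.closedBall x (k * r), |f y| ≤ M) :
    |axisDeriv^[k] f x| ≤ (3 / r) ^ k * M := by
  induction k generalizing f M with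
  | zero => simpa using hM x (by simp)
  | succ k ih =>
    rw [Function.iterate_succ_apply]
    refine (ih hf.axisDeriv (M := 3 / r * M) fun y hy => ?_).trans (le_of_eq (by ring))
    refine abs_axisDeriv_le hf hr fun z hz => hM z ?_
    rw [Metric.mem_closedBall] at hy hz ⊢
    have := dist_triangle z y x
    push_cast
    linarith

/-- Summing the rotations towards the third axis of the functions `v · xᵢ` relates the derivative
along this axis to the radial derivative. -/
lemma sum_rotGen_coord {v : E3 → ℝ} {r : ℝ} {ω : E3} (hω : ‖ω‖ = 1)
    (hv : DifferentiableAt ℝ v (r • ω)) :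
    ∑ i : Fin 3, fderiv ℝ (fun x : E3 => v x * x i) (r • ω) (rotGen i 2 ω) =
      r * fderiv ℝ v (r • ω) (EuclideanSpace.single 2 1) -
        (r * (ω 2 * fderiv ℝ v (r • ω) ω) + 2 * (ω 2 * v (r • ω))) := by
  have hfd : ∀ (i : Fin 3) (y : E3), fderiv ℝ (fun x : E3 => v x * x i) (r • ω) y =
      v (r • ω) * y i + r * ω i * fderiv ℝ v (r • ω) y := by
    intro i y
    have h1 : HasFDerivAt (fun x : E3 => x i) (EuclideanSpace.proj i : E3 →L[ℝ] ℝ) (r • ω) :=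
      (EuclideanSpace.proj i : E3 →L[ℝ] ℝ).hasFDerivAt
    have h2 : HasFDerivAt (fun x : E3 => v x * x i) _ (r • ω) := hv.hasFDerivAt.mul h1
    rw [h2.fderiv]
    simp
  have hn := norm_sq_coords ω
  rw [hω] at hn
  have hexp := congrArg (fderiv ℝ v (r • ω)) (eq_sum_coords ω)
  simp only [map_add, map_smul, smul_eq_mul] at hexp
  rw [hexp, Fin.sum_univ_three]
  simp only [hfd, rotGen_apply, map_sub, map_smul, smul_eq_mul]
  simp
  set D0 := fderiv ℝ v (r • ω) (EuclideanSpace.single 0 1)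
  set D1 := fderiv ℝ v (r • ω) (EuclideanSpace.single 1 1)
  set D2 := fderiv ℝ v (r • ω) (EuclideanSpace.single 2 1)
  linear_combination (-r * D2) * hn

/-- For harmonic `H` and `q(t) = ∫ ω₂ H(x + t ω)`, invariance under rotations and the mean value
property give `(t² q)' = 4π t² ∂₂H(x)`, which integrates to the formula for `∂₂H(x)`, with the
coordinates numbered from `0`. -/
lemma hasSphericalAxisDeriv_of_harmonic {H : E3 → ℝ} (hH : HarmonicOnNhd H univ) :
    HasSphericalAxisDeriv H := by
  have hC2 : ContDiff ℝ 2 H := contDiff_iff_contDiffAt.2 fun x => (hH x (mem_univ x)).1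
  have hC := hC2.continuous
  have hdiff : Differentiable ℝ H := hC2.differentiable (by norm_num)
  have hfc : Continuous (fderiv ℝ H) := hC2.continuous_fderiv (by norm_num)
  have hca := continuous_axisPoint
  set e : E3 := EuclideanSpace.single 2 1 with he
  have hline : ∀ x t, HasDerivAt (fun t => H (x + axisPoint t)) (fderiv ℝ H (x + axisPoint t) e) t := by
    intro x t
    have := hasDerivAt_radial (v := H) (t := t) (c := x) (x := e) (hdiff _)
    simpa only [axisPoint_eq] using this
  have hmean : ∀ (x : E3) (r : ℝ), 0 < r → ∫ ω : Metric.sphere (0 : E3) 1, fderiv ℝ H (x + r • (ω : E3)) e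
      ∂sphereMeasure = 4 * π * fderiv ℝ H x e := by
    intro x r hr
    have h := hasDerivAt_integral_sphere (t₀ := 0) (U := univ)
      (F := fun t ω => H (x + r • (ω : E3) + axisPoint t))
      (F' := fun t ω => fderiv ℝ H (x + r • (ω : E3) + axisPoint t) e)
      univ_mem
      (Continuous.continuousOn (by
        change Continuous fun p : ℝ × Metric.sphere (0 : E3) 1 =>
          H (x + r • (p.2 : E3) + axisPoint p.1)
        fun_prop))
      (Continuous.continuousOn (by
        change Continuous fun p : ℝ × Metric.sphere (0 : E3) 1 =>
          fderiv ℝ H (x + r • (p.2 : E3) + axisPoint p.1) e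
        fun_prop))
      (fun t _ ω => hline _ t)
    have h2 := (hline x 0).const_mul (4 * π)
    simp only [axisPoint_zero, add_zero] at h h2
    refine h.unique (h2.congr_of_eventuallyEq (Eventually.of_forall fun t => ?_))
    simp only
    rw [← integral_sphere_eq hr (hH.mono (subset_univ _))]
    simp only [add_right_comm]
  have hformula : ∀ x r, 0 < r → fderiv ℝ H x e = 3 / (4 * π * r) *
      ∫ ω : Metric.sphere (0 : E3) 1, (ω : E3) 2 * H (x + r • (ω : E3)) ∂sphereMeasure := by
    intro x r hr
    set D := fderiv ℝ H x e with hD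
    set q : ℝ → ℝ := fun t => ∫ ω : Metric.sphere (0 : E3) 1, (ω : E3) 2 * H (x + t • (ω : E3))
      ∂sphereMeasure with hq
    set q' : ℝ → ℝ := fun t => ∫ ω : Metric.sphere (0 : E3) 1,
      (ω : E3) 2 * fderiv ℝ H (x + t • (ω : E3)) ω ∂sphereMeasure with hq'
    have hqd : ∀ t, HasDerivAt q (q' t) t := by
      intro t
      refine hasDerivAt_integral_sphere (U := univ)
        (F := fun t ω => (ω : E3) 2 * H (x + t • (ω : E3)))
        (F' := fun t ω => (ω : E3) 2 * fderiv ℝ H (x + t • (ω : E3)) ω) univ_mem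
        (Continuous.continuousOn (by
          change Continuous fun p : ℝ × Metric.sphere (0 : E3) 1 =>
            (p.2 : E3) 2 * H (x + p.1 • (p.2 : E3))
          fun_prop))
        (Continuous.continuousOn (by
          change Continuous fun p : ℝ × Metric.sphere (0 : E3) 1 =>
            (p.2 : E3) 2 * fderiv ℝ H (x + p.1 • (p.2 : E3)) (p.2 : E3)
          fun_prop))
        (fun t _ ω => (hasDerivAt_radial (hdiff _)).const_mul _)
    have hode : ∀ t, 0 < t → t * q' t + 2 * q t = t * (4 * π * D) := by
      intro t ht
      set v : E3 → ℝ := fun y => H (x + y) with hv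
      have hvd : ContDiff ℝ 2 v := hC2.comp (contDiff_const.add contDiff_id)
      have hvf : ∀ y, fderiv ℝ v y = fderiv ℝ H (x + y) := fun y => by
        rw [hv]; exact fderiv_comp_add_left x
      have hG : ∀ i : Fin 3, ContDiff ℝ 1 (fun y : E3 => v y * y i) := fun i =>
        (hvd.of_le (by norm_num)).mul (EuclideanSpace.proj i : E3 →L[ℝ] ℝ).contDiff
      have h0 : ∀ i : Fin 3, ∫ ω : Metric.sphere (0 : E3) 1,
          fderiv ℝ (fun y : E3 => v y * y i) (t • (ω : E3)) (rotGen i 2 ω) ∂sphereMeasure = 0 :=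
        fun i => integral_fderiv_skew (rotGen i 2) (star_rotGen _ _) ht.ne'
          fun ω => (hG i).contDiffAt
      have hcont : ∀ i : Fin 3, Continuous fun ω : Metric.sphere (0 : E3) 1 =>
          fderiv ℝ (fun y : E3 => v y * y i) (t • (ω : E3)) (rotGen i 2 ω) := by
        intro i
        have h1 := (hG i).continuous_fderiv (by norm_num)
        fun_prop
      have hsum := integral_finsetSum (μ := sphereMeasure) Finset.univ
        (fun (i : Fin 3) _ => integrable_sphere (hcont i))
      simp only [h0, Finset.sum_const_zero] at hsum
      have heq : ∀ ω : Metric.sphere (0 : E3) 1, ∑ i : Fin 3,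
          fderiv ℝ (fun y : E3 => v y * y i) (t • (ω : E3)) (rotGen i 2 ω) =
          t * fderiv ℝ H (x + t • (ω : E3)) e -
            t * ((ω : E3) 2 * fderiv ℝ H (x + t • (ω : E3)) ω) -
            2 * ((ω : E3) 2 * H (x + t • (ω : E3))) := fun ω => by
        rw [sum_rotGen_coord (norm_eq_of_mem_sphere ω)
          (hvd.differentiable (by norm_num) (t • (ω : E3))), hvf]
        ring
      rw [integral_congr_ae (Eventually.of_forall heq)] at hsum
      have i1 : Integrable (fun ω : Metric.sphere (0 : E3) 1 =>
          t * fderiv ℝ H (x + t • (ω : E3)) e) sphereMeasure := integrable_sphere (by fun_prop)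
      have i2 : Integrable (fun ω : Metric.sphere (0 : E3) 1 =>
          t * ((ω : E3) 2 * fderiv ℝ H (x + t • (ω : E3)) ω)) sphereMeasure :=
        integrable_sphere (by fun_prop)
      have i3 : Integrable (fun ω : Metric.sphere (0 : E3) 1 =>
          2 * ((ω : E3) 2 * H (x + t • (ω : E3)))) sphereMeasure :=
        integrable_sphere (by fun_prop)
      have i12 : Integrable (fun ω : Metric.sphere (0 : E3) 1 =>
          t * fderiv ℝ H (x + t • (ω : E3)) e -
            t * ((ω : E3) 2 * fderiv ℝ H (x + t • (ω : E3)) ω)) sphereMeasure := i1.sub i2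
      rw [integral_sub i12 i3, integral_sub i1 i2, integral_const_mul, integral_const_mul,
        integral_const_mul, hmean x t ht] at hsum
      change t * (4 * π * D) - t * q' t - 2 * q t = 0 at hsum
      linarith
    have hder : ∀ t ∈ Ioo 0 r, HasDerivAt (fun t => t ^ 2 * q t - 4 * π * D / 3 * t ^ 3) 0 t := by
      intro t ht
      have h1 := ((hasDerivAt_pow 2 t).mul (hqd t)).sub
        ((hasDerivAt_pow 3 t).const_mul (4 * π * D / 3))
      refine h1.congr_deriv ?_
      have := hode t ht.1
      push_cast
      norm_num
      linear_combination t * this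
    have hcq : Continuous q := continuous_iff_continuousAt.2 fun t => (hqd t).continuousAt
    obtain ⟨c, hc, h⟩ := exists_hasDerivAt_eq_slope
      (fun t => t ^ 2 * q t - 4 * π * D / 3 * t ^ 3) (fun _ => 0) hr
      (by fun_prop) hder
    rw [eq_comm, div_eq_zero_iff] at h
    have hr0 : r - 0 ≠ 0 := by rw [sub_zero]; exact hr.ne'
    have h2 := h.resolve_right hr0
    have h3 : r ^ 2 * (q r - 4 * π * D / 3 * r) = 0 := by
      linear_combination h2
    have h4 := (mul_eq_zero.1 h3).resolve_left (by positivity)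
    change D = 3 / (4 * π * r) * q r
    have h5 : q r = 4 * π * D / 3 * r := by linarith
    rw [h5]
    field_simp
  have hax : ∀ x, axisDeriv H x = fderiv ℝ H x e := fun x => by
    rw [hformula x 1 one_pos, axisDeriv, mul_one]
    simp only [one_smul]
  refine ⟨hC, fun x => ?_, fun x r hr => ?_⟩
  · have := hline x 0
    rwa [axisPoint_zero, add_zero, ← hax] at this
  · rw [hax, hformula x r hr]

lemma iteratedDeriv_eq_of_hasDerivAt {g : ℕ → ℝ → ℝ} (hg : ∀ k t, HasDerivAt (g k) (g (k + 1) t) t)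
    (k : ℕ) : iteratedDeriv k (g 0) = g k := by
  induction k with
  | zero => exact iteratedDeriv_zero
  | succ k ih => rw [iteratedDeriv_succ, ih]; exact funext fun t => (hg k t).deriv

/-- The Taylor series converges if its Lagrange remainders decay geometrically. -/
lemma hasSum_taylor_of_bound {g : ℕ → ℝ → ℝ} (hg : ∀ k t, HasDerivAt (g k) (g (k + 1) t) t)
    {x A q : ℝ} (hq0 : 0 ≤ q) (hq1 : q < 1)
    (hb : ∀ k, ∀ y ∈ uIcc 0 x, |g k y| * |x| ^ k ≤ (k.factorial : ℝ) * (A * q ^ k)) :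
    HasSum (fun k => g k 0 / (k.factorial : ℝ) * x ^ k) (g 0 x) := by
  have hb' : ∀ k, ∀ y ∈ uIcc 0 x, |g k y / (k.factorial : ℝ) * x ^ k| ≤ A * q ^ k := by
    intro k y hy
    have hk : (0 : ℝ) < k.factorial := by positivity
    rw [abs_mul, abs_div, abs_of_pos hk, abs_pow, div_mul_eq_mul_div, div_le_iff₀ hk, mul_comm (A * _)]
    exact hb k y hy
  have hs : Summable fun k => g k 0 / (k.factorial : ℝ) * x ^ k :=
    Summable.of_norm_bounded ((summable_geometric_of_lt_one hq0 hq1).mul_left A)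
      fun k => hb' k 0 left_mem_uIcc
  have hsm : ContDiff ℝ ((⊤ : ℕ∞) : WithTop ℕ∞) (g 0) := by
    refine contDiff_of_differentiable_iteratedDeriv fun m _ => ?_
    rw [iteratedDeriv_eq_of_hasDerivAt hg]
    exact fun t => (hg m t).differentiableAt
  rw [hs.hasSum_iff_tendsto_nat, ← tendsto_add_atTop_iff_nat 1]
  rcases eq_or_ne 0 x with hx | hx
  · subst hx
    refine tendsto_const_nhds.congr fun n => ?_
    rw [Finset.sum_range_succ']
    simp
  have hu : UniqueDiffOn ℝ (uIcc 0 x) := uniqueDiffOn_uIcc hx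
  have hz : Tendsto (fun n : ℕ => A * q ^ (n + 1)) atTop (𝓝 0) := by
    have := ((tendsto_pow_atTop_nhds_zero_of_lt_one hq0 hq1).comp (tendsto_add_atTop_nat 1)).const_mul A
    simpa using! this
  rw [tendsto_iff_norm_sub_tendsto_zero]
  refine squeeze_zero (fun n => norm_nonneg _) (fun n => ?_) hz
  obtain ⟨y, hy, h⟩ := taylor_mean_remainder_lagrange_iteratedDeriv (n := n) hx
    (f := g 0) (hsm.of_le (by exact_mod_cast le_top)).contDiffOn
  rw [iteratedDeriv_eq_of_hasDerivAt hg, sub_zero] at h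
  have ht : taylorWithinEval (g 0) n (uIcc 0 x) 0 x =
      ∑ k ∈ Finset.range (n + 1), g k 0 / (k.factorial : ℝ) * x ^ k := by
    rw [taylor_within_apply]
    refine Finset.sum_congr rfl fun k _ => ?_
    rw [iteratedDerivWithin_eq_iteratedDeriv hu
      ((hsm.of_le (by exact_mod_cast le_top)).contDiffAt) left_mem_uIcc,
      iteratedDeriv_eq_of_hasDerivAt hg, sub_zero, smul_eq_mul]
    ring
  rw [← ht, norm_sub_rev, h, Real.norm_eq_abs, mul_div_right_comm]
  exact hb' (n + 1) y (Ioo_subset_Icc_self hy)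

/-- An entire harmonic function is given on the axis by its Taylor series. -/
theorem hasSum_taylor_axis {H : E3 → ℝ} (hH : HarmonicOnNhd H univ) (t : ℝ) :
    HasSum (fun k => iteratedDeriv k (fun s => H (axisPoint s)) 0 / (k.factorial : ℝ) * t ^ k)
      (H (axisPoint t)) := by
  have hs := hasSphericalAxisDeriv_of_harmonic hH
  set g : ℕ → ℝ → ℝ := fun k s => axisDeriv^[k] H (axisPoint s) with hg
  have hgd : ∀ k s, HasDerivAt (g k) (g (k + 1) s) s := by
    intro k s
    have := (hs.iterate k).hasDerivAt_add 0 s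
    simp only [zero_add] at this
    simp only [hg, Function.iterate_succ_apply']
    exact this
  -- spheres of radius `R / k` are used for the `k`-th derivative, and `k ^ k ≤ k! * e ^ k`;
  -- the choice of `R` makes the resulting geometric ratio `3 * e * |t| / R` at most `1 / 2`
  set R := 6 * exp 1 * (|t| + 1) with hR
  have hR0 : 0 < R := by positivity
  obtain ⟨M, hM⟩ := (isCompact_closedBall (0 : E3) (R + |t|)).exists_bound_of_continuousOn
    hs.continuous.continuousOn
  have hM0 : 0 ≤ M := (norm_nonneg _).trans (hM 0 (by simp; positivity))
  have hq : 3 * exp 1 * |t| / R ≤ 1 / 2 := by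
    rw [div_le_iff₀ hR0, hR]
    nlinarith [exp_pos 1, abs_nonneg t]
  have key := hasSum_taylor_of_bound hgd (x := t) (A := M) (q := 3 * exp 1 * |t| / R)
    (by positivity) (by linarith) fun k y hy => ?_
  · have := iteratedDeriv_eq_of_hasDerivAt hgd
    change HasSum (fun k => iteratedDeriv k (g 0) 0 / (k.factorial : ℝ) * t ^ k) (g 0 t)
    simpa only [this] using key
  have hy' : |y| ≤ |t| := by simpa using abs_sub_left_of_mem_uIcc hy
  have hM' : ∀ z ∈ Metric.closedBall (axisPoint y) R, |H z| ≤ M := by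
    intro z hz
    refine hM z ?_
    rw [Metric.mem_closedBall] at hz ⊢
    have h1 := dist_triangle z (axisPoint y) 0
    rw [dist_zero_right (axisPoint y), norm_axisPoint] at h1
    linarith
  rcases Nat.eq_zero_or_pos k with hk | hk
  · subst hk
    simpa [hg] using hM' (axisPoint y) (by simp [hR0.le])
  have hkR : (0 : ℝ) < k := by exact_mod_cast hk
  have h1 := abs_axisDeriv_iterate_le k hs (x := axisPoint y) (r := R / k) (M := M) (by positivity)
    (by rwa [mul_div_cancel₀ _ hkR.ne'])
  have h2 : (k : ℝ) ^ k ≤ k.factorial * exp 1 ^ k := by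
    have := Real.pow_div_factorial_le_exp (k : ℝ) hkR.le k
    rw [div_le_iff₀ (by positivity)] at this
    rw [← Real.exp_nat_mul, mul_one, mul_comm]
    exact this
  calc |g k y| * |t| ^ k ≤ ((3 / (R / k)) ^ k * M) * |t| ^ k := by gcongr
    _ = (k : ℝ) ^ k * (M * (3 * |t| / R) ^ k) := by
        rw [← div_mul, mul_pow, mul_div_right_comm, mul_pow]; ring
    _ ≤ (k.factorial * exp 1 ^ k) * (M * (3 * |t| / R) ^ k) := by gcongr
    _ = _ := by
        rw [show 3 * exp 1 * |t| / R = exp 1 * (3 * |t| / R) by ring, mul_pow]; ring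

/-! ### Resummation, and the foci of the two spheres -/

/-- Resummation of `∑ flatTerm` when the potential on the axis is given by a power series: the two
orders of summation are exchanged, and the inner sums are values of `ζ` and of `ψ`. -/
lemma hasSum_flatTerm_taylor {G : ℝ → ℝ} {b : ℕ → ℝ} {g₀ R e : ℝ}
    (hG : ∀ t, HasSum (fun k => b k * t ^ (k + 1)) (G t - g₀)) (hR : 0 < R) (he : e ∈ Ioc 0 1) :
    HasSum (fun k => b k * (R ^ (k + 2) * ((riemannZeta (((k + 1 : ℕ) : ℂ) + 1)).re +
      psi (k + 1) e / ((k + 1).factorial : ℝ))))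
      (∑' m, flatTerm R e G (fun t => G (-t)) m - g₀ * (R * (psi 0 e + eulerMascheroniConstant))) := by
  -- the term of degree `k + 1` in the `m`-th pair, without the contribution of `g₀`
  set A : ℕ → ℕ → ℝ := fun k m =>
    b k * (R ^ (k + 2) * (1 / ((m : ℝ) + 1) ^ (k + 2) + (-1) ^ k * (1 / ((m : ℝ) + e) ^ (k + 2))))
    with hA
  have he0 : 0 < e := he.1
  have hRe : 0 < R / e := by positivity
  have hbs : Summable fun k => 2 * (|b k| * (R / e) ^ (k + 2)) := by
    have h1 := (hG (R / e)).summable.abs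
    refine ((h1.mul_left (R / e)).mul_left 2).congr fun k => ?_
    rw [abs_mul, abs_pow, abs_of_pos hRe]
    ring
  have hbound : ∀ k m, |A k m| ≤ 2 * (|b k| * (R / e) ^ (k + 2)) * (1 / ((m : ℝ) + 1) ^ 2) := by
    intro k m
    have hm : (1 : ℝ) ≤ (m : ℝ) + 1 := by linarith [(Nat.cast_nonneg m : (0 : ℝ) ≤ m)]
    have hlow : e * ((m : ℝ) + 1) ≤ m + e := by
      have : (m : ℝ) * e ≤ m * 1 := by gcongr; exact he.2
      linarith
    have hme : 0 < (m : ℝ) + e := by positivity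
    have h1 : ((m : ℝ) + 1) ^ 2 ≤ (m + 1) ^ (k + 2) := pow_le_pow_right₀ hm (by omega)
    have h2 : 1 / ((m : ℝ) + 1) ^ (k + 2) ≤ 1 / e ^ (k + 2) * (1 / ((m : ℝ) + 1) ^ 2) := by
      rw [div_mul_div_comm, one_mul]
      refine one_div_le_one_div_of_le (by positivity) ?_
      calc e ^ (k + 2) * ((m : ℝ) + 1) ^ 2 ≤ 1 * (m + 1) ^ (k + 2) := by
            gcongr
            exact pow_le_one₀ he0.le he.2
        _ = _ := one_mul _
    have h3 : 1 / ((m : ℝ) + e) ^ (k + 2) ≤ 1 / e ^ (k + 2) * (1 / ((m : ℝ) + 1) ^ 2) := by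
      rw [div_mul_div_comm, one_mul]
      refine one_div_le_one_div_of_le (by positivity) ?_
      calc e ^ (k + 2) * ((m : ℝ) + 1) ^ 2 ≤ e ^ (k + 2) * (m + 1) ^ (k + 2) := by gcongr
        _ = (e * (m + 1)) ^ (k + 2) := (mul_pow _ _ _).symm
        _ ≤ _ := by gcongr
    have h4 : |1 / ((m : ℝ) + 1) ^ (k + 2) + (-1) ^ k * (1 / ((m : ℝ) + e) ^ (k + 2))| ≤
        2 * (1 / e ^ (k + 2) * (1 / ((m : ℝ) + 1) ^ 2)) := by
      refine (abs_add_le _ _).trans ?_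
      rw [abs_mul, abs_pow, abs_neg, abs_one, one_pow, one_mul, abs_of_pos (by positivity),
        abs_of_pos (by positivity)]
      linarith
    rw [hA]
    simp only
    rw [abs_mul, abs_mul, abs_of_pos (by positivity : 0 < R ^ (k + 2))]
    calc |b k| * (R ^ (k + 2) * _) ≤
        |b k| * (R ^ (k + 2) * (2 * (1 / e ^ (k + 2) * (1 / ((m : ℝ) + 1) ^ 2)))) := by gcongr
      _ = _ := by rw [div_pow]; ring
  have hsum : Summable (Function.uncurry A) := by
    refine Summable.of_norm_bounded (hbs.mul_of_nonneg summable_one_div_succ_sq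
      (fun k => by positivity) (fun m => by positivity)) fun p => ?_
    exact hbound p.1 p.2
  -- summation over `m` gives `ζ(k + 2)` and `ψ_{k + 1}(e)`
  have hrow : ∀ k, HasSum (fun m => A k m) (b k * (R ^ (k + 2) *
      ((riemannZeta (((k + 1 : ℕ) : ℂ) + 1)).re + psi (k + 1) e / ((k + 1).factorial : ℝ)))) := by
    intro k
    have h := ((hasSum_riemannZeta k).add ((hasSum_psi_succ k he0).mul_left ((-1) ^ k)))
    have h2 := (h.mul_left (R ^ (k + 2))).mul_left (b k)
    have hs : ((-1 : ℝ) ^ k) * (-1) ^ k = 1 := by rw [← mul_pow]; simp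
    have h3 : (-1 : ℝ) ^ k * ((-1) ^ k * psi (k + 1) e / ((k + 1).factorial : ℝ)) =
        psi (k + 1) e / ((k + 1).factorial : ℝ) := by
      rw [← mul_div_assoc, ← mul_assoc, hs, one_mul]
    rwa [h3] at h2
  -- summation over `k` gives back the `m`-th pair
  have hcol : ∀ m, HasSum (fun k => A k m) (flatTerm R e G (fun t => G (-t)) m -
      g₀ * (R * (1 / ((m : ℝ) + 1) - 1 / (m + e)))) := by
    intro m
    have h1 := (hG (R / ((m : ℝ) + 1))).mul_left (R / ((m : ℝ) + 1))
    have h2 := (hG (-(R / ((m : ℝ) + e)))).mul_left (R / ((m : ℝ) + e))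
    have h3 := h1.sub h2
    have hme : (m : ℝ) + e ≠ 0 := by positivity
    have e1 : flatTerm R e G (fun t => G (-t)) m - g₀ * (R * (1 / ((m : ℝ) + 1) - 1 / (m + e))) =
        R / ((m : ℝ) + 1) * (G (R / ((m : ℝ) + 1)) - g₀) -
        R / ((m : ℝ) + e) * (G (-(R / ((m : ℝ) + e))) - g₀) := by
      rw [flatTerm]; ring
    have e2 : (fun k => A k m) = fun k =>
        R / ((m : ℝ) + 1) * (b k * (R / ((m : ℝ) + 1)) ^ (k + 1)) -
        R / ((m : ℝ) + e) * (b k * (-(R / ((m : ℝ) + e))) ^ (k + 1)) := by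
      funext k
      simp only [hA, div_eq_mul_inv, one_mul, ← inv_pow]
      generalize ((m : ℝ) + 1)⁻¹ = u
      generalize ((m : ℝ) + e)⁻¹ = w
      ring
    rw [e1, e2]
    exact h3
  have htot := hsum.hasSum
  have hk := htot.prod_fiberwise hrow
  have hm := ((Equiv.prodComm ℕ ℕ).hasSum_iff.2 htot).prod_fiberwise hcol
  have hpsi := ((hasSum_psi_zero he0).mul_left R).mul_left g₀
  have hflat := hm.add hpsi
  simp only [sub_add_cancel] at hflat
  rw [hflat.tsum_eq, add_sub_cancel_right]
  exact hk

/-- The two spheres in bispherical coordinates: with `sinh ξⱼ = a / rⱼ` their centers are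
`∓ a coth ξⱼ`, and `a² ~ 2 r̃ ε`. -/
lemma exists_foci {r₁ r₂ : ℝ} (h₁ : 0 < r₁) (h₂ : 0 < r₂) :
    ∃ K, 0 ≤ K ∧ ∀ a₀ > 0, ∀ᶠ ε in 𝓝[>] (0 : ℝ), ∃ a ∈ Ioo 0 a₀,
      c₁ r₁ r₂ ε = -(a * (cosh (arsinh (a / r₁)) / sinh (arsinh (a / r₁)))) ∧
      c₂ r₁ r₂ ε = a * (cosh (arsinh (a / r₂)) / sinh (arsinh (a / r₂))) ∧
      a ^ 2 * (1 + |log a|) ≤ K * (ε * |log ε|) := by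
  set k := 2 * r₁ * r₂ / (r₁ + r₂ + 1) with hk
  set B := (1 + 2 * r₂) / (2 * (r₁ + r₂)) with hB
  set L := B * (2 * r₁ + B) with hL
  have hk0 : 0 < k := by positivity
  have hB0 : 0 < B := by positivity
  have hL0 : 0 < L := by positivity
  refine ⟨L * (2 + |log k| + |log L|), by positivity, fun a₀ ha₀ => ?_⟩
  have hev : ∀ᶠ ε in 𝓝[>] (0 : ℝ), ε ∈ Ioo 0 (min (exp (-1)) (a₀ ^ 2 / L)) :=
    Ioo_mem_nhdsGT (by positivity)
  filter_upwards [hev] with ε hε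
  have hε0 : 0 < ε := hε.1
  have hε1 : ε < exp (-1) := hε.2.trans_le (min_le_left _ _)
  have hε2 : ε < a₀ ^ 2 / L := hε.2.trans_le (min_le_right _ _)
  have hε3 : ε < 1 := hε1.trans (Real.exp_lt_one_iff.2 (by norm_num))
  set d := r₁ + r₂ + ε with hd
  have hd0 : 0 < d := by positivity
  set p := -c₁ r₁ r₂ ε with hp
  have hpd : p = (d ^ 2 + r₁ ^ 2 - r₂ ^ 2) / (2 * d) := by
    rw [hp, c₁, ← hd, ← neg_div]; congr 1; ring
  have hqd : c₂ r₁ r₂ ε = (d ^ 2 + r₂ ^ 2 - r₁ ^ 2) / (2 * d) := by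
    rw [c₂, c₁, ← hd, add_assoc, add_assoc, ← add_assoc r₁, ← hd]; field_simp; ring
  have e1 : p - r₁ = ε * (ε + 2 * r₂) / (2 * d) := by
    rw [hpd, hd]; field_simp; ring
  have e2 : c₂ r₁ r₂ ε - r₂ = ε * (ε + 2 * r₁) / (2 * d) := by
    rw [hqd, hd]; field_simp; ring
  have e3 : p ^ 2 - r₁ ^ 2 = c₂ r₁ r₂ ε ^ 2 - r₂ ^ 2 := by
    rw [hpd, hqd]; field_simp; ring
  have hp1 : r₁ < p := by
    have : 0 < p - r₁ := by rw [e1]; positivity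
    linarith
  have hq1 : r₂ < c₂ r₁ r₂ ε := by
    have : 0 < c₂ r₁ r₂ ε - r₂ := by rw [e2]; positivity
    linarith
  set q := c₂ r₁ r₂ ε with hq
  -- `a ^ 2 = p ^ 2 - r₁ ^ 2` lies between `k * ε` and `L * ε`, hence `log a` is comparable to `log ε`
  have hlow : k * ε ≤ p ^ 2 - r₁ ^ 2 := by
    have t1 : ε * r₂ / (r₁ + r₂ + 1) ≤ p - r₁ := by
      rw [e1, div_le_div_iff₀ (by positivity) (by positivity)]
      have : ε * r₂ * (2 * d) ≤ ε * r₂ * (2 * (r₁ + r₂ + 1)) := by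
        gcongr; linarith
      have : 0 ≤ ε * ε * (r₁ + r₂ + 1) := by positivity
      nlinarith
    have t2 : 2 * r₁ ≤ p + r₁ := by linarith
    calc k * ε = ε * r₂ / (r₁ + r₂ + 1) * (2 * r₁) := by rw [hk]; ring
      _ ≤ (p - r₁) * (p + r₁) := by gcongr
      _ = _ := by ring
  have hup : p ^ 2 - r₁ ^ 2 ≤ L * ε := by
    have t1 : p - r₁ ≤ B * ε := by
      rw [e1, hB, div_mul_eq_mul_div]
      have hdd : r₁ + r₂ ≤ d := by linarith
      have : ε * (ε + 2 * r₂) ≤ (1 + 2 * r₂) * ε := by nlinarith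
      gcongr
    have t2 : p + r₁ ≤ 2 * r₁ + B := by nlinarith
    calc p ^ 2 - r₁ ^ 2 = (p - r₁) * (p + r₁) := by ring
      _ ≤ (B * ε) * (2 * r₁ + B) := mul_le_mul t1 t2 (by linarith) (by positivity)
      _ = _ := by rw [hL]; ring
  set S := p ^ 2 - r₁ ^ 2 with hS
  have hS0 : 0 < S := (by positivity : 0 < k * ε).trans_le hlow
  have hsq : √S ^ 2 = S := sq_sqrt hS0.le
  have ha0 : 0 < √S := sqrt_pos.2 hS0
  have hcoth : ∀ r x, 0 < r → 0 < x → x ^ 2 = S + r ^ 2 →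
      √S * (cosh (arsinh (√S / r)) / sinh (arsinh (√S / r))) = x := by
    intro r x hr hx h
    rw [cosh_arsinh, sinh_arsinh]
    have : 1 + (√S / r) ^ 2 = (x / r) ^ 2 := by
      rw [div_pow, hsq, div_pow, h]; field_simp; ring
    rw [this, sqrt_sq (by positivity)]
    field_simp
  refine ⟨√S, ⟨ha0, ?_⟩, ?_, ?_, ?_⟩
  · rw [sqrt_lt' ha₀]
    rw [lt_div_iff₀ hL0] at hε2
    linarith
  · rw [hcoth r₁ p h₁ (by linarith) (by rw [hS]; ring), hp, neg_neg]
  · rw [hcoth r₂ q h₂ (by linarith) (by rw [e3]; ring)]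
  · have hlogε : 1 ≤ |log ε| := by
      have := log_lt_log hε0 hε1
      rw [log_exp] at this
      rw [abs_of_neg (by linarith)]; linarith
    have hlog : |log √S| ≤ |log k| + |log L| + |log ε| := by
      rw [log_sqrt hS0.le]
      have a1 := log_le_log (by positivity) hlow
      have a2 := log_le_log hS0 hup
      rw [log_mul hk0.ne' hε0.ne'] at a1
      rw [log_mul hL0.ne' hε0.ne'] at a2
      have b1 := neg_abs_le (log k)
      have b2 := neg_abs_le (log ε)
      have b3 := le_abs_self (log L)
      have b4 := le_abs_self (log ε)
      have b5 := abs_nonneg (log k)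
      have b6 := abs_nonneg (log L)
      rw [abs_le]
      constructor <;> linarith
    rw [hsq]
    have b5 := abs_nonneg (log k)
    have b6 := abs_nonneg (log L)
    calc S * (1 + |log √S|) ≤ (L * ε) * (1 + (|log k| + |log L| + |log ε|)) := by gcongr
      _ ≤ (L * ε) * ((2 + |log k| + |log L|) * |log ε|) := by
          gcongr
          nlinarith
      _ = _ := by ring

/-! ### The linear system for the boundary values -/

/-- The charges for the constant potential `1` are summable, at any parameters that grow linearly. -/
lemma summable_charge_one {a ξ : ℝ} (ha : 0 < a) (hξ : 0 < ξ) {x : ℕ → ℝ}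
    (hx : ∀ m : ℕ, ξ * ((m : ℝ) + 1) ≤ x m) : Summable fun m => charge a (fun _ => 1) (x m) := by
  refine Summable.of_nonneg_of_le (fun m => ?_) (fun m => ?_)
    (summable_one_div_succ_sq.mul_left (4 * a / ξ ^ 2))
  · have h0 : 0 < x m := (by positivity : 0 < ξ * ((m : ℝ) + 1)).trans_le (hx m)
    have := sinh_pos_iff.2 h0
    rw [charge]; positivity
  · have h0 : 0 < x m := (by positivity : 0 < ξ * ((m : ℝ) + 1)).trans_le (hx m)
    have h1 := sinh_pos_iff.2 h0
    have h2 := sq_le_four_mul_sinh h0.le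
    have h3 : (ξ * ((m : ℝ) + 1)) ^ 2 ≤ x m ^ 2 := by gcongr; exact hx m
    rw [charge, mul_one, div_mul_div_comm, mul_one, div_le_div_iff₀ h1 (by positivity), ← mul_pow]
    nlinarith

lemma tendsto_zero_of_isBigO {w : E3 → ℝ}
    (h : w =O[Bornology.cobounded E3] (fun x => (‖x‖ ^ 2)⁻¹)) :
    Tendsto w (Bornology.cobounded E3) (𝓝 0) := by
  refine h.trans_tendsto ?_
  exact ((tendsto_pow_atTop (by norm_num : (2 : ℕ) ≠ 0)).comp
    tendsto_norm_cobounded_atTop).inv_tendsto_atTop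

/-- The boundary values of the potentials in terms of the sums over image charges: the fluxes of
`h` and of `u - H` give two linear equations each for `(β₁, β₂)` and for `(α₁, α₂)`, with the same
symmetric matrix. -/
lemma exists_charge_sums {r₁ r₂ ε a α₁ α₂ β₁ β₂ : ℝ} {H u h : E3 → ℝ} (h₁ : 0 < r₁) (h₂ : 0 < r₂)
    (hε : 0 < ε) (ha : 0 < a)
    (hc₁ : c₁ r₁ r₂ ε = -(a * (cosh (arsinh (a / r₁)) / sinh (arsinh (a / r₁)))))
    (hc₂ : c₂ r₁ r₂ ε = a * (cosh (arsinh (a / r₂)) / sinh (arsinh (a / r₂))))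
    (hH : HarmonicOnNhd H univ) (hu : IsElectricPotential r₁ r₂ ε H u α₁ α₂)
    (hh : IsSingularFunction r₁ r₂ ε h β₁ β₂) :
    let s := arsinh (a / r₁) + arsinh (a / r₂)
    let G := fun t => H (axisPoint t)
    let G' := fun t => H (axisPoint (-t))
    ∃ T₁ T₂ S₁ S₂ : ℝ,
      Tendsto (fun N => ∑ m ∈ Finset.range N,
        imageTerm a s (arsinh (a / r₁)) (fun _ => 1) (fun _ => 1) m) atTop (𝓝 T₁) ∧
      Tendsto (fun N => ∑ m ∈ Finset.range N,
        imageTerm a s (arsinh (a / r₂)) (fun _ => 1) (fun _ => 1) m) atTop (𝓝 T₂) ∧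
      Tendsto (fun N => ∑ m ∈ Finset.range N,
        imageTerm a s (arsinh (a / r₁)) G G' m) atTop (𝓝 S₁) ∧
      Tendsto (fun N => ∑ m ∈ Finset.range N,
        imageTerm a s (arsinh (a / r₂)) G' G m) atTop (𝓝 S₂) ∧
      (T₁ + T₂ ≠ 0 → β₁ ≠ β₂ ∧
        (α₁ - α₂) / (β₁ - β₂) = 4 * π * (T₂ * S₁ - T₁ * S₂) / (T₁ + T₂)) := by
  intro s G G'
  set ξ₁ := arsinh (a / r₁) with hξ₁
  set ξ₂ := arsinh (a / r₂) with hξ₂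
  have p₁ : 0 < ξ₁ := arsinh_pos_iff.2 (by positivity)
  have p₂ : 0 < ξ₂ := arsinh_pos_iff.2 (by positivity)
  have hr₁ : r₁ = a / sinh ξ₁ := by rw [hξ₁, sinh_arsinh]; field_simp
  have hr₂ : r₂ = a / sinh ξ₂ := by rw [hξ₂, sinh_arsinh]; field_simp
  have hd : r₁ + r₂ < dist (axisPoint (c₁ r₁ r₂ ε)) (axisPoint (c₂ r₁ r₂ ε)) := by
    rw [dist_axisPoint, c₂, abs_sub_comm]
    refine lt_of_lt_of_le ?_ (le_abs_self _)
    linarith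
  have hD : UniqueDiffOn ℝ (closedExterior r₁ r₂ ε) := uniqueDiffOn_outside h₁ h₂ hd
  have hsub₁ : Metric.sphere (axisPoint (c₁ r₁ r₂ ε)) r₁ ⊆ closedExterior r₁ r₂ ε := by
    intro x hx
    refine mem_outside_iff.2 ⟨(Metric.mem_sphere.1 hx).ge, ?_⟩
    have := dist_lower (p₂ := axisPoint (c₂ r₁ r₂ ε)) (Metric.mem_sphere.1 hx).le
    linarith
  have hsub₂ : Metric.sphere (axisPoint (c₂ r₁ r₂ ε)) r₂ ⊆ closedExterior r₁ r₂ ε := by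
    intro x hx
    refine mem_outside_iff.2 ⟨?_, (Metric.mem_sphere.1 hx).ge⟩
    have := dist_lower (p₂ := axisPoint (c₁ r₁ r₂ ε)) (Metric.mem_sphere.1 hx).le
    rw [dist_comm] at this
    linarith
  have hHd : ∀ x, DifferentiableAt ℝ H x := fun x =>
    (hH x (mem_univ x)).1.differentiableAt (by norm_num)
  have hHc : ContDiffOn ℝ 1 H (closedExterior r₁ r₂ ε) := fun x _ =>
    ((hH x (mem_univ x)).1.of_le (by norm_num)).contDiffWithinAt
  obtain ⟨hh, hhinf⟩ := hh
  obtain ⟨hu, huinf⟩ := hu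
  have hflH₁ : flux (closedExterior r₁ r₂ ε) (u - H) (axisPoint (c₁ r₁ r₂ ε)) r₁ = 0 := by
    rw [flux_sub hD hsub₁ h₁.le hu.contDiffOn hHc, hu.flux₁,
      flux_eq_zero hD hsub₁ h₁ (fun x _ => hHd x) (hH.mono (subset_univ _)), sub_zero]
  have hflH₂ : flux (closedExterior r₁ r₂ ε) (u - H) (axisPoint (c₂ r₁ r₂ ε)) r₂ = 0 := by
    rw [flux_sub hD hsub₂ h₂.le hu.contDiffOn hHc, hu.flux₂,
      flux_eq_zero hD hsub₂ h₂ (fun x _ => hHd x) (hH.mono (subset_univ _)), sub_zero]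
  have Hh := tendsto_flux_charges ha p₁ p₂ (congrArg axisPoint hc₁) (congrArg axisPoint hc₂) hr₁ hr₂
    hd (f₁ := fun _ => β₁) (f₂ := fun _ => β₂) (harmonicOnNhd_const β₁) (harmonicOnNhd_const β₂)
    hh.harmonic hh.contDiffOn hh.const₁ hh.const₂ (tendsto_zero_of_isBigO hhinf)
  have Hu := tendsto_flux_charges ha p₁ p₂ (congrArg axisPoint hc₁) (congrArg axisPoint hc₂) hr₁ hr₂
    hd (w := u - H) (f₁ := (fun _ => α₁) - H) (f₂ := (fun _ => α₂) - H)
    ((harmonicOnNhd_const α₁).sub hH) ((harmonicOnNhd_const α₂).sub hH)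
    (hu.harmonic.sub (hH.mono (subset_univ _))) (hu.contDiffOn.sub hHc)
    (fun x hx => by simp only [Pi.sub_apply, hu.const₁ x hx])
    (fun x hx => by simp only [Pi.sub_apply, hu.const₂ x hx]) (tendsto_zero_of_isBigO huinf)
  have e₁ := hh.flux₁
  have e₂ := hh.flux₂
  change flux (outside _ _ _ _) _ _ _ = _ at e₁ e₂ hflH₁ hflH₂
  rw [e₁, e₂] at Hh
  rw [hflH₁, hflH₂] at Hu
  obtain ⟨Hh₁, Hh₂⟩ := Hh
  obtain ⟨Hu₁, Hu₂⟩ := Hu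
  have hlow : ∀ ξ, 0 < ξ → ξ ≤ s → ∀ m : ℕ, ξ * ((m : ℝ) + 1) ≤ m * s + ξ := by
    intro ξ _ hξs m
    have : (m : ℝ) * ξ ≤ m * s := by gcongr
    linarith
  have hs₁ : ξ₁ ≤ s := le_add_of_nonneg_right p₂.le
  have hs₂ : ξ₂ ≤ s := le_add_of_nonneg_left p₁.le
  have sP := (summable_charge_one ha (p₁.trans_le hs₁)
    (x := fun m => (m + 1) * s) (fun m => by rw [mul_comm])).hasSum.tendsto_sum_nat
  have sQ₁ := (summable_charge_one ha p₁ (hlow ξ₁ p₁ hs₁)).hasSum.tendsto_sum_nat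
  have sQ₂ := (summable_charge_one ha p₂ (hlow ξ₂ p₂ hs₂)).hasSum.tendsto_sum_nat
  set P := ∑' m : ℕ, charge a (fun _ => 1) (((m : ℝ) + 1) * s)
  set Q₁ := ∑' m : ℕ, charge a (fun _ => 1) ((m : ℝ) * s + ξ₁)
  set Q₂ := ∑' m : ℕ, charge a (fun _ => 1) ((m : ℝ) * s + ξ₂)
  have hconst : ∀ (b b' ξ : ℝ) (N : ℕ),
      ∑ m ∈ Finset.range N, imageTerm a s ξ (fun _ => b) (fun _ => b') m =
        b * ∑ m ∈ Finset.range N, charge a (fun _ => 1) (((m : ℝ) + 1) * s) -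
        b' * ∑ m ∈ Finset.range N, charge a (fun _ => 1) ((m : ℝ) * s + ξ) := by
    intro b b' ξ N
    rw [Finset.mul_sum, Finset.mul_sum, ← Finset.sum_sub_distrib]
    refine Finset.sum_congr rfl fun m _ => ?_
    simp only [imageTerm, charge]
    ring
  have hsubst : ∀ (b b' ξ : ℝ) (U V : ℝ → ℝ) (N : ℕ),
      ∑ m ∈ Finset.range N, imageTerm a s ξ (fun t => b - U t) (fun t => b' - V t) m =
        ∑ m ∈ Finset.range N, imageTerm a s ξ (fun _ => b) (fun _ => b') m -
        ∑ m ∈ Finset.range N, imageTerm a s ξ U V m := by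
    intro b b' ξ U V N
    rw [← Finset.sum_sub_distrib]
    refine Finset.sum_congr rfl fun m _ => ?_
    simp only [imageTerm, charge]
    ring
  have l₁ : ∀ b b', Tendsto (fun N => ∑ m ∈ Finset.range N,
      imageTerm a s ξ₁ (fun _ => b) (fun _ => b') m) atTop (𝓝 (b * P - b' * Q₁)) := by
    intro b b'
    simp only [hconst]
    exact (sP.const_mul b).sub (sQ₁.const_mul b')
  have l₂ : ∀ b b', Tendsto (fun N => ∑ m ∈ Finset.range N,
      imageTerm a s ξ₂ (fun _ => b) (fun _ => b') m) atTop (𝓝 (b * P - b' * Q₂)) := by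
    intro b b'
    simp only [hconst]
    exact (sP.const_mul b).sub (sQ₂.const_mul b')
  have q₁ := tendsto_nhds_unique Hh₁ ((l₁ β₂ β₁).const_mul (4 * π))
  have q₂ := tendsto_nhds_unique Hh₂ ((l₂ β₁ β₂).const_mul (4 * π))
  have hpi : (4 * π) ≠ 0 := by positivity
  have hdiv : ∀ F : ℕ → ℝ, Tendsto (fun N => 4 * π * F N) atTop (𝓝 0) →
      Tendsto F atTop (𝓝 0) := by
    intro F hF
    have := hF.const_mul (4 * π)⁻¹
    simpa only [inv_mul_cancel_left₀ hpi, mul_zero] using this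
  have hS₁ : Tendsto (fun N => ∑ m ∈ Finset.range N, imageTerm a s ξ₁ G G' m) atTop
      (𝓝 (α₂ * P - α₁ * Q₁)) := by
    have h1 := (l₁ α₂ α₁).sub (hdiv _ Hu₁)
    rw [sub_zero] at h1
    refine h1.congr fun N => ?_
    change _ - ∑ m ∈ Finset.range N, imageTerm a s ξ₁ (fun t => α₂ - G t) (fun t => α₁ - G' t) m = _
    rw [hsubst, sub_sub_cancel]
  have hS₂ : Tendsto (fun N => ∑ m ∈ Finset.range N, imageTerm a s ξ₂ G' G m) atTop
      (𝓝 (α₁ * P - α₂ * Q₂)) := by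
    have h1 := (l₂ α₁ α₂).sub (hdiv _ Hu₂)
    rw [sub_zero] at h1
    refine h1.congr fun N => ?_
    change _ - ∑ m ∈ Finset.range N, imageTerm a s ξ₂ (fun t => α₁ - G' t) (fun t => α₂ - G t) m = _
    rw [hsubst, sub_sub_cancel]
  refine ⟨1 * P - 1 * Q₁, 1 * P - 1 * Q₂, _, _, l₁ 1 1, l₂ 1 1, hS₁, hS₂, fun hT => ?_⟩
  simp only [one_mul] at hT ⊢
  -- `P`, `-Q₁`, `-Q₂` are the entries of the matrix; the fluxes `1` and `-1` of `h` add up to zero,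
  -- which makes `(β₁, β₂)` proportional to `(T₂, -T₁)`
  have k₀ : β₁ * (P - Q₁) + β₂ * (P - Q₂) = 0 := by
    have : 4 * π * (β₁ * (P - Q₁) + β₂ * (P - Q₂)) = 0 := by linear_combination -q₁ - q₂
    exact (mul_eq_zero.1 this).resolve_left hpi
  have hne : β₁ ≠ β₂ := by
    intro hβ
    rw [hβ, ← mul_add] at k₀
    have h0 := (mul_eq_zero.1 k₀).resolve_right hT
    rw [hβ, h0] at q₁
    simp at q₁
  refine ⟨hne, ?_⟩
  rw [div_eq_div_iff (sub_ne_zero.2 hne) hT]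
  have q₁' : (4 * π) * (β₂ * P - β₁ * Q₁) = 1 := q₁.symm
  have q₂' : (4 * π) * (β₁ * P - β₂ * Q₂) = -1 := q₂.symm
  linear_combination (-α₁ * (P - Q₁ + (P - Q₂))) * q₁' - (α₂ * (P - Q₁ + (P - Q₂))) * q₂' +
    4 * π * (α₂ * P - α₁ * Q₁ + (α₁ * P - α₂ * Q₂)) * k₀

/-- Perturbation of the quotient which gives the concentration factor. -/
lemma exists_quotient_bound {t₁ t₂ s₁ s₂ : ℝ} (ht : t₁ + t₂ ≠ 0) :
    ∃ C, ∃ δ₀ > 0, ∀ δ ≤ δ₀, ∀ T₁ T₂ S₁ S₂ : ℝ, |T₁ - t₁| ≤ δ → |T₂ - t₂| ≤ δ → |S₁ - s₁| ≤ δ →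
      |S₂ - s₂| ≤ δ → T₁ + T₂ ≠ 0 ∧
      |4 * π * (T₂ * S₁ - T₁ * S₂) / (T₁ + T₂) - 4 * π * (t₂ * s₁ - t₁ * s₂) / (t₁ + t₂)| ≤
        C * δ := by
  set d := |t₁ + t₂| with hd
  have hd0 : 0 < d := abs_pos.2 ht
  set B := |t₁| + |t₂| + |s₁| + |s₂| + 1 with hB
  have hB0 : 0 < B := by positivity
  set n := t₂ * s₁ - t₁ * s₂ with hn
  refine ⟨4 * π * ((4 * B * d + 2 * |n|) / (d * (d / 2))), min 1 (d / 4), by positivity,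
    fun δ hδ T₁ T₂ S₁ S₂ hT₁ hT₂ hS₁ hS₂ => ?_⟩
  have hδ1 : δ ≤ 1 := hδ.trans (min_le_left _ _)
  have hδ2 : δ ≤ d / 4 := hδ.trans (min_le_right _ _)
  have hδ0 : 0 ≤ δ := (abs_nonneg _).trans hT₁
  have hD : |(T₁ + T₂) - (t₁ + t₂)| ≤ 2 * δ := by
    have : (T₁ + T₂) - (t₁ + t₂) = (T₁ - t₁) + (T₂ - t₂) := by ring
    rw [this]
    exact (abs_add_le _ _).trans (by linarith)
  have hDlow : d / 2 ≤ |T₁ + T₂| := by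
    have := abs_sub_abs_le_abs_sub (t₁ + t₂) (T₁ + T₂)
    rw [abs_sub_comm] at this
    linarith
  have hT : T₁ + T₂ ≠ 0 := abs_pos.1 (by linarith)
  refine ⟨hT, ?_⟩
  have hprod : ∀ x y X Y : ℝ, |x| + |y| + 1 ≤ B → |X - x| ≤ δ → |Y - y| ≤ δ →
      |X * Y - x * y| ≤ 2 * B * δ := by
    intro x y X Y hxy hX hY
    have e : X * Y - x * y = (X - x) * (Y - y) + (X - x) * y + x * (Y - y) := by ring
    have b1 : |(X - x) * (Y - y)| ≤ δ * 1 := by rw [abs_mul]; gcongr; exact hY.trans hδ1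
    have b2 : |(X - x) * y| ≤ δ * B := by
      rw [abs_mul]; gcongr; linarith [abs_nonneg x]
    have b3 : |x * (Y - y)| ≤ |x| * δ := by rw [abs_mul]; gcongr
    have b4 : |x| * δ + 1 * δ ≤ B * δ := by
      rw [← add_mul]; gcongr; linarith [abs_nonneg y]
    rw [e]
    have c1 := abs_add_le ((X - x) * (Y - y) + (X - x) * y) (x * (Y - y))
    have c2 := abs_add_le ((X - x) * (Y - y)) ((X - x) * y)
    linarith
  have hN : |(T₂ * S₁ - T₁ * S₂) - n| ≤ 4 * B * δ := by
    have e : (T₂ * S₁ - T₁ * S₂) - n = (T₂ * S₁ - t₂ * s₁) - (T₁ * S₂ - t₁ * s₂) := by rw [hn]; ring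
    have h1 := hprod t₂ s₁ T₂ S₁
      (by rw [hB]; linarith [abs_nonneg t₁, abs_nonneg s₂]) hT₂ hS₁
    have h2 := hprod t₁ s₂ T₁ S₂
      (by rw [hB]; linarith [abs_nonneg t₂, abs_nonneg s₁]) hT₁ hS₂
    rw [e]
    refine (abs_sub _ _).trans ?_
    linarith
  have e : 4 * π * (T₂ * S₁ - T₁ * S₂) / (T₁ + T₂) - 4 * π * n / (t₁ + t₂) =
      4 * π * ((((T₂ * S₁ - T₁ * S₂) - n) * (t₁ + t₂) - n * ((T₁ + T₂) - (t₁ + t₂))) /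
        ((t₁ + t₂) * (T₁ + T₂))) := by
    field_simp; ring
  rw [e, abs_mul, abs_of_pos (by positivity : 0 < 4 * π), mul_assoc (4 * π) _ δ, abs_div,
    abs_mul (t₁ + t₂), div_mul_eq_mul_div]
  gcongr
  refine (abs_sub _ _).trans ?_
  rw [abs_mul, abs_mul]
  calc _ ≤ 4 * B * δ * d + |n| * (2 * δ) := by gcongr
    _ = _ := by ring

lemma contDiff_axis {H : E3 → ℝ} (hH : HarmonicOnNhd H univ) :
    ContDiff ℝ 2 fun t => H (axisPoint t) := by
  have hC2 : ContDiff ℝ 2 H := contDiff_iff_contDiffAt.2 fun x => (hH x (mem_univ x)).1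
  have h : ContDiff ℝ 2 fun t : ℝ => t • EuclideanSpace.single (2 : Fin 3) (1 : ℝ) := by fun_prop
  simpa only [axisPoint_eq] using! hC2.comp h

lemma taylorCoeff_succ (H : E3 → ℝ) (k : ℕ) : taylorCoeff H (k + 1) =
    iteratedDeriv (k + 1) (fun t => H (axisPoint t)) 0 / ((k + 1).factorial : ℝ) := by
  have h : deriv (fun t => H (axisPoint t) - H 0) = deriv fun t => H (axisPoint t) :=
    funext fun t => deriv_sub_const (H 0)
  rw [taylorCoeff, iteratedDeriv_succ', iteratedDeriv_succ', h]

lemma hasSum_taylorCoeff {H : E3 → ℝ} (hH : HarmonicOnNhd H univ) (t : ℝ) :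
    HasSum (fun k : ℕ => taylorCoeff H (k + 1) * t ^ (k + 1)) (H (axisPoint t) - H 0) := by
  have h := (hasSum_nat_add_iff' 1).2 (hasSum_taylor_axis hH t)
  simp only [Finset.sum_range_one, iteratedDeriv_zero, axisPoint_zero, Nat.factorial_zero,
    Nat.cast_one, div_one, pow_zero, mul_one] at h
  simpa only [taylorCoeff_succ] using h

/-- The flat sums for the potential `1` are values of `ψ + γ`. -/
lemma hasSum_flatTerm_one {e : ℝ} (R : ℝ) (he : 0 < e) :
    HasSum (flatTerm R e (fun _ => 1) (fun _ => 1)) (R * (psi 0 e + eulerMascheroniConstant)) := by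
  have h : flatTerm R e (fun _ => 1) (fun _ => 1) =
      fun m : ℕ => R * (1 / ((m : ℝ) + 1) - 1 / (m + e)) := by
    funext m
    rw [flatTerm]
    ring
  rw [h]
  exact (hasSum_psi_zero he).mul_left R

/-- All terms of the series for `ψ(e) + γ` are negative if `0 < e < 1`. -/
lemma psi_zero_add_neg {e : ℝ} (he : 0 < e) (he1 : e < 1) :
    psi 0 e + eulerMascheroniConstant < 0 := by
  have h := hasSum_psi_zero he
  have hle : ∀ m : ℕ, 1 / ((m : ℝ) + 1) - 1 / (m + e) ≤ 0 := fun m => by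
    rw [sub_nonpos]; gcongr
  have h0 : 1 / (((0 : ℕ) : ℝ) + 1) - 1 / ((0 : ℕ) + e) < 0 := by
    rw [sub_neg]
    refine one_div_lt_one_div_of_lt (by positivity) ?_
    simpa using he1
  rw [← h.tsum_eq]
  have := h.summable.tsum_lt_tsum hle h0 summable_zero
  simpa using this

/-! ### The concentration factor -/

section

variable {r₁ r₂ : ℝ} {H : E3 → ℝ}

lemma term₁_eq (m : ℕ) : term₁ r₁ r₂ H m =
    flatTerm (rt r₁ r₂) (rt₂ r₁ r₂) (fun t => H (axisPoint t)) (fun t => H (axisPoint (-t))) m := by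
  rw [term₁, flatTerm, neg_div]

lemma term₂_eq (m : ℕ) : term₂ r₁ r₂ H m =
    -flatTerm (rt r₁ r₂) (rt₁ r₁ r₂) (fun t => H (axisPoint (-t))) (fun t => H (axisPoint t)) m := by
  rw [term₂, flatTerm, neg_div]; ring

lemma deriv_comp_neg_zero (G : ℝ → ℝ) : deriv (fun t => G (-t)) 0 = -deriv G 0 := by
  rw [deriv_comp_neg, neg_zero]

/-- The sums over image charges for the potential `H` on the axis, seen from either sphere. -/
lemma imageTerm_asymptotics_axis (h₁ : 0 < r₁) (h₂ : 0 < r₂) (hH : HarmonicOnNhd H univ) :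
    ∃ C, 0 ≤ C ∧ ∃ a₀ > 0, ∀ a ∈ Ioo 0 a₀,
      let s := arsinh (a / r₁) + arsinh (a / r₂)
      let G := fun t => H (axisPoint t)
      let G' := fun t => H (axisPoint (-t))
      ∀ T₁ T₂ S₁ S₂ : ℝ,
      Tendsto (fun N => ∑ m ∈ Finset.range N,
        imageTerm a s (arsinh (a / r₁)) (fun _ => 1) (fun _ => 1) m) atTop (𝓝 T₁) →
      Tendsto (fun N => ∑ m ∈ Finset.range N,
        imageTerm a s (arsinh (a / r₂)) (fun _ => 1) (fun _ => 1) m) atTop (𝓝 T₂) →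
      Tendsto (fun N => ∑ m ∈ Finset.range N,
        imageTerm a s (arsinh (a / r₁)) G G' m) atTop (𝓝 S₁) →
      Tendsto (fun N => ∑ m ∈ Finset.range N,
        imageTerm a s (arsinh (a / r₂)) G' G m) atTop (𝓝 S₂) →
      |T₁ - rt r₁ r₂ * (psi 0 (rt₂ r₁ r₂) + eulerMascheroniConstant)| ≤
        C * (a ^ 2 * (1 + |log a|)) ∧
      |T₂ - rt r₁ r₂ * (psi 0 (rt₁ r₁ r₂) + eulerMascheroniConstant)| ≤
        C * (a ^ 2 * (1 + |log a|)) ∧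
      |S₁ - ∑' m, term₁ r₁ r₂ H m| ≤ C * (a ^ 2 * (1 + |log a|)) ∧
      |S₂ - -∑' m, term₂ r₁ r₂ H m| ≤ C * (a ^ 2 * (1 + |log a|)) := by
  have hG := contDiff_axis hH
  have hG' : ContDiff ℝ 2 fun t => H (axisPoint (-t)) := hG.comp contDiff_neg
  have e₂ : r₂ * r₁ / (r₂ + r₁) = rt r₁ r₂ := by rw [rt, mul_comm, add_comm]
  have e₁ : r₁ / (r₂ + r₁) = rt₁ r₁ r₂ := by rw [rt₁, add_comm]
  have hd := deriv_comp_neg_zero fun t => H (axisPoint t)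
  obtain ⟨_, C₁, a₁, ha₁, A₁⟩ := imageTerm_asymptotics h₁ h₂
    (contDiff_const (c := (1 : ℝ))) (contDiff_const (c := (1 : ℝ))) rfl (by simp)
  obtain ⟨_, C₂, a₂, ha₂, A₂⟩ := imageTerm_asymptotics h₂ h₁
    (contDiff_const (c := (1 : ℝ))) (contDiff_const (c := (1 : ℝ))) rfl (by simp)
  obtain ⟨_, C₃, a₃, ha₃, A₃⟩ := imageTerm_asymptotics h₁ h₂ hG hG' (by simp) hd
  obtain ⟨_, C₄, a₄, ha₄, A₄⟩ := imageTerm_asymptotics h₂ h₁ hG' hG (by simp)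
    (by rw [hd, neg_neg])
  rw [e₁, e₂] at A₂ A₄
  refine ⟨|C₁| + |C₂| + |C₃| + |C₄|, by positivity, min (min a₁ a₂) (min a₃ a₄), by positivity,
    fun a ha => ?_⟩
  intro s G G' T₁ T₂ S₁ S₂ k₁ k₂ k₃ k₄
  have b₁ : a < a₁ := ha.2.trans_le ((min_le_left _ _).trans (min_le_left _ _))
  have b₂ : a < a₂ := ha.2.trans_le ((min_le_left _ _).trans (min_le_right _ _))
  have b₃ : a < a₃ := ha.2.trans_le ((min_le_right _ _).trans (min_le_left _ _))
  have b₄ : a < a₄ := ha.2.trans_le ((min_le_right _ _).trans (min_le_right _ _))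
  have hs : s = arsinh (a / r₂) + arsinh (a / r₁) := add_comm _ _
  rw [hs] at k₂ k₄
  have hpos : 0 < r₁ + r₂ := by linarith
  have n₂ : 0 < rt₂ r₁ r₂ := div_pos h₂ hpos
  have n₁ : 0 < rt₁ r₁ r₂ := div_pos h₁ hpos
  have c₁ := abs_nonneg C₁
  have c₂ := abs_nonneg C₂
  have c₃ := abs_nonneg C₃
  have c₄ := abs_nonneg C₄
  have hx : 0 ≤ a ^ 2 * (1 + |log a|) := by positivity
  have weaken : ∀ C y : ℝ, y ≤ C * (a ^ 2 * (1 + |log a|)) →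
      C ≤ |C₁| + |C₂| + |C₃| + |C₄| →
      y ≤ (|C₁| + |C₂| + |C₃| + |C₄|) * (a ^ 2 * (1 + |log a|)) := fun C y hy hC =>
    hy.trans (mul_le_mul_of_nonneg_right hC hx)
  refine ⟨?_, ?_, ?_, ?_⟩
  · refine weaken C₁ _ ?_ (by linarith [le_abs_self C₁])
    rw [← (hasSum_flatTerm_one _ n₂).tsum_eq]
    exact A₁ a ⟨ha.1, b₁⟩ T₁ k₁
  · refine weaken C₂ _ ?_ (by linarith [le_abs_self C₂])
    rw [← (hasSum_flatTerm_one _ n₁).tsum_eq]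
    exact A₂ a ⟨ha.1, b₂⟩ T₂ k₂
  · refine weaken C₃ _ ?_ (by linarith [le_abs_self C₃])
    simp only [term₁_eq]
    exact A₃ a ⟨ha.1, b₃⟩ S₁ k₃
  · refine weaken C₄ _ ?_ (by linarith [le_abs_self C₄])
    simp only [term₂_eq, tsum_neg, neg_neg]
    exact A₄ a ⟨ha.1, b₄⟩ S₂ k₄

lemma summable_terms (h₁ : 0 < r₁) (h₂ : 0 < r₂) (hH : HarmonicOnNhd H univ) :
    Summable (term₁ r₁ r₂ H) ∧ Summable (term₂ r₁ r₂ H) := by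
  have hG := contDiff_axis hH
  have hG' : ContDiff ℝ 2 fun t => H (axisPoint (-t)) := hG.comp contDiff_neg
  have hd := deriv_comp_neg_zero fun t => H (axisPoint t)
  have A₁ := (imageTerm_asymptotics h₁ h₂ hG hG' (by simp) hd).1
  have A₂ := (imageTerm_asymptotics h₂ h₁ hG' hG (by simp) (by rw [hd, neg_neg])).1
  have e₂ : r₂ * r₁ / (r₂ + r₁) = rt r₁ r₂ := by rw [rt, mul_comm, add_comm]
  have e₁ : r₁ / (r₂ + r₁) = rt₁ r₁ r₂ := by rw [rt₁, add_comm]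
  rw [e₁, e₂] at A₂
  exact ⟨A₁.congr fun m => (term₁_eq m).symm, A₂.neg.congr fun m => (term₂_eq m).symm⟩

lemma psi_neg (h₁ : 0 < r₁) (h₂ : 0 < r₂) :
    psi 0 (rt₁ r₁ r₂) + eulerMascheroniConstant < 0 ∧
      psi 0 (rt₂ r₁ r₂) + eulerMascheroniConstant < 0 := by
  have hpos : 0 < r₁ + r₂ := by linarith
  exact ⟨psi_zero_add_neg (div_pos h₁ hpos) ((div_lt_one hpos).2 (by linarith)),
    psi_zero_add_neg (div_pos h₂ hpos) ((div_lt_one hpos).2 (by linarith))⟩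

/-- The value `C_H` as a quotient of limits of sums over image charges. -/
lemma CH_eq (h₁ : 0 < r₁) (h₂ : 0 < r₂) :
    let t₁ := rt r₁ r₂ * (psi 0 (rt₂ r₁ r₂) + eulerMascheroniConstant)
    let t₂ := rt r₁ r₂ * (psi 0 (rt₁ r₁ r₂) + eulerMascheroniConstant)
    t₁ + t₂ ≠ 0 ∧ CH r₁ r₂ H =
      4 * π * (t₂ * ∑' m, term₁ r₁ r₂ H m - t₁ * -∑' m, term₂ r₁ r₂ H m) / (t₁ + t₂) := by
  intro t₁ t₂
  obtain ⟨n₁, n₂⟩ := psi_neg h₁ h₂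
  have hR : 0 < rt r₁ r₂ := by rw [rt]; positivity
  have hden : psi 0 (rt₁ r₁ r₂) + psi 0 (rt₂ r₁ r₂) + 2 * eulerMascheroniConstant ≠ 0 := by
    linarith
  have hsum : t₁ + t₂ = rt r₁ r₂ *
      (psi 0 (rt₁ r₁ r₂) + psi 0 (rt₂ r₁ r₂) + 2 * eulerMascheroniConstant) := by
    simp only [t₁, t₂]; ring
  have hne : t₁ + t₂ ≠ 0 := by rw [hsum]; exact mul_ne_zero hR.ne' hden
  refine ⟨hne, ?_⟩
  rw [hsum, CH, mu₁, mu₂]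
  simp only [t₁, t₂]
  field_simp
  ring

/-- The expansion of `C_H` in the Taylor coefficients of `H` on the axis. -/
lemma hasSum_CH (h₁ : 0 < r₁) (h₂ : 0 < r₂) (hH : HarmonicOnNhd H univ) :
    HasSum (fun k : ℕ => taylorCoeff H (k + 1) * Q (k + 1) r₁ r₂) (CH r₁ r₂ H) := by
  have hpos : 0 < r₁ + r₂ := by linarith
  have hR : 0 < rt r₁ r₂ := by rw [rt]; positivity
  have m₂ : rt₂ r₁ r₂ ∈ Ioc 0 1 := ⟨div_pos h₂ hpos, (div_le_one hpos).2 (by linarith)⟩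
  have m₁ : rt₁ r₁ r₂ ∈ Ioc 0 1 := ⟨div_pos h₁ hpos, (div_le_one hpos).2 (by linarith)⟩
  have H₁ := hasSum_flatTerm_taylor (hasSum_taylorCoeff hH) hR m₂
  have hneg : ∀ t, HasSum (fun k : ℕ => (-1) ^ (k + 1) * taylorCoeff H (k + 1) * t ^ (k + 1))
      (H (axisPoint (-t)) - H 0) := by
    intro t
    convert hasSum_taylorCoeff hH (-t) using 2 with k
    rw [neg_pow t]
    ring
  have H₂ := hasSum_flatTerm_taylor (G := fun t => H (axisPoint (-t))) hneg hR m₁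
  simp only [neg_neg] at H₂
  have hS₁ : ∑' m, flatTerm (rt r₁ r₂) (rt₂ r₁ r₂) (fun t => H (axisPoint t))
      (fun t => H (axisPoint (-t))) m = ∑' m, term₁ r₁ r₂ H m :=
    tsum_congr fun m => (term₁_eq m).symm
  have hS₂ : ∑' m, flatTerm (rt r₁ r₂) (rt₁ r₁ r₂) (fun t => H (axisPoint (-t)))
      (fun t => H (axisPoint t)) m = -∑' m, term₂ r₁ r₂ H m := by
    rw [← tsum_neg]
    exact tsum_congr fun m => by rw [term₂_eq, neg_neg]
  rw [hS₁] at H₁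
  rw [hS₂] at H₂
  obtain ⟨n₁, n₂⟩ := psi_neg h₁ h₂
  have hden : psi 0 (rt₁ r₁ r₂) + psi 0 (rt₂ r₁ r₂) + 2 * eulerMascheroniConstant ≠ 0 := by
    linarith
  -- this makes the contributions of `H 0` to the two series cancel
  have hμ : mu₁ r₁ r₂ * (psi 0 (rt₂ r₁ r₂) + eulerMascheroniConstant) =
      mu₂ r₁ r₂ * (psi 0 (rt₁ r₁ r₂) + eulerMascheroniConstant) := by
    rw [mu₁, mu₂]; ring
  have h := (H₁.mul_left (4 * π * mu₁ r₁ r₂)).sub (H₂.mul_left (4 * π * mu₂ r₁ r₂))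
  have hval : CH r₁ r₂ H = 4 * π * mu₁ r₁ r₂ * (∑' m, term₁ r₁ r₂ H m -
        H 0 * (rt r₁ r₂ * (psi 0 (rt₂ r₁ r₂) + eulerMascheroniConstant))) -
      4 * π * mu₂ r₁ r₂ * (-∑' m, term₂ r₁ r₂ H m -
        H 0 * (rt r₁ r₂ * (psi 0 (rt₁ r₁ r₂) + eulerMascheroniConstant))) := by
    rw [CH]
    linear_combination (4 * π * H 0 * rt r₁ r₂) * hμ
  have hterm : (fun k : ℕ => taylorCoeff H (k + 1) * Q (k + 1) r₁ r₂) = fun k : ℕ =>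
      4 * π * mu₁ r₁ r₂ * (taylorCoeff H (k + 1) * (rt r₁ r₂ ^ (k + 2) *
        ((riemannZeta (((k + 1 : ℕ) : ℂ) + 1)).re +
          psi (k + 1) (rt₂ r₁ r₂) / ((k + 1).factorial : ℝ)))) -
      4 * π * mu₂ r₁ r₂ * ((-1) ^ (k + 1) * taylorCoeff H (k + 1) * (rt r₁ r₂ ^ (k + 2) *
        ((riemannZeta (((k + 1 : ℕ) : ℂ) + 1)).re +
          psi (k + 1) (rt₁ r₁ r₂) / ((k + 1).factorial : ℝ)))) := by
    funext k
    rw [Q]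
    ring
  rw [hval, hterm]
  exact h

/-- The concentration factor converges to `C_H` with error `O(ε |log ε|)`; for small `ε` the sums
`T₁ + T₂` are nonzero, which forces `β₁ ≠ β₂`. -/
lemma concentration_asymptotics (h₁ : 0 < r₁) (h₂ : 0 < r₂) (hH : HarmonicOnNhd H univ) :
    ∃ K : ℝ, ∀ᶠ ε in 𝓝[>] (0 : ℝ), ∀ (u h : E3 → ℝ) (α₁ α₂ β₁ β₂ : ℝ),
      IsElectricPotential r₁ r₂ ε H u α₁ α₂ → IsSingularFunction r₁ r₂ ε h β₁ β₂ →
        β₁ ≠ β₂ ∧ |(α₁ - α₂) / (β₁ - β₂) - CH r₁ r₂ H| ≤ K * (ε * |log ε|) := by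
  obtain ⟨hne, hCH⟩ := CH_eq (H := H) h₁ h₂
  obtain ⟨C, hC, a₀, ha₀, hasymp⟩ := imageTerm_asymptotics_axis h₁ h₂ hH
  obtain ⟨C', δ₀, hδ₀, hquot⟩ := exists_quotient_bound (s₁ := ∑' m, term₁ r₁ r₂ H m)
    (s₂ := -∑' m, term₂ r₁ r₂ H m) hne
  obtain ⟨K, hK, hfoci⟩ := exists_foci h₁ h₂
  refine ⟨C' * (C * K), ?_⟩
  have hlim : Tendsto (fun ε : ℝ => C * (K * (ε * |log ε|))) (𝓝[>] 0) (𝓝 0) := by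
    have h := ((Real.continuous_mul_log.tendsto 0).mono_left
      (nhdsWithin_le_nhds (s := Ioi (0 : ℝ)))).abs
    rw [zero_mul, abs_zero] at h
    have h2 := (h.const_mul K).const_mul C
    rw [mul_zero, mul_zero] at h2
    refine h2.congr' ?_
    filter_upwards [self_mem_nhdsWithin] with ε hε
    have hε' : (0 : ℝ) < ε := hε
    rw [abs_mul, abs_of_pos hε']
  filter_upwards [hfoci a₀ ha₀, hlim.eventually (ge_mem_nhds hδ₀), self_mem_nhdsWithin]
    with ε ⟨a, ha, hc₁, hc₂, hle⟩ hδ hε u h α₁ α₂ β₁ β₂ hu hh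
  obtain ⟨T₁, T₂, S₁, S₂, k₁, k₂, k₃, k₄, hrel⟩ := exists_charge_sums h₁ h₂ hε ha.1 hc₁ hc₂ hH hu hh
  obtain ⟨b₁, b₂, b₃, b₄⟩ := hasymp a ha T₁ T₂ S₁ S₂ k₁ k₂ k₃ k₄
  have hle' : C * (a ^ 2 * (1 + |log a|)) ≤ C * (K * (ε * |log ε|)) := by gcongr
  obtain ⟨hT, hb⟩ := hquot _ hδ T₁ T₂ S₁ S₂ (b₁.trans hle') (b₂.trans hle') (b₃.trans hle')
    (b₄.trans hle')
  obtain ⟨hβ, hratio⟩ := hrel hT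
  refine ⟨hβ, ?_⟩
  rw [hratio, hCH]
  refine hb.trans (le_of_eq ?_)
  ring

end

end TwoSpheres

end

theorem theorem2p1 (r₁ r₂ : ℝ) (hr₁ : 0 < r₁) (hr₂ : 0 < r₂) (H : TwoSpheres.E3 → ℝ)
    (hH : InnerProductSpace.HarmonicOnNhd H Set.univ) :
    -- the two series that define `C_H` converge
    (Summable (TwoSpheres.term₁ r₁ r₂ H) ∧ Summable (TwoSpheres.term₂ r₁ r₂ H)) ∧
    -- (a)
    (∃ K : ℝ, ∀ᶠ ε in 𝓝[>] (0 : ℝ), ∀ (u h : TwoSpheres.E3 → ℝ) (α₁ α₂ β₁ β₂ : ℝ),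
      TwoSpheres.IsElectricPotential r₁ r₂ ε H u α₁ α₂ →
      TwoSpheres.IsSingularFunction r₁ r₂ ε h β₁ β₂ →
        β₁ ≠ β₂ ∧
        |(α₁ - α₂) / (β₁ - β₂) - TwoSpheres.CH r₁ r₂ H| ≤ K * (ε * |Real.log ε|)) ∧
    -- (b)
    (∀ t : ℝ, HasSum (fun k : ℕ => TwoSpheres.taylorCoeff H (k + 1) * t ^ (k + 1))
      (H (TwoSpheres.axisPoint t) - H 0)) ∧
    HasSum (fun k : ℕ => TwoSpheres.taylorCoeff H (k + 1) * TwoSpheres.Q (k + 1) r₁ r₂)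
      (TwoSpheres.CH r₁ r₂ H) := by
  exact ⟨TwoSpheres.summable_terms hr₁ hr₂ hH, TwoSpheres.concentration_asymptotics hr₁ hr₂ hH,
    TwoSpheres.hasSum_taylorCoeff hH, TwoSpheres.hasSum_CH hr₁ hr₂ hH⟩
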